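/- There are a program $P$ for the unit-cost word RAM and constants $c,d$ such that the following holds for all strings $A,B,C$ over any finite alphabet. Let $|A|=M$ and $|B|=N$, and let $m=|\mathit{RLE}(A)|$ and $n=|\mathit{RLE}(B)|$ be the numbers of maximal runs of equal characters in $A$ and $B$. Call a string an STR-IC-LCS of $A,B,C$ if it is a longest string among those that are subsequences of both $A$ and $B$ and contain $C$ as a (contiguous) substring. If the characters are represented by distinct machine words and the word length is at least $d\log_2(M+N+|C|+2)$ bits, then $P$, given $A,B,C$ and their lengths, computes the length of an STR-IC-LCS of $A,B,C$, or reports that there is none, in at most $c\,(mN+nM+1)$ steps; that is, in $O(mN+nM)$ time when $A$ and $B$ are non-empty. The program and the constants depend neither on the strings nor on the alphabet nor on the word length. -/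

import Mathlib

/-! ### Strings: run-length encoding and the constrained LCS -/

/-- The run-length encoding of a string: the list of its maximal runs from left to right,
each given by its character and its length. -/
def rle {α : Type*} [DecidableEq α] : List α → List (α × ℕ)
  | [] => []
  | a :: l =>
    match rle l with
    | [] => [(a, 1)]
    | (b, k) :: t => if a = b then (b, k + 1) :: t else (a, 1) :: (b, k) :: t

/-- `Z` is a common subsequence of `A` and `B` that contains `C` as a (contiguous) substring. -/
def IsSTRICCommonSubseq {α : Type*} (A B C Z : List α) : Prop :=
  Z.Sublist A ∧ Z.Sublist B ∧ C <:+: Z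

/-- `Z` is an STR-IC-LCS of `A`, `B`, `C`: a longest string among the common subsequences of
`A` and `B` that contain `C` as a substring. -/
def IsSTRICLCS {α : Type*} (A B C Z : List α) : Prop :=
  IsSTRICCommonSubseq A B C Z ∧
    ∀ Z' : List α, IsSTRICCommonSubseq A B C Z' → Z'.length ≤ Z.length

/-! ### The machine model: a word RAM

A program is a structured imperative program over finitely many registers and finitely many
arrays (those that are named in the program text), with random access to the arrays. A word has
`w` bits: every value that a program computes, including every intermediate value, must be
smaller than `2 ^ w`; otherwise execution is stuck and there is no terminating run. Every
operation on words (constant, register read, array read, addition, truncated subtraction,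
multiplication, comparison, Boolean connective, register write, array write, branch) takes
one unit of time. -/

namespace WordRAM

/-- A memory configuration: the contents of the registers and of the arrays. -/
structure State where
  reg : ℕ → ℕ
  arr : ℕ → ℕ → ℕ

/-- Arithmetic expressions. `get a e` reads the cell of the array `a` whose index is the value
of `e`; the names of registers and arrays are fixed by the program text. -/
inductive Expr where
  | const (k : ℕ)
  | reg (x : ℕ)
  | get (a : ℕ) (e : Expr)
  | add (e₁ e₂ : Expr)
  | sub (e₁ e₂ : Expr)
  | mul (e₁ e₂ : Expr)

/-- The value of an expression (subtraction is truncated at `0`). -/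
def Expr.eval (s : State) : Expr → ℕ
  | const k => k
  | reg x => s.reg x
  | get a e => s.arr a (e.eval s)
  | add e₁ e₂ => e₁.eval s + e₂.eval s
  | sub e₁ e₂ => e₁.eval s - e₂.eval s
  | mul e₁ e₂ => e₁.eval s * e₂.eval s

/-- All values that arise during the evaluation of the expression fit into `w`-bit words. -/
def Expr.Fits (w : ℕ) (s : State) : Expr → Prop
  | const k => k < 2 ^ w
  | reg x => s.reg x < 2 ^ w
  | get a e => e.Fits w s ∧ s.arr a (e.eval s) < 2 ^ w
  | add e₁ e₂ => e₁.Fits w s ∧ e₂.Fits w s ∧ e₁.eval s + e₂.eval s < 2 ^ w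
  | sub e₁ e₂ => e₁.Fits w s ∧ e₂.Fits w s
  | mul e₁ e₂ => e₁.Fits w s ∧ e₂.Fits w s ∧ e₁.eval s * e₂.eval s < 2 ^ w

/-- The time to evaluate an expression: its number of operations. -/
def Expr.cost : Expr → ℕ
  | const _ => 1
  | reg _ => 1
  | get _ e => e.cost + 1
  | add e₁ e₂ => e₁.cost + e₂.cost + 1
  | sub e₁ e₂ => e₁.cost + e₂.cost + 1
  | mul e₁ e₂ => e₁.cost + e₂.cost + 1

/-- Boolean tests. -/
inductive Cond where
  | eq (e₁ e₂ : Expr)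
  | lt (e₁ e₂ : Expr)
  | not (b : Cond)
  | and (b₁ b₂ : Cond)

/-- The truth value of a test. -/
def Cond.Holds (s : State) : Cond → Prop
  | eq e₁ e₂ => e₁.eval s = e₂.eval s
  | lt e₁ e₂ => e₁.eval s < e₂.eval s
  | not b => ¬ b.Holds s
  | and b₁ b₂ => b₁.Holds s ∧ b₂.Holds s

/-- All values that arise during the evaluation of the test fit into `w`-bit words. -/
def Cond.Fits (w : ℕ) (s : State) : Cond → Prop
  | eq e₁ e₂ => e₁.Fits w s ∧ e₂.Fits w s
  | lt e₁ e₂ => e₁.Fits w s ∧ e₂.Fits w s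
  | not b => b.Fits w s
  | and b₁ b₂ => b₁.Fits w s ∧ b₂.Fits w s

/-- The time to evaluate a test. -/
def Cond.cost : Cond → ℕ
  | eq e₁ e₂ => e₁.cost + e₂.cost + 1
  | lt e₁ e₂ => e₁.cost + e₂.cost + 1
  | not b => b.cost + 1
  | and b₁ b₂ => b₁.cost + b₂.cost + 1

/-- Programs: `assign x e` is `x := e`, `store a i e` is `a[i] := e`, `loop b p` is
`while b do p`. -/
inductive Program where
  | skip
  | assign (x : ℕ) (e : Expr)
  | store (a : ℕ) (i e : Expr)
  | seq (p q : Program)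
  | ite (b : Cond) (p q : Program)
  | loop (b : Cond) (p : Program)

/-- The state after `x := v`. -/
def State.setReg (s : State) (x v : ℕ) : State :=
  { s with reg := Function.update s.reg x v }

/-- The state after `a[i] := v`. -/
def State.setArr (s : State) (a i v : ℕ) : State :=
  { s with arr := Function.update s.arr a (Function.update (s.arr a) i v) }

/-- `Exec w p s t s'`: with words of `w` bits, the program `p` started in the state `s`
terminates after exactly `t` units of time in the state `s'`. -/
inductive Exec (w : ℕ) : Program → State → ℕ → State → Prop where
  | skip (s : State) : Exec w .skip s 1 s
  | assign (s : State) (x : ℕ) (e : Expr) (he : e.Fits w s) :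
      Exec w (.assign x e) s (e.cost + 1) (s.setReg x (e.eval s))
  | store (s : State) (a : ℕ) (i e : Expr) (hi : i.Fits w s) (he : e.Fits w s) :
      Exec w (.store a i e) s (i.cost + e.cost + 1) (s.setArr a (i.eval s) (e.eval s))
  | seq {p q : Program} {s₁ s₂ s₃ : State} {t₁ t₂ : ℕ}
      (hp : Exec w p s₁ t₁ s₂) (hq : Exec w q s₂ t₂ s₃) :
      Exec w (.seq p q) s₁ (t₁ + t₂) s₃
  | iteTrue {b : Cond} {p q : Program} {s s' : State} {t : ℕ}
      (hf : b.Fits w s) (hb : b.Holds s) (hp : Exec w p s t s') :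
      Exec w (.ite b p q) s (b.cost + 1 + t) s'
  | iteFalse {b : Cond} {p q : Program} {s s' : State} {t : ℕ}
      (hf : b.Fits w s) (hb : ¬ b.Holds s) (hq : Exec w q s t s') :
      Exec w (.ite b p q) s (b.cost + 1 + t) s'
  | loopTrue {b : Cond} {p : Program} {s₁ s₂ s₃ : State} {t₁ t₂ : ℕ}
      (hf : b.Fits w s₁) (hb : b.Holds s₁) (hp : Exec w p s₁ t₁ s₂)
      (hl : Exec w (.loop b p) s₂ t₂ s₃) :
      Exec w (.loop b p) s₁ (b.cost + 1 + t₁ + t₂) s₃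
  | loopFalse {b : Cond} {p : Program} {s : State}
      (hf : b.Fits w s) (hb : ¬ b.Holds s) :
      Exec w (.loop b p) s (b.cost + 1) s

/-- The start configuration on three input strings, whose characters are given as words through
`code`: the registers `0`, `1`, `2` hold the lengths of the strings, the arrays `0`, `1`, `2`
hold their characters (from index `0` on), and everything else is `0`. -/
def input {α : Type*} (code : α → ℕ) (A B C : List α) : State where
  reg x :=
    match x with
    | 0 => A.length
    | 1 => B.length
    | 2 => C.length
    | _ => 0
  arr a i :=
    match a with
    | 0 => (A.map code).getD i 0
    | 1 => (B.map code).getD i 0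
    | 2 => (C.map code).getD i 0
    | _ => 0

end WordRAM

/-! ### A calculus for total correctness and running time -/

namespace WordRAM

/-! Write `C = c^k W`, where `c^k` is the first run of `C`. A solution has the form `X c^k W Y`, and
cutting it behind `c^k` cuts `A` at some `i` and `B` at some `j`. For a fixed cut `(i, j)` the
optimum is greedy: embed `c^k` as late as possible into the two prefixes and `W` as early as
possible into the two suffixes, then take for `X` and `Y` longest common subsequences of what
remains on the left and on the right. This optimum is `cellValue`; `exists_of_cellValue` shows that
it is attained and `le_cellValue` that it is an upper bound.

It is enough to look at cuts where a run of `A` ends at `i` or a run of `B` ends at `j`. At any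
other cut both next characters are again `c`. Since `W` does not begin with `c`, both cuts can
advance by one: `X` gains a `c`, and `Y` loses at most one character, which happens only if `W` is
empty (`exists_split_runEnd`). There are at most `mN + nM` such special cuts.

The LCS lengths of arbitrary prefixes are recovered in constant time from those at special cells
(`lookup_eq`). Consider the block formed by a run of `A` and a run of `B`. If their characters
agree, the value is found by walking back along the diagonal to the border of the block; if they
differ, the block contains no match and the value is the maximum of two border values. The same rule
fills the table. Suffixes are treated as prefixes of the reversed strings, which have equally many
runs (`count_newRun_reverse`).

The greedy embeddings are computed for all cuts at once, one run `v^l` of `C` at a time, by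
composing with the map from a position to the `l`-th last `v` before it. A stack of occurrences
yields that map in linear time whatever `l` is (`IsOccStack.iterate`). For `r` runs of `C` this
takes time of order `r(M + N)`. A solution contains `C` as a subsequence of `A` and of `B`, so `r ≤
m` and `r ≤ n` (`length_rle_mono`), whence `r(M + N) ≤ nM + mN`; if one of these inequalities fails,
there is no solution.

On the machine side, `WP` bundles termination, running time and final state. The loop over the
special cells is verified once, in `wp_forSpecial`, and serves both for filling the tables and for
maximizing over the cuts. -/

@[simp] theorem State.setReg_reg (s : State) (x v y : ℕ) :
    (s.setReg x v).reg y = if y = x then v else s.reg y := by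
  simp [State.setReg, Function.update_apply]

@[simp] theorem State.setReg_arr (s : State) (x v : ℕ) : (s.setReg x v).arr = s.arr := rfl

@[simp] theorem State.setArr_reg (s : State) (a i v : ℕ) : (s.setArr a i v).reg = s.reg := rfl

@[simp] theorem State.setArr_arr_same (s : State) (a i v j : ℕ) :
    (s.setArr a i v).arr a j = if j = i then v else s.arr a j := by
  simp [State.setArr, Function.update_apply]

@[simp] theorem State.setArr_arr_ne (s : State) {a b : ℕ} (i v : ℕ) (h : b ≠ a) :
    (s.setArr a i v).arr b = s.arr b := by
  simp [State.setArr, h]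

/-- The registers that a program may write. -/
def Program.WritesReg : Program → ℕ → Prop
  | skip, _ => False
  | assign x _, y => y = x
  | store _ _ _, _ => False
  | seq p q, y => p.WritesReg y ∨ q.WritesReg y
  | ite _ p q, y => p.WritesReg y ∨ q.WritesReg y
  | loop _ p, y => p.WritesReg y

/-- The arrays that a program may write. -/
def Program.WritesArr : Program → ℕ → Prop
  | skip, _ => False
  | assign _ _, _ => False
  | store a _ _, b => b = a
  | seq p q, b => p.WritesArr b ∨ q.WritesArr b
  | ite _ p q, b => p.WritesArr b ∨ q.WritesArr b
  | loop _ p, b => p.WritesArr b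

theorem Exec.reg_eq {w : ℕ} {p : Program} {s s' : State} {t x : ℕ} (h : Exec w p s t s')
    (hx : ¬ p.WritesReg x) : s'.reg x = s.reg x := by
  induction h <;> simp_all [Program.WritesReg]

theorem Exec.arr_eq {w : ℕ} {p : Program} {s s' : State} {t a : ℕ} (h : Exec w p s t s')
    (ha : ¬ p.WritesArr a) : s'.arr a = s.arr a := by
  induction h <;> simp_all [Program.WritesArr]

/-- The program terminates from `s`, and its running time and final state satisfy `Q`. -/
def WP (w : ℕ) (p : Program) (s : State) (Q : ℕ → State → Prop) : Prop :=
  ∃ t s', Exec w p s t s' ∧ Q t s'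

namespace WP

variable {w : ℕ} {p q : Program} {s : State} {Q R : ℕ → State → Prop}

theorem mono (h : WP w p s Q) (hQ : ∀ t s', Q t s' → R t s') : WP w p s R := by
  obtain ⟨t, s', he, hq⟩ := h
  exact ⟨t, s', he, hQ _ _ hq⟩

/-- Lets a specification mention only what a program computes: what it leaves alone is read off the
program text. -/
theorem frame (h : WP w p s Q) :
    WP w p s fun t s' => Q t s' ∧ (∀ x, ¬ p.WritesReg x → s'.reg x = s.reg x) ∧
      ∀ a, ¬ p.WritesArr a → s'.arr a = s.arr a := by
  obtain ⟨t, s', he, hq⟩ := h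
  exact ⟨t, s', he, hq, fun x hx => he.reg_eq hx, fun a ha => he.arr_eq ha⟩

theorem skip (h : Q 1 s) : WP w .skip s Q := ⟨_, _, .skip s, h⟩

theorem assign {x : ℕ} {e : Expr} (hf : e.Fits w s)
    (h : Q (e.cost + 1) (s.setReg x (e.eval s))) : WP w (.assign x e) s Q :=
  ⟨_, _, .assign s x e hf, h⟩

theorem store {a : ℕ} {i e : Expr} (hi : i.Fits w s) (he : e.Fits w s)
    (h : Q (i.cost + e.cost + 1) (s.setArr a (i.eval s) (e.eval s))) :
    WP w (.store a i e) s Q :=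
  ⟨_, _, .store s a i e hi he, h⟩

theorem seq (h : WP w p s fun t₁ s₁ => WP w q s₁ fun t₂ s₂ => Q (t₁ + t₂) s₂) :
    WP w (.seq p q) s Q := by
  obtain ⟨t₁, s₁, h₁, t₂, s₂, h₂, hq⟩ := h
  exact ⟨_, _, .seq h₁ h₂, hq⟩

theorem ite {b : Cond} (hf : b.Fits w s)
    (hp : b.Holds s → WP w p s fun t s' => Q (b.cost + 1 + t) s')
    (hq : ¬ b.Holds s → WP w q s fun t s' => Q (b.cost + 1 + t) s') :
    WP w (.ite b p q) s Q := by
  by_cases hb : b.Holds s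
  · obtain ⟨t, s', he, h⟩ := hp hb
    exact ⟨_, _, .iteTrue hf hb he, h⟩
  · obtain ⟨t, s', he, h⟩ := hq hb
    exact ⟨_, _, .iteFalse hf hb he, h⟩

end WP

/-- `for x in [x, n) do p`, where the bound `n` is a register. -/
def forLoop (x n : ℕ) (p : Program) : Program :=
  .loop (.lt (.reg x) (.reg n)) (.seq p (.assign x (.add (.reg x) (.const 1))))

/-- Invariant rule for `forLoop`; the potential `Φ` accounts for the running time. -/
theorem WP.forLoop {w x n hi : ℕ} {p : Program} {I : ℕ → State → Prop} {Φ : ℕ → ℕ}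
    (hw : hi + 1 < 2 ^ w) (hI : ∀ i s, I i s → s.reg x = i ∧ s.reg n = hi)
    -- The 8 units are 4 for the loop test and 4 for the increment; the 4 in the conclusion is the
    -- final failing test.
    (hbody : ∀ i s, i < hi → I i s → WP w p s fun t s' =>
      t + 8 + Φ i ≤ Φ (i + 1) ∧ s'.reg x = i ∧ I (i + 1) (s'.setReg x (i + 1)))
    {lo : ℕ} {s : State} (hlo : lo ≤ hi) (hs : I lo s) :
    WP w (forLoop x n p) s fun t s' => t + Φ lo ≤ Φ hi + 4 ∧ I hi s' := by
  induction hk : hi - lo generalizing lo s with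
  | zero =>
    obtain rfl : lo = hi := by omega
    obtain ⟨h1, h2⟩ := hI _ _ hs
    refine ⟨_, s, .loopFalse (by simp [Cond.Fits, Expr.Fits, h1, h2]; omega)
      (by simp [Cond.Holds, Expr.eval, h1, h2]), by simp [Cond.cost, Expr.cost]; omega, hs⟩
  | succ k ih =>
    obtain ⟨h1, h2⟩ := hI _ _ hs
    obtain ⟨t₁, s₁, e₁, ht₁, hx₁, hI₁⟩ := hbody lo s (by omega) hs
    obtain ⟨t₂, s₂, e₂, ht₂, hI₂⟩ := ih (lo := lo + 1) (by omega) hI₁ (by omega)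
    have e : Exec w (.assign x (.add (.reg x) (.const 1))) s₁ 4 (s₁.setReg x (lo + 1)) := by
      have := Exec.assign (w := w) s₁ x (.add (.reg x) (.const 1))
        (by simp only [Expr.Fits, Expr.eval, hx₁]; omega)
      simpa [Expr.eval, Expr.cost, hx₁] using this
    refine ⟨_, s₂, .loopTrue (by simp [Cond.Fits, Expr.Fits, h1, h2]; omega)
      (by simp [Cond.Holds, Expr.eval, h1, h2]; omega) (.seq e₁ e) e₂, ?_, hI₂⟩
    simp [Cond.cost, Expr.cost]; omega

end WordRAM

/-! ### Subsequences of prefixes -/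

namespace STRICLCS

theorem sublist_concat_iff {l Z : List ℕ} {x : ℕ} :
    Z.Sublist (l ++ [x]) ↔ Z.Sublist l ∨ ∃ Z', Z = Z' ++ [x] ∧ Z'.Sublist l := by
  rw [List.sublist_append_iff]
  constructor
  · rintro ⟨l₁, l₂, rfl, h₁, h₂⟩
    rcases List.sublist_singleton.1 h₂ with rfl | rfl
    · exact .inl (by simpa using h₁)
    · exact .inr ⟨l₁, rfl, h₁⟩
  · rintro (h | ⟨Z', rfl, h⟩)
    · exact ⟨Z, [], by simp, h, by simp⟩
    · exact ⟨Z', [x], rfl, h, .refl _⟩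

/-- The first `i` characters of the infinite string `a`. -/
def pre (a : ℕ → ℕ) (i : ℕ) : List ℕ := (List.range i).map a

theorem pre_succ (a : ℕ → ℕ) (i : ℕ) : pre a (i + 1) = pre a i ++ [a i] := by
  simp [pre, List.range_succ]

@[simp] theorem pre_zero (a : ℕ → ℕ) : pre a 0 = [] := rfl

theorem pre_sublist (a : ℕ → ℕ) {i j : ℕ} (h : i ≤ j) : (pre a i).Sublist (pre a j) := by
  induction h with
  | refl => exact .refl _
  | step _ ih => rw [pre_succ]; exact ih.trans (List.sublist_append_left _ _)

/-! ### The length of a longest common subsequence of two prefixes -/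

def lcs (a b : ℕ → ℕ) : ℕ → ℕ → ℕ
  | 0, _ => 0
  | _ + 1, 0 => 0
  | i + 1, j + 1 => if a i = b j then lcs a b i j + 1 else max (lcs a b i (j + 1)) (lcs a b (i + 1) j)

variable (a b : ℕ → ℕ)

@[simp] theorem lcs_zero_left (j : ℕ) : lcs a b 0 j = 0 := by simp [lcs]

@[simp] theorem lcs_zero_right (i : ℕ) : lcs a b i 0 = 0 := by cases i <;> simp [lcs]

theorem exists_length_eq_lcs (i j : ℕ) :
    ∃ Z : List ℕ, Z.Sublist (pre a i) ∧ Z.Sublist (pre b j) ∧ Z.length = lcs a b i j := by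
  fun_induction lcs a b i j with
  | case1 j => exact ⟨[], by simp⟩
  | case2 i => exact ⟨[], by simp⟩
  | case3 i j h ih =>
    obtain ⟨Z, h₁, h₂, h₃⟩ := ih
    refine ⟨Z ++ [a i], ?_, ?_, by simp [h₃]⟩
    · rw [pre_succ]; exact h₁.append_right _
    · rw [pre_succ, h]; exact h₂.append_right _
  | case4 i j h ih₁ ih₂ =>
    obtain ⟨Z, h₁, h₂, h₃⟩ := ih₁
    obtain ⟨Z', h₁', h₂', h₃'⟩ := ih₂
    rcases le_total (lcs a b i (j + 1)) (lcs a b (i + 1) j) with hl | hl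
    · exact ⟨Z', h₁', h₂'.trans (pre_sublist b (by omega)), by omega⟩
    · exact ⟨Z, h₁.trans (pre_sublist a (by omega)), h₂, by omega⟩

variable {a b}

theorem length_le_lcs {i j : ℕ} {Z : List ℕ} (h₁ : Z.Sublist (pre a i)) (h₂ : Z.Sublist (pre b j)) :
    Z.length ≤ lcs a b i j := by
  fun_induction lcs a b i j generalizing Z with
  | case1 j => simp_all
  | case2 i => simp_all
  | case3 i j h ih =>
    have key : ∀ {l : List ℕ} {x : ℕ}, Z.Sublist (l ++ [x]) → Z.dropLast.Sublist l := by
      intro l x hl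
      rcases sublist_concat_iff.1 hl with h | ⟨Z', rfl, h⟩
      · exact (List.dropLast_sublist _).trans h
      · simpa using h
    rw [pre_succ] at h₁ h₂
    have := ih (key h₁) (key h₂)
    simp at this
    omega
  | case4 i j h ih₁ ih₂ =>
    have h₁' := h₁
    have h₂' := h₂
    rw [pre_succ] at h₁ h₂
    rcases sublist_concat_iff.1 h₁ with h₃ | ⟨Z', rfl, h₃⟩
    · exact (ih₁ h₃ h₂').trans (le_max_left _ _)
    rcases sublist_concat_iff.1 h₂ with h₄ | ⟨Z'', e, h₄⟩
    · exact (ih₂ h₁' h₄).trans (le_max_right _ _)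
    · exact absurd (List.append_inj_right' e rfl) (by simpa using h)

theorem lcs_mono {i i' j j' : ℕ} (hi : i ≤ i') (hj : j ≤ j') : lcs a b i j ≤ lcs a b i' j' := by
  obtain ⟨Z, h₁, h₂, h₃⟩ := exists_length_eq_lcs a b i j
  rw [← h₃]
  exact length_le_lcs (h₁.trans (pre_sublist a hi)) (h₂.trans (pre_sublist b hj))

theorem lcs_le_left (i j : ℕ) : lcs a b i j ≤ i := by
  obtain ⟨Z, h₁, h₂, h₃⟩ := exists_length_eq_lcs a b i j
  have := h₁.length_le
  simp [pre] at this
  omega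

theorem lcs_add_of_eq {i j t : ℕ} (h : ∀ u < t, a (i + u) = b (j + u)) :
    lcs a b (i + t) (j + t) = lcs a b i j + t := by
  induction t with
  | zero => rfl
  | succ t ih =>
    rw [← add_assoc, ← add_assoc, lcs, if_pos (h t (by omega)), ih fun u hu => h u (by omega)]
    rfl

/-- A common subsequence cannot use both the last `s` characters of `a` and the last `t` characters
of `b`: they do not match each other, and matching each of them to an earlier character would make
the matches cross. -/
theorem lcs_add_of_ne {i j s t : ℕ} (h : ∀ u < s, ∀ v < t, a (i + u) ≠ b (j + v)) :
    lcs a b (i + s) (j + t) = max (lcs a b i (j + t)) (lcs a b (i + s) j) := by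
  induction s generalizing t with
  | zero => simp [lcs_mono]
  | succ s ih =>
    induction t with
    | zero => simp [lcs_mono]
    | succ t iht =>
      have h₁ := ih (t := t + 1) fun u hu v hv => h u (by omega) v hv
      have h₂ := iht fun u hu v hv => h u hu v (by omega)
      have h₃ : lcs a b i (j + t) ≤ lcs a b i (j + (t + 1)) := lcs_mono le_rfl (by omega)
      have h₄ : lcs a b (i + s) j ≤ lcs a b (i + (s + 1)) j := lcs_mono (by omega) le_rfl
      rw [← add_assoc, ← add_assoc, lcs, if_neg (h s (by omega) t (by omega))]
      simp only [← add_assoc] at *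
      omega

/-! ### Runs -/

/-- A new run starts at position `i`. -/
def NewRun (a : ℕ → ℕ) (i : ℕ) : Prop := i = 0 ∨ a i ≠ a (i - 1)

instance (a : ℕ → ℕ) : DecidablePred (NewRun a) := fun _ => inferInstanceAs (Decidable (_ ∨ _))

/-- The start of the run that contains position `i - 1`. -/
def runStart (a : ℕ → ℕ) : ℕ → ℕ
  | 0 => 0
  | i + 1 => if NewRun a i then i else runStart a i

theorem runStart_le (a : ℕ → ℕ) (i : ℕ) : runStart a i ≤ i := by
  induction i with
  | zero => rfl
  | succ i ih => rw [runStart]; split <;> omega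

theorem runStart_lt (a : ℕ → ℕ) {i : ℕ} (hi : 0 < i) : runStart a i < i := by
  obtain ⟨i, rfl⟩ := Nat.exists_eq_succ_of_ne_zero hi.ne'
  have := runStart_le a i
  rw [runStart]; split <;> omega

theorem newRun_runStart (a : ℕ → ℕ) (i : ℕ) : NewRun a (runStart a i) := by
  induction i with
  | zero => exact .inl rfl
  | succ i ih => rw [runStart]; split <;> assumption

theorem not_newRun {i u : ℕ} (h₁ : runStart a i < u) (h₂ : u < i) : ¬ NewRun a u := by
  induction i with
  | zero => omega
  | succ i ih =>
    rw [runStart] at h₁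
    split at h₁
    · omega
    · rcases Nat.lt_succ_iff_lt_or_eq.1 h₂ with h | rfl
      · exact ih h₁ h
      · assumption

theorem eq_of_runStart_le {a : ℕ → ℕ} {i u : ℕ} (h₁ : runStart a i ≤ u) (h₂ : u < i) : a u = a (i - 1) := by
  induction i with
  | zero => omega
  | succ i ih =>
    rcases Nat.lt_succ_iff_lt_or_eq.1 h₂ with h | rfl
    · rw [runStart] at h₁
      split at h₁
      · omega
      · rename_i hn
        simp only [NewRun, not_or, not_not] at hn
        rw [ih h₁ h, ← hn.2]; rfl
    · rfl

/-- The value at `(i, j)` obtained from a table that is correct where a run ends. -/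
def lookup (a b : ℕ → ℕ) (T : ℕ → ℕ → ℕ) (i j : ℕ) : ℕ :=
  if a (i - 1) = b (j - 1) then
    T (i - min (i - runStart a i) (j - runStart b j)) (j - min (i - runStart a i) (j - runStart b j)) +
      min (i - runStart a i) (j - runStart b j)
  else max (T (runStart a i) j) (T i (runStart b j))

/-- Within a block either all pairs of characters match or none does, so `lcs_add_of_eq` or
`lcs_add_of_ne` leads back to its border. Away from the axes `T` need not be correct at `(i, j)`
itself, so the lemma serves both for computing that entry and for reading a finished table. -/
theorem lookup_eq {T : ℕ → ℕ → ℕ} {i j : ℕ}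
    (hT : ∀ i' ≤ i, ∀ j' ≤ j, (NewRun a i' ∨ NewRun b j') → (i' = i → j' = j → i = 0 ∨ j = 0) →
      T i' j' = lcs a b i' j') :
    lookup a b T i j = lcs a b i j := by
  have ha := runStart_le a i
  have hb := runStart_le b j
  have ha' := fun h => runStart_lt a (i := i) h
  have hb' := fun h => runStart_lt b (i := j) h
  rw [lookup]
  split
  · rename_i h
    -- Going back `t` steps along the diagonal reaches the nearer of the two borders of the block.
    set t := min (i - runStart a i) (j - runStart b j) with ht
    have hsp : NewRun a (i - t) ∨ NewRun b (j - t) := by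
      rcases le_total (i - runStart a i) (j - runStart b j) with hl | hl
      · rw [show i - t = runStart a i by omega]; exact .inl (newRun_runStart a i)
      · rw [show j - t = runStart b j by omega]; exact .inr (newRun_runStart b j)
    rw [hT _ (by omega) _ (by omega) hsp (by omega)]
    conv_rhs => rw [show i = i - t + t by omega, show j = j - t + t by omega]
    rw [lcs_add_of_eq]
    intro u hu
    rw [eq_of_runStart_le (a := a) (i := i) (by omega) (by omega), h,
      eq_of_runStart_le (a := b) (i := j) (u := j - t + u) (by omega) (by omega)]
  · rename_i h
    rw [hT _ ha _ le_rfl (.inl (newRun_runStart a i)) (by omega),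
      hT _ le_rfl _ hb (.inr (newRun_runStart b j)) (by omega)]
    conv_rhs => rw [show i = runStart a i + (i - runStart a i) by omega,
      show j = runStart b j + (j - runStart b j) by omega]
    rw [lcs_add_of_ne]
    · rw [Nat.add_sub_cancel' ha, Nat.add_sub_cancel' hb]
    · intro u hu v hv
      rwa [eq_of_runStart_le (a := a) (i := i) (by omega) (by omega),
        eq_of_runStart_le (a := b) (i := j) (by omega) (by omega)]

/-! ### The number of runs -/

section rle

variable {α : Type*} [DecidableEq α]

theorem length_rle_cons_cons (x y : α) (l : List α) :
    (rle (x :: y :: l)).length = (rle (y :: l)).length + if x = y then 0 else 1 := by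
  have key : ∃ k t, rle (y :: l) = (y, k) :: t := by
    rw [rle]
    rcases rle l with _ | ⟨⟨z, k⟩, t⟩
    · exact ⟨_, _, rfl⟩
    · dsimp only
      split
      · rename_i h
        exact ⟨_, _, by rw [h]⟩
      · exact ⟨_, _, rfl⟩
  obtain ⟨k, t, h⟩ := key
  rw [rle, h]
  dsimp only
  split <;> simp

@[simp] theorem length_rle_singleton (x : α) : (rle [x]).length = 1 := rfl

/-- The triangle inequality for "is different from": replacing the first character affects only the
first boundary. -/
theorem length_rle_cons_le (x y : α) (l : List α) :
    (rle (x :: l)).length ≤ (rle (y :: l)).length + if x = y then 0 else 1 := by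
  rcases l with _ | ⟨z, l⟩
  · simp
  · rw [length_rle_cons_cons, length_rle_cons_cons]
    split_ifs <;> simp_all; omega

/-- The common first character `x` strengthens the induction: when the next character `y` is
skipped, `length_rle_cons_le` pays for exchanging `x` for `y` with the boundary between `x` and `y`.
-/
theorem length_rle_cons_mono {l₁ l₂ : List α} (h : l₁.Sublist l₂) (x : α) :
    (rle (x :: l₁)).length ≤ (rle (x :: l₂)).length := by
  induction h generalizing x with
  | slnil => rfl
  | cons y _ ih =>
    rw [length_rle_cons_cons]
    exact (length_rle_cons_le x y _).trans (by gcongr; exact ih y)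
  | cons_cons y _ ih =>
    rw [length_rle_cons_cons, length_rle_cons_cons]
    gcongr
    exact ih y

/-- This is what bounds the number of runs of `C` by those of `A` and of `B` whenever a solution
exists. -/
theorem length_rle_mono {l₁ l₂ : List α} (h : l₁.Sublist l₂) :
    (rle l₁).length ≤ (rle l₂).length := by
  induction h with
  | slnil => rfl
  | @cons l₁ l₂ y _ ih =>
    refine ih.trans ?_
    rcases l₂ with _ | ⟨z, l⟩
    · simp [rle]
    · rw [length_rle_cons_cons]; omega
  | cons_cons y h _ => exact length_rle_cons_mono h y

theorem length_rle_eq_count (l : List ℕ) :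
    (rle l).length = Nat.count (NewRun fun i => l.getD i 0) l.length := by
  induction l with
  | nil => rfl
  | cons x l ih =>
    rcases l with _ | ⟨y, l⟩
    · simp [Nat.count_succ, NewRun]
    · rw [length_rle_cons_cons, ih]
      simp only [List.length_cons]
      rw [Nat.count_succ', Nat.count_succ', Nat.count_succ']
      simp [NewRun, eq_comm]
      omega

theorem length_rle_map {β : Type*} [DecidableEq β] {f : α → β} (hf : Function.Injective f)
    (l : List α) : (rle (l.map f)).length = (rle l).length := by
  induction l with
  | nil => rfl
  | cons x l ih =>
    rcases l with _ | ⟨y, l⟩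
    · rfl
    · simp only [List.map_cons, length_rle_cons_cons, hf.eq_iff] at ih ⊢
      rw [ih]

end rle

/-- Apart from position `0`, a new run is a boundary between two neighbouring characters, and
reversal permutes these boundaries. -/
theorem count_newRun_reverse {a ar : ℕ → ℕ} {M : ℕ} (h : ∀ i < M, ar i = a (M - 1 - i)) :
    Nat.count (NewRun ar) M = Nat.count (NewRun a) M := by
  rcases M with _ | M
  · rfl
  rw [Nat.count_succ', Nat.count_succ']
  congr 1
  · rw [Nat.count_eq_card_filter_range, Nat.count_eq_card_filter_range]
    refine Finset.card_bij' (fun i _ => M - 1 - i) (fun i _ => M - 1 - i) ?_ ?_ ?_ ?_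
    · intro i
      simp only [Finset.mem_filter, Finset.mem_range]
      simp only [NewRun]
      rintro ⟨h₁, h₂⟩
      rw [h _ (by omega), h _ (by omega)] at h₂
      refine ⟨by omega, .inr ?_⟩
      rw [show M - 1 - i + 1 = M - i by omega]
      rcases h₂ with h₂ | h₂
      · omega
      · rw [show M + 1 - 1 - (i + 1) = M - 1 - i by omega,
          show M + 1 - 1 - (i + 1 - 1) = M - i by omega] at h₂
        rw [show M - i - 1 = M - 1 - i by omega]
        exact h₂.symm
    · intro i
      simp only [Finset.mem_filter, Finset.mem_range]
      simp only [NewRun]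
      rintro ⟨h₁, h₂⟩
      refine ⟨by omega, .inr ?_⟩
      rw [h _ (by omega), h _ (by omega)]
      rcases h₂ with h₂ | h₂
      · omega
      · rw [show M + 1 - 1 - (M - 1 - i + 1) = i by omega,
          show M + 1 - 1 - (M - 1 - i + 1 - 1) = i + 1 by omega]
        exact h₂.symm
    · intro i
      simp only [Finset.mem_filter, Finset.mem_range]
      omega
    · intro i
      simp only [Finset.mem_filter, Finset.mem_range]
      omega

/-! ### Latest embeddings -/

/-- Positions are coded by `0` (none) and `i + 1` (position `i`); `prevOcc a c q` is the position
of the last `c` in `a` before the position `q`. -/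
def prevOcc (a : ℕ → ℕ) (c : ℕ) : ℕ → ℕ
  | 0 => 0
  | 1 => 0
  | i + 2 => if a i = c then i + 1 else prevOcc a c (i + 1)

theorem prevOcc_le (a : ℕ → ℕ) (c q : ℕ) : prevOcc a c q ≤ q := by
  fun_induction prevOcc a c q <;> omega

/-- `X` is a subsequence of the part of `a` before the coded position `q`. -/
def SubBefore (a : ℕ → ℕ) (X : List ℕ) (q : ℕ) : Prop := q ≠ 0 ∧ X.Sublist (pre a (q - 1))

/-- The greedy principle: the last character of a subsequence may be matched to its last occurrence,
which leaves the longest prefix for the rest. -/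
theorem subBefore_concat_iff {a : ℕ → ℕ} {X : List ℕ} {c q : ℕ} :
    SubBefore a (X ++ [c]) q ↔ SubBefore a X (prevOcc a c q) := by
  fun_induction prevOcc a c q with
  | case1 => simp [SubBefore]
  | case2 => simp [SubBefore]
  | case3 i h =>
    simp [SubBefore, pre_succ, h]
  | case4 i h ih =>
    rw [← ih]
    simp only [SubBefore, Nat.succ_eq_add_one, Nat.add_sub_cancel, ne_eq, Nat.succ_ne_zero,
      not_false_eq_true, true_and]
    rw [pre_succ, sublist_concat_iff, or_iff_left]
    rintro ⟨Z', e, -⟩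
    exact h (by simpa using (List.append_inj_right' e rfl).symm)

/-- The greedy matching proceeds from right to left, so the fold meets the characters of the matched
word in reverse order. -/
theorem subBefore_append_reverse_iff {a : ℕ → ℕ} {X V : List ℕ} {q : ℕ} :
    SubBefore a (X ++ V.reverse) q ↔ SubBefore a X (V.foldl (fun q c => prevOcc a c q) q) := by
  induction V generalizing q with
  | nil => simp
  | cons c V ih => rw [List.foldl_cons, ← ih, ← subBefore_concat_iff]; simp

end STRICLCS

/-! ### The value of a cut, and why special cuts suffice -/

namespace STRICLCS

/-- The coded start of the latest embedding of `V.reverse` into the part of `a` before the coded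
position `q`. -/
def latest (a : ℕ → ℕ) (V : List ℕ) (q : ℕ) : ℕ := V.foldl (fun q c => prevOcc a c q) q

theorem latest_le (a : ℕ → ℕ) (V : List ℕ) (q : ℕ) : latest a V q ≤ q := by
  induction V generalizing q with
  | nil => exact le_rfl
  | cons c V ih => exact (ih _).trans (prevOcc_le _ _ _)

theorem latest_append (a : ℕ → ℕ) (V W : List ℕ) (q : ℕ) :
    latest a (V ++ W) q = latest a W (latest a V q) := by
  simp [latest]

theorem latest_replicate (a : ℕ → ℕ) (c k q : ℕ) :
    latest a (List.replicate k c) q = (prevOcc a c)^[k] q := by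
  induction k generalizing q with
  | zero => rfl
  | succ k ih => rw [List.replicate_succ, Function.iterate_succ_apply, ← ih]; rfl

/-- `ar` lists the first `M` characters of `a` in reverse order. -/
def IsReverse (a ar : ℕ → ℕ) (M : ℕ) : Prop := ∀ i < M, ar i = a (M - 1 - i)

theorem pre_getD (A : List ℕ) {i : ℕ} (hi : i ≤ A.length) :
    pre (fun i => A.getD i 0) i = A.take i := by
  apply List.ext_getElem
  · simp [pre, hi]
  · intro n h₁ h₂
    simp only [pre, List.length_map, List.length_range] at h₁
    simp [pre, List.getElem?_eq_getElem (show n < A.length by omega)]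

theorem pre_reverse {A : List ℕ} {ar : ℕ → ℕ} (h : IsReverse (fun i => A.getD i 0) ar A.length)
    {i : ℕ} (hi : i ≤ A.length) : pre ar (A.length - i) = (A.drop i).reverse := by
  apply List.ext_getElem
  · simp [pre]
  · intro n h₁ h₂
    simp only [pre, List.length_map, List.length_range] at h₁
    have := h n (by omega)
    simp only [pre, List.getElem_map, List.getElem_range, List.getElem_reverse, this,
      List.getElem_drop, List.length_drop]
    rw [List.getD_eq_getElem _ _ (by omega)]
    congr 1
    omega

theorem append_sublist_iff_split {A Z W : List ℕ} :
    (Z ++ W).Sublist A ↔ ∃ i ≤ A.length, Z.Sublist (A.take i) ∧ W.Sublist (A.drop i) := by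
  rw [List.append_sublist_iff]
  constructor
  · rintro ⟨r₁, r₂, rfl, h₁, h₂⟩
    exact ⟨r₁.length, by simp, by simpa using h₁, by simpa using h₂⟩
  · rintro ⟨i, -, h₁, h₂⟩
    exact ⟨_, _, (List.take_append_drop i A).symm, h₁, h₂⟩

theorem subBefore_latest_iff {A X V : List ℕ} {i : ℕ} (hi : i ≤ A.length) :
    SubBefore (fun i => A.getD i 0) X (latest (fun i => A.getD i 0) V (i + 1)) ↔
      (X ++ V.reverse).Sublist (A.take i) := by
  rw [latest, ← subBefore_append_reverse_iff, SubBefore, Nat.add_sub_cancel, pre_getD A hi]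
  simp

/-- The suffix of `A` from `i` on is the reversal of a prefix of `ar`, so an earliest embedding into
it becomes a latest embedding. The two reversals cancel, and `V` is met in its own order. -/
theorem subBefore_latest_reverse_iff {A Y V : List ℕ} {ar : ℕ → ℕ}
    (h : IsReverse (fun i => A.getD i 0) ar A.length) {i : ℕ} (hi : i ≤ A.length) :
    SubBefore ar Y.reverse (latest ar V (A.length - i + 1)) ↔ (V ++ Y).Sublist (A.drop i) := by
  rw [latest, ← subBefore_append_reverse_iff, SubBefore, Nat.add_sub_cancel, pre_reverse h hi,
    ← List.reverse_append, List.reverse_sublist]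
  simp

/-- One more than the length of the best solution whose first run of `C` ends at `(i, j)`;
`0` if there is none. -/
def cellValue (L L' : ℕ → ℕ → ℕ) (P Q P' Q' : ℕ → ℕ) (M N K i j : ℕ) : ℕ :=
  if 0 < P (i + 1) ∧ 0 < Q (j + 1) ∧ 0 < P' (M - i + 1) ∧ 0 < Q' (N - j + 1) then
    L (P (i + 1) - 1) (Q (j + 1) - 1) + K + L' (P' (M - i + 1) - 1) (Q' (N - j + 1) - 1) + 1
  else 0

/-- A run of `a`, of length `M`, ends at position `i - 1`. -/
def RunEnd (a : ℕ → ℕ) (M i : ℕ) : Prop := i = M ∨ a i ≠ a (i - 1)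

instance (a : ℕ → ℕ) (M : ℕ) : DecidablePred (RunEnd a M) :=
  fun _ => inferInstanceAs (Decidable (_ ∨ _))

section

variable {A B C : List ℕ} {ar br : ℕ → ℕ}

/-- Soundness, for every cut: gluing longest common subsequences of both sides around the greedy
embedding of `C` yields a solution of the claimed length. -/
theorem exists_of_cellValue (hA : IsReverse (A.getD · 0) ar A.length) (hB : IsReverse (B.getD · 0) br B.length)
    {V W : List ℕ} (hC : C = V.reverse ++ W) {i j : ℕ} (hi : i ≤ A.length) (hj : j ≤ B.length)
    (h : cellValue (lcs (A.getD · 0) (B.getD · 0)) (lcs ar br) (latest (A.getD · 0) V) (latest (B.getD · 0) V) (latest ar W) (latest br W)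
      A.length B.length C.length i j ≠ 0) :
    ∃ Z, IsSTRICCommonSubseq A B C Z ∧ Z.length + 1 =
      cellValue (lcs (A.getD · 0) (B.getD · 0)) (lcs ar br) (latest (A.getD · 0) V) (latest (B.getD · 0) V) (latest ar W) (latest br W)
        A.length B.length C.length i j := by
  rw [cellValue] at h ⊢
  split_ifs at h ⊢ with hpos
  · obtain ⟨h₁, h₂, h₃, h₄⟩ := hpos
    obtain ⟨X, hX₁, hX₂, hX⟩ := exists_length_eq_lcs (A.getD · 0) (B.getD · 0) (latest (A.getD · 0) V (i + 1) - 1)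
      (latest (B.getD · 0) V (j + 1) - 1)
    obtain ⟨Y, hY₁, hY₂, hY⟩ := exists_length_eq_lcs ar br (latest ar W (A.length - i + 1) - 1)
      (latest br W (B.length - j + 1) - 1)
    rw [← Y.reverse_reverse] at hY₁ hY₂
    have key₁ := (subBefore_latest_iff hi).1 ⟨h₁.ne', hX₁⟩
    have key₂ := (subBefore_latest_iff hj).1 ⟨h₂.ne', hX₂⟩
    have key₃ := (subBefore_latest_reverse_iff hA hi).1 ⟨h₃.ne', hY₁⟩
    have key₄ := (subBefore_latest_reverse_iff hB hj).1 ⟨h₄.ne', hY₂⟩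
    refine ⟨(X ++ V.reverse) ++ (W ++ Y.reverse),
      ⟨append_sublist_iff_split.2 ⟨i, hi, key₁, key₃⟩,
        append_sublist_iff_split.2 ⟨j, hj, key₂, key₄⟩, X, Y.reverse, by simp [hC]⟩, ?_⟩
    rw [← hX, ← hY]
    simp [hC]
    omega
  · exact absurd rfl h

/-- Optimality for a fixed cut: whatever precedes `V.reverse` or follows `W` still fits beside their
greedy embeddings. -/
theorem le_cellValue (hA : IsReverse (A.getD · 0) ar A.length) (hB : IsReverse (B.getD · 0) br B.length)
    {V W X Y : List ℕ} {i j : ℕ} (hi : i ≤ A.length) (hj : j ≤ B.length)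
    (hAX : (X ++ V.reverse).Sublist (A.take i)) (hBX : (X ++ V.reverse).Sublist (B.take j))
    (hAY : (W ++ Y).Sublist (A.drop i)) (hBY : (W ++ Y).Sublist (B.drop j)) (K : ℕ) :
    X.length + K + Y.length + 1 ≤
      cellValue (lcs (A.getD · 0) (B.getD · 0)) (lcs ar br) (latest (A.getD · 0) V) (latest (B.getD · 0) V) (latest ar W) (latest br W)
        A.length B.length K i j := by
  obtain ⟨h₁, h₁'⟩ := (subBefore_latest_iff hi).2 hAX
  obtain ⟨h₂, h₂'⟩ := (subBefore_latest_iff hj).2 hBX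
  obtain ⟨h₃, h₃'⟩ := (subBefore_latest_reverse_iff hA hi).2 hAY
  obtain ⟨h₄, h₄'⟩ := (subBefore_latest_reverse_iff hB hj).2 hBY
  rw [cellValue, if_pos ⟨by omega, by omega, by omega, by omega⟩]
  have := length_le_lcs h₁' h₂'
  have := length_le_lcs h₃' h₄'
  simp only [List.length_reverse] at this
  omega

/-- A split of a solution between the first run `c ^ k` of `C` and the rest can be moved to a
place where a run of `A` or of `B` ends. -/
theorem exists_split_runEnd {c k : ℕ} {W : List ℕ} (hW : W.head? ≠ some c)
    {X Y : List ℕ} {i j : ℕ} (hi : i ≤ A.length) (hj : j ≤ B.length)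
    (hi₀ : 0 < i) (hj₀ : 0 < j) (hia : A.getD (i - 1) 0 = c) (hjb : B.getD (j - 1) 0 = c)
    (hAX : (X ++ List.replicate k c).Sublist (A.take i))
    (hBX : (X ++ List.replicate k c).Sublist (B.take j))
    (hAY : (W ++ Y).Sublist (A.drop i)) (hBY : (W ++ Y).Sublist (B.drop j)) :
    ∃ i j X' Y', 0 < i ∧ i ≤ A.length ∧ 0 < j ∧ j ≤ B.length ∧
      (RunEnd (A.getD · 0) A.length i ∨ RunEnd (B.getD · 0) B.length j) ∧
      (X' ++ List.replicate k c).Sublist (A.take i) ∧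
      (X' ++ List.replicate k c).Sublist (B.take j) ∧
      (W ++ Y').Sublist (A.drop i) ∧ (W ++ Y').Sublist (B.drop j) ∧
      X.length + Y.length ≤ X'.length + Y'.length := by
  -- The cut moves to the right until it is special, at the latest when it reaches the end of `A`.
  induction hn : A.length - i generalizing X Y i j with
  | zero =>
    exact ⟨i, j, X, Y, hi₀, hi, hj₀, hj, .inl (.inl (by omega)), hAX, hBX, hAY, hBY, le_rfl⟩
  | succ n ih =>
    by_cases hsp : RunEnd (A.getD · 0) A.length i ∨ RunEnd (B.getD · 0) B.length j
    · exact ⟨i, j, X, Y, hi₀, hi, hj₀, hj, hsp, hAX, hBX, hAY, hBY, le_rfl⟩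
    simp only [RunEnd, not_or, not_not] at hsp
    obtain ⟨⟨h₁, h₂⟩, h₃, h₄⟩ := hsp
    rw [hia] at h₂
    rw [hjb] at h₄
    -- The exchange, for either string `D`: the character `c` behind the cut goes over to the left
    -- part.
    have step : ∀ {D : List ℕ} {u : ℕ}, u < D.length → D.getD u 0 = c →
        (X ++ List.replicate k c).Sublist (D.take u) → (W ++ Y).Sublist (D.drop u) →
        ((X ++ [c]) ++ List.replicate k c).Sublist (D.take (u + 1)) ∧
          (W ++ if W = [] then Y.tail else Y).Sublist (D.drop (u + 1)) := by
      intro D u hu hc hX hY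
      rw [List.getD_eq_getElem _ _ hu] at hc
      rw [List.take_succ_eq_append_getElem hu, hc]
      rw [List.drop_eq_getElem_cons hu, hc] at hY
      constructor
      · rw [List.append_assoc, List.singleton_append, ← List.replicate_succ,
          List.replicate_succ', ← List.append_assoc]
        exact hX.append_right _
      · rcases W with _ | ⟨x, W⟩
        · simpa using hY.tail
        · rw [if_neg (by simp)]
          -- As `W` is non-empty and does not begin with `c`, its embedding cannot use the character
          -- that is given away.
          cases hY with
          | cons _ h => exact h
          | cons_cons _ h => simp at hW
    obtain ⟨hA₁, hA₂⟩ := step (by omega) h₂ hAX hAY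
    obtain ⟨hB₁, hB₂⟩ := step (by omega) h₄ hBX hBY
    obtain ⟨i', j', X', Y', g₁, g₂, g₃, g₄, g₅, g₆, g₇, g₈, g₉, g⟩ :=
      ih (by omega) (by omega) (by omega) (by omega) (by simpa using h₂) (by simpa using h₄)
        hA₁ hB₁ hA₂ hB₂ (by omega)
    refine ⟨i', j', X', Y', g₁, g₂, g₃, g₄, g₅, g₆, g₇, g₈, g₉, ?_⟩
    have : Y.length ≤ (if W = [] then Y.tail else Y).length + 1 := by
      split <;> simp; omega
    simp at g
    omega

/-- The cut is made immediately behind the character matched to `c`. Hence the character before the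
cut is `c`, and, unless a run ends there, so is the one behind it. -/
theorem exists_split_concat {D Z W : List ℕ} {c : ℕ} (h : (Z ++ [c] ++ W).Sublist D) :
    ∃ i, 0 < i ∧ i ≤ D.length ∧ D.getD (i - 1) 0 = c ∧ (Z ++ [c]).Sublist (D.take i) ∧
      W.Sublist (D.drop i) := by
  rw [List.append_sublist_iff] at h
  obtain ⟨r₁, r₂, rfl, h₁, h₂⟩ := h
  rw [List.append_sublist_iff] at h₁
  obtain ⟨s₁, s₂, rfl, h₁, h₃⟩ := h₁
  obtain ⟨u, v, rfl⟩ := List.append_of_mem (List.singleton_sublist.1 h₃)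
  refine ⟨s₁.length + u.length + 1, by omega, by simp, ?_, ?_, ?_⟩
  · simp
  · have : (s₁ ++ (u ++ c :: v) ++ r₂).take (s₁.length + u.length + 1) = s₁ ++ (u ++ [c]) := by
      rw [show s₁ ++ (u ++ c :: v) ++ r₂ = (s₁ ++ (u ++ [c])) ++ (v ++ r₂) by simp]
      exact List.take_left' (by simp; omega)
    rw [this]
    exact h₁.append (by simp)
  · have : (s₁ ++ (u ++ c :: v) ++ r₂).drop (s₁.length + u.length + 1) = v ++ r₂ := by
      rw [show s₁ ++ (u ++ c :: v) ++ r₂ = (s₁ ++ (u ++ [c])) ++ (v ++ r₂) by simp]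
      exact List.drop_left' (by simp; omega)
    rw [this]
    exact h₂.trans (List.sublist_append_right _ _)

theorem exists_le_cellValue (hA : IsReverse (A.getD · 0) ar A.length) (hB : IsReverse (B.getD · 0) br B.length)
    (hA₀ : 0 < A.length) (hB₀ : 0 < B.length)
    {c k : ℕ} {W : List ℕ} (hC : C = List.replicate k c ++ W) (hW : W.head? ≠ some c)
    (hk : k = 0 → W = []) {Z : List ℕ} (hZ : IsSTRICCommonSubseq A B C Z) :
    ∃ i j, 0 < i ∧ i ≤ A.length ∧ 0 < j ∧ j ≤ B.length ∧
      (RunEnd (A.getD · 0) A.length i ∨ RunEnd (B.getD · 0) B.length j) ∧ Z.length + 1 ≤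
      cellValue (lcs (A.getD · 0) (B.getD · 0)) (lcs ar br) (latest (A.getD · 0) (List.replicate k c))
        (latest (B.getD · 0) (List.replicate k c)) (latest ar W) (latest br W)
        A.length B.length C.length i j := by
  obtain ⟨hZA, hZB, X, Y, rfl⟩ := hZ
  -- For empty `C` no character `c` fixes the cut; the whole solution is put to the left of the cut
  -- at the ends of `A` and `B`.
  rcases Nat.eq_zero_or_pos k with rfl | hk₀
  · obtain rfl := hk rfl
    simp only [List.replicate_zero, List.append_nil] at hC
    subst hC
    refine ⟨A.length, B.length, hA₀, le_rfl, hB₀, le_rfl, .inl (.inl rfl), ?_⟩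
    have := le_cellValue hA hB (V := []) (W := []) (X := X ++ Y) (Y := []) (le_refl A.length)
      (le_refl B.length) (by simpa using hZA) (by simpa using hZB) (by simp) (by simp) 0
    simpa using this
  · have key : ∀ {D : List ℕ}, (X ++ C ++ Y).Sublist D → ∃ i, 0 < i ∧ i ≤ D.length ∧
        D.getD (i - 1) 0 = c ∧ (X ++ List.replicate k c).Sublist (D.take i) ∧
        (W ++ Y).Sublist (D.drop i) := by
      intro D h
      obtain ⟨k, rfl⟩ := Nat.exists_eq_succ_of_ne_zero hk₀.ne'
      have := exists_split_concat (Z := X ++ List.replicate k c) (c := c) (W := W ++ Y) (D := D)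
        (by simpa [hC, List.replicate_succ'] using h)
      simpa [List.replicate_succ'] using this
    obtain ⟨i, hi₁, hi₂, hi₃, hi₄, hi₅⟩ := key hZA
    obtain ⟨j, hj₁, hj₂, hj₃, hj₄, hj₅⟩ := key hZB
    obtain ⟨i', j', X', Y', g₁, g₂, g₃, g₄, g₅, g₆, g₇, g₈, g₉, g⟩ :=
      exists_split_runEnd hW hi₂ hj₂ hi₁ hj₁ hi₃ hj₃ hi₄ hj₄ hi₅ hj₅
    refine ⟨i', j', g₁, g₂, g₃, g₄, g₅, ?_⟩
    have := le_cellValue hA hB (V := List.replicate k c) g₂ g₄ (by simpa using g₆)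
      (by simpa using g₇) g₈ g₉ C.length
    refine le_trans ?_ this
    simp
    omega

end

end STRICLCS

/-! ### Reversing a string -/

namespace WordRAM

open STRICLCS

/-- `dst := ` the reversal of `src`. -/
def reverseCopy (src dst len : ℕ) : Program :=
  .seq (.assign 10 (.const 0)) <| forLoop 10 len <|
    .store dst (.reg 10) (.get src (.sub (.sub (.reg len) (.const 1)) (.reg 10)))

theorem wp_reverseCopy {w src dst len M : ℕ} {s : State} (hsd : src ≠ dst) (hlen : len < 10)
    (hM : s.reg len = M) (hw : M + 16 < 2 ^ w) (hc : ∀ i, s.arr src i < 2 ^ w) :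
    WP w (reverseCopy src dst len) s fun t s' => t ≤ 20 * M + 20 ∧
      IsReverse (s.arr src) (s'.arr dst) M ∧ (∀ i, M ≤ i → s'.arr dst i = s.arr dst i) ∧
      (∀ x < 10, s'.reg x = s.reg x) ∧ ∀ y, y ≠ dst → s'.arr y = s.arr y := by
  have h10 : len ≠ 10 := by omega
  refine (WP.frame (Q := fun t s' => t ≤ 20 * M + 20 ∧ IsReverse (s.arr src) (s'.arr dst) M ∧
    ∀ i, M ≤ i → s'.arr dst i = s.arr dst i) ?_).mono ?_
  · refine .seq (.assign (by simp only [Expr.Fits]; omega) ?_)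
    refine (WP.forLoop (hi := M) (Φ := fun i => 20 * i)
      (I := fun i s' => s'.reg 10 = i ∧ s'.reg len = M ∧ s'.arr src = s.arr src ∧
        (∀ u < i, s'.arr dst u = s.arr src (M - 1 - u)) ∧
        ∀ u, M ≤ u → s'.arr dst u = s.arr dst u)
      (by omega) (fun i s' h => ⟨h.1, h.2.1⟩) ?_ (lo := 0) (by omega) ?_).mono ?_
    · rintro i s' hi ⟨h₁, h₂, h₃, h₄, h₅⟩
      refine .store ?_ ?_ ?_
      · simp only [Expr.Fits, h₁]; omega
      · simp only [Expr.Fits, h₁, h₂, h₃, hc, and_true]; omega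
      · simp only [Expr.eval, Expr.cost, h₁, h₂, h₃, State.setReg_reg, State.setArr_reg,
          State.setReg_arr, State.setArr_arr_ne _ _ _ hsd, State.setArr_arr_same, if_neg h10,
          if_true, true_and]
        refine ⟨by omega, fun u hu => ?_, fun u hu => ?_⟩
        · split_ifs with h
          · rw [h]
          · exact h₄ u (by omega)
        · rw [if_neg (by omega), h₅ u hu]
    · simp [Expr.eval, h10, hM]
    · rintro t s' ⟨ht, -, -, -, h₄, h₅⟩
      simp only [Expr.cost]
      exact ⟨by omega, h₄, h₅⟩
  · rintro t s' ⟨⟨ht, h₁, h₂⟩, hr, ha⟩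
    exact ⟨ht, h₁, h₂, fun x hx => hr x (by simp [reverseCopy, Program.WritesReg, forLoop]; omega),
      fun y hy => ha y (by simpa [reverseCopy, Program.WritesArr, forLoop] using hy)⟩

end WordRAM

/-! ### Invariants for lists of runs and stacks of occurrences -/

namespace STRICLCS

/-- `bd` lists the starting positions of the runs among the first `i` characters of `a`. -/
structure IsRunPrefix (a : ℕ → ℕ) (i : ℕ) (bd : ℕ → ℕ) : Prop where
  lt : ∀ x < Nat.count (NewRun a) i, bd x < i ∧ NewRun a (bd x)
  step : ∀ x, x + 1 < Nat.count (NewRun a) i →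
    runStart a (bd (x + 1)) = bd x ∧ bd x < bd (x + 1)
  last : 0 < i → 0 < Nat.count (NewRun a) i ∧ bd (Nat.count (NewRun a) i - 1) = runStart a i
  zero : 0 < i → bd 0 = 0

/-- `st` gives the starts of the runs of `a`, and `bd` lists them, followed by the length `M`. -/
structure IsRunTable (a : ℕ → ℕ) (M : ℕ) (st bd : ℕ → ℕ) : Prop where
  st_eq : ∀ i ≤ M, st i = runStart a i
  lt : ∀ x < Nat.count (NewRun a) M, bd x < M ∧ NewRun a (bd x)
  step : ∀ x < Nat.count (NewRun a) M, runStart a (bd (x + 1)) = bd x ∧ bd x < bd (x + 1)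
  last : bd (Nat.count (NewRun a) M) = M
  zero : bd 0 = 0

variable {a bd bd' : ℕ → ℕ} {i : ℕ}

theorem IsRunPrefix.init : IsRunPrefix a 0 bd := by
  constructor <;> simp

theorem IsRunPrefix.succ_new (h : IsRunPrefix a i bd) (hi : NewRun a i)
    (hbd : ∀ x < Nat.count (NewRun a) i, bd' x = bd x) (hi' : bd' (Nat.count (NewRun a) i) = i) :
    IsRunPrefix a (i + 1) bd' := by
  have hc : Nat.count (NewRun a) (i + 1) = Nat.count (NewRun a) i + 1 := by
    rw [Nat.count_succ, if_pos hi]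
  constructor
  · intro x hx
    rw [hc] at hx
    rcases Nat.lt_succ_iff_lt_or_eq.1 hx with hx | rfl
    · rw [hbd x hx]
      exact ⟨by have := (h.lt x hx).1; omega, (h.lt x hx).2⟩
    · rw [hi']
      exact ⟨by omega, hi⟩
  · intro x hx
    rw [hc] at hx
    rw [hbd x (by omega)]
    rcases Nat.lt_succ_iff_lt_or_eq.1 hx with hx | hx
    · rw [hbd _ hx]
      exact h.step x hx
    · have hi₀ : 0 < i := by
        by_contra h0
        obtain rfl : i = 0 := by omega
        simp at hx
      have := h.last hi₀
      rw [← hx, Nat.add_sub_cancel] at this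
      rw [hx, hi', this.2]
      exact ⟨rfl, runStart_lt a hi₀⟩
  · intro _
    rw [hc, Nat.add_sub_cancel, hi', runStart, if_pos hi]
    exact ⟨by omega, rfl⟩
  · intro _
    rcases Nat.eq_zero_or_pos i with rfl | hi₀
    · simpa using hi'
    · rw [hbd 0 (h.last hi₀).1, h.zero hi₀]

theorem IsRunPrefix.succ_old (h : IsRunPrefix a i bd) (hi : ¬ NewRun a i) :
    IsRunPrefix a (i + 1) bd := by
  have hc : Nat.count (NewRun a) (i + 1) = Nat.count (NewRun a) i := by
    rw [Nat.count_succ, if_neg hi]; rfl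
  have hi₀ : 0 < i := Nat.pos_of_ne_zero fun h => hi (.inl h)
  constructor
  · intro x hx
    rw [hc] at hx
    exact ⟨by have := (h.lt x hx).1; omega, (h.lt x hx).2⟩
  · rw [hc]
    exact h.step
  · intro _
    rw [hc, runStart, if_neg hi]
    exact h.last hi₀
  · intro _
    exact h.zero hi₀

theorem IsRunPrefix.isRunTable {st : ℕ → ℕ} (h : IsRunPrefix a i bd)
    (hst : ∀ u ≤ i, st u = runStart a u)
    (hbd : ∀ x < Nat.count (NewRun a) i, bd' x = bd x) (hi' : bd' (Nat.count (NewRun a) i) = i) :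
    IsRunTable a i st bd' := by
  refine ⟨hst, fun x hx => by rw [hbd x hx]; exact h.lt x hx, fun x hx => ?_, hi', ?_⟩
  · rw [hbd x hx]
    rcases Nat.lt_or_eq_of_le (Nat.succ_le_of_lt hx) with hx' | hx'
    · rw [hbd _ hx']
      exact h.step x hx'
    · have hi₀ : 0 < i := by
        by_contra h0
        obtain rfl : i = 0 := by omega
        simp at hx'
      have := h.last hi₀
      rw [← hx', Nat.succ_sub_one] at this
      rw [← Nat.succ_eq_add_one, hx', hi', this.2]
      exact ⟨rfl, runStart_lt a hi₀⟩
  · rcases Nat.eq_zero_or_pos i with rfl | hi₀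
    · simpa using hi'
    · rw [hbd 0 (h.last hi₀).1, h.zero hi₀]

/-- `occ` stores the positions of the `cnt` occurrences of `c` before the coded position `q`. -/
structure IsOccStack (a : ℕ → ℕ) (c q cnt : ℕ) (occ : ℕ → ℕ) : Prop where
  zero : occ 0 = 0
  step : ∀ x < cnt, prevOcc a c (occ (x + 1)) = occ x
  top : occ cnt = prevOcc a c q
  le : ∀ x ≤ cnt, occ x ≤ q
  cnt_le : cnt < q

/-- Stepping to the previous occurrence is popping the stack. Once the stack is exhausted, the
truncated subtraction stays at entry `0`, which holds the code `0` for "none". -/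
theorem IsOccStack.iterate {c q cnt : ℕ} {occ : ℕ → ℕ} (h : IsOccStack a c q cnt occ) (t : ℕ) :
    (prevOcc a c)^[t + 1] q = occ (cnt - t) := by
  induction t with
  | zero => exact h.top.symm
  | succ t ih =>
    rw [Function.iterate_succ_apply', ih]
    rcases Nat.lt_or_ge t cnt with ht | ht
    · rw [← h.step (cnt - (t + 1)) (by omega)]
      congr 2
      omega
    · rw [Nat.sub_eq_zero_of_le ht, Nat.sub_eq_zero_of_le (by omega), h.zero, prevOcc]

theorem IsOccStack.succ_eq {c q cnt : ℕ} {occ occ' : ℕ → ℕ} (h : IsOccStack a c q cnt occ)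
    (hq : a (q - 1) = c) (hocc : ∀ x ≤ cnt, occ' x = occ x) (ht : occ' (cnt + 1) = q) :
    IsOccStack a c (q + 1) (cnt + 1) occ' := by
  have hcq := h.cnt_le
  obtain ⟨q, rfl⟩ := Nat.exists_eq_succ_of_ne_zero (show q ≠ 0 by omega)
  refine ⟨by rw [hocc 0 (by omega), h.zero], fun x hx => ?_, ?_, fun x hx => ?_, by omega⟩
  · rw [hocc x (by omega)]
    rcases Nat.lt_succ_iff_lt_or_eq.1 hx with hx | rfl
    · rw [hocc _ (by omega), h.step x hx]
    · rw [ht, h.top]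
  · rw [ht, prevOcc, if_pos (by simpa using hq)]
  · rcases Nat.lt_or_eq_of_le hx with hx | rfl
    · rw [hocc x (by omega)]
      have := h.le x (by omega)
      omega
    · omega

theorem IsOccStack.succ_ne {c q cnt : ℕ} {occ : ℕ → ℕ} (h : IsOccStack a c q cnt occ)
    (hq : a (q - 1) ≠ c) : IsOccStack a c (q + 1) cnt occ := by
  have hcq := h.cnt_le
  obtain ⟨q, rfl⟩ := Nat.exists_eq_succ_of_ne_zero (show q ≠ 0 by omega)
  refine ⟨h.zero, h.step, ?_, fun x hx => ?_, by omega⟩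
  · rw [h.top, Nat.succ_eq_add_one, prevOcc.eq_3, if_neg (by simpa using hq)]
  · have := h.le x hx
    omega

theorem iterate_prevOcc_zero (a : ℕ → ℕ) (c k : ℕ) : (prevOcc a c)^[k] 0 = 0 :=
  Function.iterate_fixed rfl k

theorem iterate_prevOcc_le (a : ℕ → ℕ) (c k q : ℕ) : (prevOcc a c)^[k] q ≤ q := by
  rw [← latest_replicate]
  exact latest_le _ _ _

end STRICLCS

/-! ### Programs that find runs and match one run -/

namespace WordRAM

open STRICLCS

/-- Computes the runs of the string `ch`, and their number in the register `cr`. -/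
def findRuns (ch st bd len cr : ℕ) : Program :=
  .seq (.assign cr (.const 0)) <| .seq (.assign 10 (.const 0)) <|
  .seq (.store st (.const 0) (.const 0)) <|
  .seq (forLoop 10 len <|
    .seq (.ite (.not (.and (.lt (.const 0) (.reg 10))
        (.eq (.get ch (.reg 10)) (.get ch (.sub (.reg 10) (.const 1))))))
      (.seq (.store bd (.reg cr) (.reg 10)) (.assign cr (.add (.reg cr) (.const 1)))) .skip) <|
    .store st (.add (.reg 10) (.const 1)) (.get bd (.sub (.reg cr) (.const 1)))) <|
  .store bd (.reg cr) (.reg len)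

theorem wp_findRuns {w ch st bd len cr M : ℕ} {s : State} (h₁ : ch ≠ st) (h₂ : ch ≠ bd)
    (h₃ : st ≠ bd) (hlen : len < 10) (hcr : cr < 10) (hlc : len ≠ cr)
    (hM : s.reg len = M) (hw : M + 16 < 2 ^ w) (hc : ∀ i, s.arr ch i < 2 ^ w) :
    WP w (findRuns ch st bd len cr) s fun t s' => t ≤ 50 * M + 50 ∧
      IsRunTable (s.arr ch) M (s'.arr st) (s'.arr bd) ∧
      s'.reg cr = Nat.count (NewRun (s.arr ch)) M ∧
      (∀ x < 10, x ≠ cr → s'.reg x = s.reg x) ∧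
      ∀ y, y ≠ st → y ≠ bd → s'.arr y = s.arr y := by
  have h10 : len ≠ 10 := by omega
  have h10' : cr ≠ 10 := by omega
  refine (WP.frame (Q := fun t s' => t ≤ 50 * M + 50 ∧
    IsRunTable (s.arr ch) M (s'.arr st) (s'.arr bd) ∧
    s'.reg cr = Nat.count (NewRun (s.arr ch)) M) ?_).mono ?_
  · refine .seq (.assign (by simp only [Expr.Fits]; omega) ?_)
    refine .seq (.assign (by simp only [Expr.Fits]; omega) ?_)
    refine .seq (.store (by simp only [Expr.Fits]; omega) (by simp only [Expr.Fits]; omega) ?_)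
    refine .seq ((WP.forLoop (hi := M) (Φ := fun i => 50 * i)
      (I := fun i s' => s'.reg 10 = i ∧ s'.reg len = M ∧ s'.arr ch = s.arr ch ∧
        s'.reg cr = Nat.count (NewRun (s.arr ch)) i ∧
        IsRunPrefix (s.arr ch) i (s'.arr bd) ∧
        ∀ u ≤ i, s'.arr st u = runStart (s.arr ch) u)
      (by omega) (fun i s' h => ⟨h.1, h.2.1⟩) ?_ (lo := 0) (by omega) ?_).mono ?_)
    · rintro i s' hi ⟨g₁, g₂, g₃, g₄, g₅, g₆⟩
      have hcnt : Nat.count (NewRun (s.arr ch)) i ≤ i := Nat.count_le _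
      refine .seq (WP.mono (Q := fun t s' => t ≤ 25 ∧ s'.reg 10 = i ∧ s'.reg len = M ∧
        s'.arr ch = s.arr ch ∧ s'.reg cr = Nat.count (NewRun (s.arr ch)) (i + 1) ∧
        IsRunPrefix (s.arr ch) (i + 1) (s'.arr bd) ∧
        ∀ u ≤ i, s'.arr st u = runStart (s.arr ch) u) (.ite ?_ ?_ ?_) ?_)
      · simp only [Cond.Fits, Expr.Fits, g₁, g₃, Expr.eval]
        exact ⟨⟨by omega, by omega⟩, ⟨by omega, hc _⟩, ⟨by omega, by omega⟩, hc _⟩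
      · intro hb
        have hnew : NewRun (s.arr ch) i := by
          simp only [Cond.Holds, Expr.eval, g₁, g₃] at hb
          rw [NewRun]
          by_contra hcon
          push Not at hcon
          exact hb ⟨by omega, hcon.2⟩
        refine .seq (.store ?_ ?_ (.assign ?_ ?_))
        · simp only [Expr.Fits, g₄]; omega
        · simp only [Expr.Fits, g₁]; omega
        · simp only [Expr.Fits, Expr.eval, State.setArr_reg, g₄]; omega
        · simp only [Expr.eval, Expr.cost, Cond.cost, State.setReg_reg, State.setArr_reg,
            State.setReg_arr, State.setArr_arr_ne _ _ _ h₂, State.setArr_arr_ne _ _ _ h₃, g₁, g₂,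
            g₃, g₄, if_neg hlc, if_neg h10'.symm, if_true, true_and]
          refine ⟨by omega, ?_, ?_, g₆⟩
          · rw [Nat.count_succ, if_pos hnew]
          · refine g₅.succ_new hnew (fun x hx => ?_) ?_
            · rw [State.setArr_arr_same, if_neg (by omega)]
            · rw [State.setArr_arr_same, if_pos rfl]
      · intro hb
        have hold : ¬ NewRun (s.arr ch) i := by
          simp only [Cond.Holds, Expr.eval, g₁, g₃, not_not] at hb
          rw [NewRun]
          push Not
          exact ⟨by omega, hb.2⟩
        refine .skip ?_
        simp only [Cond.cost, Expr.cost]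
        exact ⟨by omega, g₁, g₂, g₃, by rw [Nat.count_succ, if_neg hold, g₄]; rfl,
          g₅.succ_old hold, g₆⟩
      · rintro t s₁ ⟨ht, g₁, g₂, g₃, g₄, g₅, g₆⟩
        -- The run that contains position `i` is the most recently listed one, so its start is the
        -- entry below the top of the list.
        have hlast := g₅.last (by omega)
        have hst := runStart_le (s.arr ch) (i + 1)
        have hcnt : Nat.count (NewRun (s.arr ch)) (i + 1) ≤ i + 1 := Nat.count_le _
        refine .store ?_ ?_ ?_
        · simp only [Expr.Fits, Expr.eval, g₁]; omega
        · simp only [Expr.Fits, Expr.eval, g₄, hlast.2]; omega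
        · simp only [Expr.eval, Expr.cost, State.setReg_reg, State.setArr_reg,
            State.setReg_arr, State.setArr_arr_ne _ _ _ h₁, State.setArr_arr_ne _ _ _ h₃.symm, g₁,
            g₂, g₃, g₄, if_neg h10, if_neg h10', if_true, true_and, hlast.2]
          refine ⟨by omega, g₅, fun u hu => ?_⟩
          rw [State.setArr_arr_same]
          split_ifs with h
          · rw [h]
          · exact g₆ u (by omega)
    · simp [Expr.eval, h10, h10', hM, hlc, h₁, h₃.symm, IsRunPrefix.init, runStart]
    · rintro t s' ⟨ht, g₁, g₂, g₃, g₄, g₅, g₆⟩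
      have hcnt : Nat.count (NewRun (s.arr ch)) M ≤ M := Nat.count_le _
      refine .store ?_ ?_ ?_
      · simp only [Expr.Fits, g₄]; omega
      · simp only [Expr.Fits, g₂]; omega
      · simp only [Expr.eval, Expr.cost, State.setArr_reg, State.setArr_arr_ne _ _ _ h₃, g₂, g₄,
          and_true]
        refine ⟨by omega, g₅.isRunTable g₆ (fun x hx => ?_) ?_⟩
        · rw [State.setArr_arr_same, if_neg (by omega)]
        · rw [State.setArr_arr_same, if_pos rfl]
  · rintro t s' ⟨⟨ht, g₁, g₂⟩, hr, ha⟩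
    refine ⟨ht, g₁, g₂, fun x hx hx' => hr x ?_, fun y hy hy' => ha y ?_⟩
    · simp [findRuns, Program.WritesReg, forLoop]; omega
    · simp [findRuns, Program.WritesArr, forLoop, hy, hy']

/-- `F q := q` for all coded positions `q`. -/
def initPositions (F len : ℕ) : Program :=
  .seq (.assign 10 (.const 0)) <| .seq (.assign 11 (.add (.reg len) (.const 2))) <|
  forLoop 10 11 <| .store F (.reg 10) (.reg 10)

theorem wp_initPositions {w F len M : ℕ} {s : State} (hlen : len < 10) (hM : s.reg len = M)
    (hw : M + 16 < 2 ^ w) :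
    WP w (initPositions F len) s fun t s' => t ≤ 20 * M + 60 ∧
      (∀ q ≤ M + 1, s'.arr F q = q) ∧
      (∀ x < 10, s'.reg x = s.reg x) ∧ ∀ y, y ≠ F → s'.arr y = s.arr y := by
  have h10 : len ≠ 10 := by omega
  refine (WP.frame (Q := fun t s' => t ≤ 20 * M + 60 ∧ ∀ q ≤ M + 1, s'.arr F q = q) ?_).mono ?_
  · refine .seq (.assign (by simp only [Expr.Fits]; omega) ?_)
    refine .seq (.assign ?_ ?_)
    · simp only [Expr.Fits, Expr.eval, State.setReg_reg, if_neg h10, hM]; omega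
    refine (WP.forLoop (hi := M + 2) (Φ := fun i => 20 * i)
      (I := fun i s' => s'.reg 10 = i ∧ s'.reg 11 = M + 2 ∧ ∀ u < i, s'.arr F u = u)
      (by omega) (fun i s' h => ⟨h.1, h.2.1⟩) ?_ (lo := 0) (by omega) ?_).mono ?_
    · rintro i s' hi ⟨g₁, g₂, g₃⟩
      refine .store ?_ ?_ ?_
      · simp only [Expr.Fits, g₁]; omega
      · simp only [Expr.Fits, g₁]; omega
      · simp only [Expr.eval, Expr.cost, State.setReg_reg, State.setArr_reg, State.setReg_arr,
          g₁, g₂, if_true, true_and]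
        refine ⟨by omega, by simp, fun u hu => ?_⟩
        rw [State.setArr_arr_same]
        split_ifs with h
        · exact h.symm
        · exact g₃ u (by omega)
    · simp [Expr.eval, h10, hM]
    · rintro t s' ⟨ht, -, -, g₃⟩
      simp only [Expr.cost]
      exact ⟨by omega, fun q hq => g₃ q (by omega)⟩
  · rintro t s' ⟨⟨ht, h₁⟩, hr, ha⟩
    refine ⟨ht, h₁, fun x hx => hr x ?_, fun y hy => ha y ?_⟩
    · simp [initPositions, Program.WritesReg, forLoop]; omega
    · simpa [initPositions, Program.WritesArr, forLoop] using hy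

/-- Moves all positions in `F` backwards over the latest embedding of `c ^ k` into the string
`ch`, where `c` and `k` are in the registers `12` and `13`. -/
def matchRun (ch F len : ℕ) : Program :=
  .seq (.assign 14 (.const 0)) <| .seq (.store 20 (.const 0) (.const 0)) <|
  .seq (.store 19 (.const 0) (.const 0)) <|
  .seq (.assign 11 (.add (.reg len) (.const 2))) <| .seq (.assign 10 (.const 1)) <|
  forLoop 10 11 <|
    .seq (.store 19 (.reg 10) (.get 20 (.sub (.add (.reg 14) (.const 1)) (.reg 13)))) <|
    .seq (.store F (.reg 10) (.get 19 (.get F (.reg 10)))) <|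
    .ite (.eq (.get ch (.sub (.reg 10) (.const 1))) (.reg 12))
      (.seq (.assign 14 (.add (.reg 14) (.const 1))) (.store 20 (.reg 14) (.reg 10))) .skip

/-- One pass suffices: entry `q` of array `19` is the `k`-th last occurrence of `c` before `q`, and
`F q ≤ q` ensures that the entry at `F q` is already known when `F q` is updated. The time does not
depend on `k`. -/
theorem wp_matchRun {w ch F len M c k : ℕ} {s : State} (h₁ : ch ≠ F) (h₂ : ch ≠ 19)
    (h₃ : ch ≠ 20) (h₄ : F ≠ 19) (h₅ : F ≠ 20) (hlen : len < 10) (hM : s.reg len = M)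
    (hw : M + 16 < 2 ^ w) (hc : ∀ i, s.arr ch i < 2 ^ w) (hF : ∀ q ≤ M + 1, s.arr F q ≤ q)
    (h12 : s.reg 12 = c) (h13 : s.reg 13 = k) (hcw : c < 2 ^ w) (hkw : k < 2 ^ w) (hk : 0 < k) :
    WP w (matchRun ch F len) s fun t s' => t ≤ 60 * M + 200 ∧
      (∀ q ≤ M + 1, s'.arr F q = (prevOcc (s.arr ch) c)^[k] (s.arr F q)) ∧
      (∀ x, x ≠ 10 → x ≠ 11 → x ≠ 14 → s'.reg x = s.reg x) ∧
      ∀ y, y ≠ F → y ≠ 19 → y ≠ 20 → s'.arr y = s.arr y := by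
  have h10 : len ≠ 14 := by omega
  refine (WP.frame (Q := fun t s' => t ≤ 60 * M + 200 ∧
    ∀ q ≤ M + 1, s'.arr F q = (prevOcc (s.arr ch) c)^[k] (s.arr F q)) ?_).mono ?_
  · refine .seq (.assign (by simp only [Expr.Fits]; omega) ?_)
    refine .seq (.store (by simp only [Expr.Fits]; omega) (by simp only [Expr.Fits]; omega) ?_)
    refine .seq (.store (by simp only [Expr.Fits]; omega) (by simp only [Expr.Fits]; omega) ?_)
    refine .seq (.assign ?_ ?_)
    · simp only [Expr.Fits, Expr.eval, State.setReg_reg, State.setArr_reg, if_neg h10, hM]; omega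
    refine .seq (.assign (by simp only [Expr.Fits]; omega) ?_)
    refine (WP.forLoop (hi := M + 2) (Φ := fun i => 60 * i)
      (I := fun q s' => s'.reg 10 = q ∧ s'.reg 11 = M + 2 ∧ s'.reg 12 = c ∧ s'.reg 13 = k ∧
        s'.arr ch = s.arr ch ∧ IsOccStack (s.arr ch) c q (s'.reg 14) (s'.arr 20) ∧
        (∀ u < q, s'.arr 19 u = (prevOcc (s.arr ch) c)^[k] u) ∧
        (∀ u < q, s'.arr F u = (prevOcc (s.arr ch) c)^[k] (s.arr F u)) ∧
        ∀ u, q ≤ u → s'.arr F u = s.arr F u)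
      (by omega) (fun i s' h => ⟨h.1, h.2.1⟩) ?_ (lo := 1) (by omega) ?_).mono ?_
    · rintro q s' hq ⟨g₁, g₂, g₃, g₄, g₅, g₆, g₇, g₈, g₉⟩
      have hcnt := g₆.cnt_le
      -- If there are fewer than `k` occurrences, the index is truncated to `0` and the result is
      -- the code for "none". Entries above the top of the stack are stale but never read.
      have hit : s'.arr 20 (s'.reg 14 + 1 - k) = (prevOcc (s.arr ch) c)^[k] q := by
        obtain ⟨k, rfl⟩ := Nat.exists_eq_succ_of_ne_zero hk.ne'
        rw [Nat.succ_eq_add_one, g₆.iterate k]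
        congr 1
        omega
      have hit' := iterate_prevOcc_le (s.arr ch) c k q
      have hFq := hF q (by omega)
      have hit'' := iterate_prevOcc_le (s.arr ch) c k (s.arr F q)
      have hh : ∀ u ≤ q, (s'.setArr 19 q ((prevOcc (s.arr ch) c)^[k] q)).arr 19 u =
          (prevOcc (s.arr ch) c)^[k] u := by
        intro u hu
        rw [State.setArr_arr_same]
        split_ifs with h
        · rw [h]
        · exact g₇ u (by omega)
      refine .seq (.store ?_ ?_ (.seq (.store ?_ ?_ (.ite ?_ ?_ ?_))))
      · simp only [Expr.Fits, g₁]; omega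
      · simp only [Expr.Fits, Expr.eval, g₄, hit]
        exact ⟨⟨⟨by omega, by omega, by omega⟩, by omega⟩, by omega⟩
      · simp only [Expr.Fits, State.setArr_reg, g₁]; omega
      · simp only [Expr.Fits, Expr.eval, State.setArr_reg, g₁, g₄, hit,
          State.setArr_arr_ne _ _ _ h₄, g₉ q le_rfl, hh _ hFq]
        omega
      · simp only [Cond.Fits, Expr.Fits, Expr.eval, State.setArr_reg, g₁, g₃,
          State.setArr_arr_ne _ _ _ h₁, State.setArr_arr_ne _ _ _ h₂, g₅]
        exact ⟨⟨⟨by omega, by omega⟩, hc _⟩, hcw⟩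
      · intro hb
        simp only [Cond.Holds, Expr.eval, State.setArr_reg, g₁, g₃,
          State.setArr_arr_ne _ _ _ h₁, State.setArr_arr_ne _ _ _ h₂, g₅] at hb
        refine .seq (.assign ?_ (.store ?_ ?_ ?_))
        · simp only [Expr.Fits, Expr.eval, State.setArr_reg]; omega
        · simp only [Expr.Fits, Expr.eval, State.setReg_reg, State.setArr_reg, if_true]; omega
        · simp [Expr.Fits, g₁]; omega
        · simp only [Expr.eval, Expr.cost, Cond.cost, State.setReg_reg, State.setArr_reg,
            State.setReg_arr, g₁, g₂, g₃, g₄, hit, State.setArr_arr_ne _ _ _ h₁,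
            State.setArr_arr_ne _ _ _ h₂, State.setArr_arr_ne _ _ _ h₃,
            State.setArr_arr_ne _ _ _ h₄, State.setArr_arr_ne _ _ _ h₅,
            State.setArr_arr_ne _ _ _ h₄.symm, g₅,
            g₉ q le_rfl, hh _ hFq, if_true, true_and,
            State.setArr_arr_ne (b := 19) (a := 20) _ _ _ (by decide)]
          refine ⟨by omega, by simp, by simp, by simp, by simp, ?_, fun u hu => hh u (by omega),
            fun u hu => ?_, fun u hu => ?_⟩
          · simp only [show (14 : ℕ) ≠ 10 by decide, if_false]
            refine g₆.succ_eq hb (fun x hx => ?_) ?_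
            · rw [State.setArr_arr_same, if_neg (by omega), State.setReg_arr,
                State.setArr_arr_ne _ _ _ h₅.symm,
                State.setArr_arr_ne _ _ _ (by decide)]
            · rw [State.setArr_arr_same, if_pos rfl]
              simp
          · rw [State.setArr_arr_same]
            split_ifs with h
            · rw [h]
            · rw [State.setArr_arr_ne _ _ _ h₄, g₈ u (by omega)]
          · rw [State.setArr_arr_same, if_neg (by omega), State.setArr_arr_ne _ _ _ h₄,
              g₉ u (by omega)]
      · intro hb
        simp only [Cond.Holds, Expr.eval, State.setArr_reg, g₁, g₃,
          State.setArr_arr_ne _ _ _ h₁, State.setArr_arr_ne _ _ _ h₂, g₅] at hb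
        refine .skip ?_
        simp only [Expr.eval, Expr.cost, Cond.cost, State.setReg_reg, State.setArr_reg,
          State.setReg_arr, g₁, g₂, g₃, g₄, hit, State.setArr_arr_ne _ _ _ h₁,
          State.setArr_arr_ne _ _ _ h₂, State.setArr_arr_ne _ _ _ h₄,
          State.setArr_arr_ne _ _ _ h₄.symm, State.setArr_arr_ne _ _ _ h₅.symm, g₅,
          g₉ q le_rfl, hh _ hFq, if_true, true_and,
          State.setArr_arr_ne (b := 20) (a := 19) _ _ _ (by decide)]
        refine ⟨by omega, by simp, by simp, by simp, by simpa using g₆.succ_ne hb,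
          fun u hu => hh u (by omega), fun u hu => ?_, fun u hu => ?_⟩
        · rw [State.setArr_arr_same]
          split_ifs with h
          · rw [h]
          · rw [State.setArr_arr_ne _ _ _ h₄, g₈ u (by omega)]
        · rw [State.setArr_arr_same, if_neg (by omega), State.setArr_arr_ne _ _ _ h₄,
            g₉ u (by omega)]
    -- The loop starts at `1`: the coded position `0` is fixed by `prevOcc`, and `F 0 = 0` by `hF`.
    · have hF0 := hF 0 (by omega)
      simp only [Expr.eval, State.setReg_reg, State.setArr_reg, State.setReg_arr, h10, hM, h12, h13,
        State.setArr_arr_ne _ _ _ h₂, State.setArr_arr_ne _ _ _ h₃, State.setArr_arr_ne _ _ _ h₄,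
        State.setArr_arr_ne _ _ _ h₅, State.setArr_arr_ne (b := 20) (a := 19) _ _ _ (by decide)]
      refine ⟨by simp, by simp, by simp, by simp, trivial, ?_, ?_, ?_, by simp⟩
      · simp only [show (14 : ℕ) ≠ 10 by decide, show (14 : ℕ) ≠ 11 by decide, if_false, if_true]
        refine ⟨by simp, by simp, by simp [prevOcc], ?_, by omega⟩
        intro x hx
        obtain rfl : x = 0 := by omega
        simp
      · intro u hu
        obtain rfl : u = 0 := by omega
        simp [iterate_prevOcc_zero]
      · intro u hu
        obtain rfl : u = 0 := by omega
        rw [Nat.le_zero.1 hF0, iterate_prevOcc_zero]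
    · rintro t s' ⟨ht, -, -, -, -, -, -, -, g₈, -⟩
      simp only [Expr.cost]
      exact ⟨by omega, fun q hq => g₈ q (by omega)⟩
  · rintro t s' ⟨⟨ht, g₁⟩, hr, ha⟩
    refine ⟨ht, g₁, fun x hx hx' hx'' => hr x ?_, fun y hy hy' hy'' => ha y ?_⟩
    · simp [matchRun, Program.WritesReg, forLoop]; omega
    · simp [matchRun, Program.WritesArr, forLoop, hy, hy', hy'']

end WordRAM

/-! ### Special cells and sparse LCS tables -/

namespace STRICLCS

theorem index_lt {M N i j : ℕ} (hi : i ≤ M) (hj : j ≤ N) :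
    i * (N + 1) + j < (M + 1) * (N + 1) := by
  have : i * (N + 1) ≤ M * (N + 1) := Nat.mul_le_mul_right _ hi
  rw [add_mul]
  omega

theorem index_inj {N i j i' j' : ℕ} (hj : j ≤ N) (hj' : j' ≤ N)
    (h : i * (N + 1) + j = i' * (N + 1) + j') : i = i' ∧ j = j' := by
  have h₁ : (i * (N + 1) + j) / (N + 1) = i := by
    rw [mul_comm, Nat.mul_add_div (by omega), Nat.div_eq_of_lt (by omega), add_zero]
  have h₂ : (i' * (N + 1) + j') / (N + 1) = i' := by
    rw [mul_comm, Nat.mul_add_div (by omega), Nat.div_eq_of_lt (by omega), add_zero]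
  obtain rfl : i = i' := by rw [← h₁, ← h₂, h]
  exact ⟨rfl, by omega⟩

/-- A run ends at the `i`-th character of `a` or at the `j`-th character of `b`. -/
def Special (a b : ℕ → ℕ) (M N i j : ℕ) : Prop := RunEnd a M i ∨ RunEnd b N j

/-- A run other than the first starts where the previous one ends. So the run starts that `lookup`
consults give cells that lie on an axis or are special. -/
theorem NewRun.runEnd {a : ℕ → ℕ} {M i : ℕ} (h : NewRun a i) : i = 0 ∨ RunEnd a M i :=
  h.imp_right .inr

/-- The table `T` is correct on the border and where a run ends. -/
def IsLCSTable (a b : ℕ → ℕ) (M N : ℕ) (T : ℕ → ℕ → ℕ) : Prop :=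
  ∀ i ≤ M, ∀ j ≤ N, i = 0 ∨ j = 0 ∨ Special a b M N i j → T i j = lcs a b i j

theorem IsLCSTable.lookup_eq {a b : ℕ → ℕ} {M N : ℕ} {T : ℕ → ℕ → ℕ} (h : IsLCSTable a b M N T)
    {i j : ℕ} (hi : i ≤ M) (hj : j ≤ N) : lookup a b T i j = lcs a b i j := by
  refine STRICLCS.lookup_eq fun i' hi' j' hj' hs _ => h i' (by omega) j' (by omega) ?_
  rcases hs with hs | hs
  · rcases hs.runEnd (M := M) with h | h
    · exact .inl h
    · exact .inr (.inr (.inl h))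
  · rcases hs.runEnd (M := N) with h | h
    · exact .inr (.inl h)
    · exact .inr (.inr (.inr h))

end STRICLCS

/-! ### Constant-time lookup and the loop over special cells -/

namespace WordRAM

open STRICLCS

/-- Sets the register `28` to the length of a longest common subsequence of prefixes, whose lengths
are in the registers `26` and `27`. -/
def lookupCell (cha chb sta stb T : ℕ) : Program :=
  .ite (.eq (.get cha (.sub (.reg 26) (.const 1))) (.get chb (.sub (.reg 27) (.const 1))))
    (.seq (.assign 29 (.sub (.reg 26) (.get sta (.reg 26)))) <|
      .seq (.ite (.lt (.sub (.reg 27) (.get stb (.reg 27))) (.reg 29))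
        (.assign 29 (.sub (.reg 27) (.get stb (.reg 27)))) .skip) <|
      .assign 28 (.add (.get T (.add (.mul (.sub (.reg 26) (.reg 29)) (.add (.reg 1) (.const 1)))
        (.sub (.reg 27) (.reg 29)))) (.reg 29)))
    (.seq (.assign 28 (.get T (.add (.mul (.get sta (.reg 26)) (.add (.reg 1) (.const 1)))
        (.reg 27)))) <|
      .seq (.assign 29 (.get T (.add (.mul (.reg 26) (.add (.reg 1) (.const 1)))
        (.get stb (.reg 27))))) <|
      .ite (.lt (.reg 28) (.reg 29)) (.assign 28 (.reg 29)) .skip)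

theorem wp_lookupCell {w cha chb sta stb T M N p q : ℕ} {s : State}
    (hw : (M + 1) * (N + 1) + 4 * (M + N) + 16 < 2 ^ w) (hN : s.reg 1 = N)
    (hp : s.reg 26 = p) (hq : s.reg 27 = q) (hpM : p ≤ M) (hqN : q ≤ N)
    (ha : ∀ i, s.arr cha i < 2 ^ w) (hb : ∀ i, s.arr chb i < 2 ^ w)
    (hsta : s.arr sta p = runStart (s.arr cha) p) (hstb : s.arr stb q = runStart (s.arr chb) q)
    (hT : ∀ u, s.arr T u ≤ M) :
    WP w (lookupCell cha chb sta stb T) s fun t s' => t ≤ 100 ∧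
      s'.reg 28 = lookup (s.arr cha) (s.arr chb) (fun i j => s.arr T (i * (N + 1) + j)) p q ∧
      (∀ x, x ≠ 28 → x ≠ 29 → s'.reg x = s.reg x) ∧ s'.arr = s.arr := by
  have hsa := runStart_le (s.arr cha) p
  have hsb := runStart_le (s.arr chb) q
  have hNM : N + 1 ≤ (M + 1) * (N + 1) := Nat.le_mul_of_pos_left _ (by omega)
  have hidx : ∀ {i j}, i ≤ M → j ≤ N → i * (N + 1) + j < 2 ^ w := fun hi hj =>
    (index_lt hi hj).trans (by omega)
  have hidx' : ∀ {i}, i ≤ M → i * (N + 1) < 2 ^ w := fun hi => hidx hi (Nat.zero_le _)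
  refine (WP.frame (Q := fun t s' => t ≤ 100 ∧
    s'.reg 28 = lookup (s.arr cha) (s.arr chb) (fun i j => s.arr T (i * (N + 1) + j)) p q)
      ?_).mono ?_
  · refine .ite ?_ ?_ ?_
    · simp only [Cond.Fits, Expr.Fits, Expr.eval, hp, hq]
      exact ⟨⟨⟨by omega, by omega⟩, ha _⟩, ⟨by omega, by omega⟩, hb _⟩
    · intro hcond
      simp only [Cond.Holds, Expr.eval, hp, hq] at hcond
      refine .seq (.assign ?_ (.seq (WP.mono (Q := fun t s' => t ≤ 12 ∧ s'.reg 1 = N ∧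
        s'.reg 26 = p ∧ s'.reg 27 = q ∧ s'.arr = s.arr ∧ s'.reg 29 =
          min (p - runStart (s.arr cha) p) (q - runStart (s.arr chb) q)) ?_ ?_)))
      · simp only [Expr.Fits, Expr.eval, hp, hsta]; omega
      · refine .ite ?_ ?_ ?_
        · simp [Cond.Fits, Expr.Fits, Expr.eval, hp, hq, hsta, hstb]; omega
        · intro h
          simp [Cond.Holds, Expr.eval, hp, hq, hsta, hstb] at h
          refine .assign ?_ ?_
          · simp [Expr.Fits, Expr.eval, hq, hstb]; omega
          · simp [Expr.eval, Expr.cost, Cond.cost, hp, hq, hstb, hN]; omega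
        · intro h
          simp [Cond.Holds, Expr.eval, hp, hq, hsta, hstb] at h
          refine .skip ?_
          simp [Expr.eval, Expr.cost, Cond.cost, hp, hq, hsta, hN]; omega
      · rintro t s' ⟨ht, g₁, g₂, g₃, g₄, g₅⟩
        refine .assign ?_ ?_
        · have := hT ((p - s'.reg 29) * (N + 1) + (q - s'.reg 29))
          have h₁ := hidx (i := p - s'.reg 29) (j := q - s'.reg 29) (by omega) (by omega)
          have h₂ := hidx' (i := p - s'.reg 29) (by omega)
          simp only [Expr.Fits, Expr.eval, g₁, g₂, g₃, g₄]
          refine ⟨⟨⟨⟨?_, ?_, h₂⟩, ?_, h₁⟩, ?_⟩, ?_, ?_⟩ <;> omega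
        · simp only [Expr.eval, Expr.cost, Cond.cost, State.setReg_reg, if_true, g₁, g₂, g₃, g₄, g₅,
            lookup, if_pos hcond, and_true]
          omega
    · intro hcond
      simp only [Cond.Holds, Expr.eval, hp, hq] at hcond
      have hT₁ := hT (runStart (s.arr cha) p * (N + 1) + q)
      have hT₂ := hT (p * (N + 1) + runStart (s.arr chb) q)
      have h₁ := hidx (i := runStart (s.arr cha) p) (j := q) (by omega) (by omega)
      have h₂ := hidx' (i := runStart (s.arr cha) p) (by omega)
      have h₃ := hidx (i := p) (j := runStart (s.arr chb) q) (by omega) (by omega)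
      have h₄ := hidx' (i := p) (by omega)
      refine .seq (.assign ?_ (.seq (.assign ?_ (.ite ?_ ?_ ?_))))
      · simp only [Expr.Fits, Expr.eval, hp, hq, hN, hsta]
        refine ⟨⟨⟨⟨?_, ?_⟩, ?_, h₂⟩, ?_, h₁⟩, ?_⟩ <;> omega
      · simp [Expr.Fits, Expr.eval, hp, hq, hN, hstb, -Nat.one_lt_two_pow_iff]
        refine ⟨⟨⟨?_, ?_, h₄⟩, ?_, h₃⟩, ?_⟩ <;> omega
      · simp [Cond.Fits, Expr.Fits, Expr.eval, hp, hq, hN, hsta, hstb]; omega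
      · intro h
        simp [Cond.Holds, Expr.eval, hp, hq, hN, hsta, hstb] at h
        refine .assign ?_ ?_
        · simp [Expr.Fits, Expr.eval, hp, hq, hN, hstb]; omega
        · simp [Expr.eval, Expr.cost, Cond.cost, hp, hq, hN, hstb, lookup, if_neg hcond]
          omega
      · intro h
        simp [Cond.Holds, Expr.eval, hp, hq, hN, hsta, hstb] at h
        refine .skip ?_
        simp [Expr.eval, Expr.cost, Cond.cost, hp, hq, hN, hsta, lookup, if_neg hcond]
        omega
  · rintro t s' ⟨⟨ht, g₁⟩, hr, ha⟩
    refine ⟨ht, g₁, fun x hx hx' => hr x ?_, funext fun y => ha y ?_⟩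
    · simp [lookupCell, Program.WritesReg, hx, hx']
    · simp [lookupCell, Program.WritesArr]

/-- Executes `body` for all `i ≥ 1` and `j ≥ 1`, in the registers `20` and `25`, such that a run
of the first string ends at `i` or a run of the second string ends at `j`. -/
def forSpecial (cha lenA lenB bdb nb : ℕ) (body : Program) : Program :=
  .seq (.assign 20 (.const 1)) <| .seq (.assign 21 (.add (.reg lenA) (.const 1))) <|
  forLoop 20 21 <|
    .seq (.ite (.not (.and (.not (.eq (.reg 20) (.reg lenA)))
          (.eq (.get cha (.reg 20)) (.get cha (.sub (.reg 20) (.const 1))))))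
      (.seq (.assign 23 (.add (.reg lenB) (.const 1))) (.assign 24 (.const 1)))
      (.seq (.assign 23 (.add (.reg nb) (.const 1))) (.assign 24 (.const 0)))) <|
    .seq (.assign 22 (.const 1)) <|
    forLoop 22 23 <|
      .seq (.ite (.eq (.reg 24) (.const 1)) (.assign 25 (.reg 22))
        (.assign 25 (.get bdb (.reg 22)))) body

/-- `I i j` is to be read as "all cells lexicographically before `(i, j)` are done". By `hskip`,
cells that are not special may be passed over for free, so a user of the rule reasons as about a
full double loop. Rows at a run end of `a` visit all `N` columns, the others only the run ends of
`b`. -/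
theorem wp_forSpecial {w cha lenA lenB bdb nb M N τ : ℕ} {a b st bd : ℕ → ℕ} {body : Program}
    {I : ℕ → ℕ → State → Prop} (hM₀ : 0 < M)
    (hw : (M + 1) * (N + 1) + 4 * (M + N) + 16 < 2 ^ w)
    (hlA : lenA < 10) (ha : ∀ i, a i < 2 ^ w)
    (hb : IsRunTable b N st bd)
    (hI : ∀ i j s, I i j s → s.arr cha = a ∧ s.arr bdb = bd ∧ s.reg lenA = M ∧ s.reg lenB = N ∧
      s.reg nb = Nat.count (NewRun b) N)
    (hset : ∀ i j s x v, 20 ≤ x → x ≤ 25 → I i j s → I i j (s.setReg x v))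
    (hskip : ∀ i j s, 0 < i → i ≤ M → 0 < j → j ≤ N → ¬ Special a b M N i j → I i j s →
      I i (j + 1) s)
    (hrow : ∀ i s, 0 < i → i ≤ M → I i (N + 1) s → I (i + 1) 1 s)
    (hwr : ∀ x, 20 ≤ x → x ≤ 25 → ¬ body.WritesReg x)
    (hbody : ∀ i j s, 0 < i → i ≤ M → 0 < j → j ≤ N → Special a b M N i j → s.reg 20 = i →
      s.reg 25 = j → I i j s → WP w body s fun t s' => t ≤ τ ∧ I i (j + 1) s')
    {s : State} (hs : I 1 1 s) :
    WP w (forSpecial cha lenA lenB bdb nb body) s fun t s' =>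
      t ≤ ((Nat.count (NewRun a) M + 1) * N + Nat.count (NewRun b) N * (M + 1)) * (τ + 20) +
        60 * (M + 1) + 20 ∧ I (M + 1) 1 s' := by
  set n := Nat.count (NewRun b) N with hn
  have hNM : N + 1 ≤ (M + 1) * (N + 1) := Nat.le_mul_of_pos_left _ (by omega)
  have hnN : n ≤ N := Nat.count_le _
  have hlt : ∀ {x y : ℕ}, x < 10 → 20 ≤ y → x ≠ y := fun h₁ h₂ => by omega
  refine .seq (.assign (by simp only [Expr.Fits]; omega) (.seq (.assign ?_ ?_)))
  · simp only [Expr.Fits, Expr.eval, State.setReg_reg, if_neg (hlt hlA le_rfl), (hI _ _ _ hs).2.2.1]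
    omega
  -- The potential counts the visited cells. The run end `i < M` is paid for by the new run that
  -- starts at `i`, the end `i = M` by the summand `1` in the last case.
  refine (WP.forLoop (hi := M + 1) (Φ := fun i =>
      ((if i ≤ M then Nat.count (NewRun a) i else Nat.count (NewRun a) M + 1) * N + n * i) *
        (τ + 20) + 60 * i)
    (I := fun i s => s.reg 20 = i ∧ s.reg 21 = M + 1 ∧ 0 < i ∧ I i 1 s)
    (by omega) (fun i s h => ⟨h.1, h.2.1⟩) ?_ (lo := 1) (by omega) ?_).mono ?_
  · rintro i s hi ⟨h20, h21, hi₀, hIs⟩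
    obtain ⟨f₁, f₂, f₃, f₄, f₅⟩ := hI _ _ _ hIs
    obtain ⟨flag, hflag⟩ : ∃ flag : ℕ, flag = if RunEnd a M i then 1 else 0 := ⟨_, rfl⟩
    obtain ⟨L, hL⟩ : ∃ L : ℕ, L = if RunEnd a M i then N else n := ⟨_, rfl⟩
    -- `jj` enumerates the columns visited in row `i`, with `jj 0 = 0` as a sentinel and `jj L = N`
    -- as the last one.
    obtain ⟨jj, hjj⟩ : ∃ jj : ℕ → ℕ, jj = if RunEnd a M i then id else bd := ⟨_, rfl⟩
    have hLN : L ≤ N := by rw [hL]; split <;> omega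
    have hjj₀ : jj 0 = 0 := by rw [hjj]; split; exacts [rfl, hb.zero]
    have hjjL : jj L = N := by rw [hjj, hL]; split; exacts [rfl, hb.last]
    have hstep : ∀ x < L, jj x < jj (x + 1) := by
      intro x hx
      rw [hL] at hx
      rw [hjj]
      split <;> rename_i h
      · exact Nat.lt_succ_self x
      · rw [if_neg h] at hx
        exact (hb.step x hx).2
    have hjjN : ∀ x ≤ L, jj x ≤ N := by
      intro x hx
      rw [hL] at hx
      rw [hjj]
      split at hx <;> rename_i h
      · rwa [if_pos h]
      · rw [if_neg h]
        rcases Nat.lt_or_eq_of_le hx with hx | rfl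
        · exact (hb.lt x hx).1.le
        · exact hb.last.le
    -- The skipped columns lie strictly inside a run of `b`, and the row is not at a run end of `a`.
    have hns : ∀ x < L, ∀ j, jj x < j → j < jj (x + 1) → ¬ Special a b M N i j := by
      intro x hx j hj hj'
      have hle := hjjN (x + 1) hx
      rw [hL] at hx
      split at hx <;> rename_i h <;> rw [hjj] at hj hj' hle
      · simp only [if_pos h, id] at hj hj'
        omega
      · simp only [if_neg h] at hj hj' hle
        rintro (hr | hr | hr)
        · exact h hr
        · omega
        · refine not_newRun ?_ hj' (.inr hr)
          rwa [(hb.step x hx).1]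
    have hsp : ∀ x < L, Special a b M N i (jj (x + 1)) := by
      intro x hx
      have hlt := hstep x hx
      rw [hL] at hx
      split at hx <;> rename_i h
      · exact .inl h
      · rw [hjj, if_neg h] at hlt ⊢
        refine .inr ?_
        rcases Nat.lt_or_eq_of_le (Nat.succ_le_of_lt hx) with hx' | hx'
        · rcases (hb.lt _ hx').2.runEnd (M := N) with h | h
          · rw [← Nat.succ_eq_add_one, h] at hlt
            omega
          · exact h
        · rw [← Nat.succ_eq_add_one, hx', hb.last]
          exact .inl rfl
    refine .seq (WP.mono (Q := fun t s' => t ≤ 25 ∧ s'.reg 20 = i ∧ s'.reg 21 = M + 1 ∧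
      s'.reg 23 = L + 1 ∧ s'.reg 24 = flag ∧ I i 1 s') (.ite ?_ ?_ ?_) ?_)
    · simp only [Cond.Fits, Expr.Fits, Expr.eval, h20, f₁, f₃]
      exact ⟨⟨by omega, by omega⟩, ⟨by omega, ha _⟩, ⟨by omega, by omega⟩, ha _⟩
    · intro h
      have h' : RunEnd a M i := by
        simp only [Cond.Holds, Expr.eval, h20, f₁, f₃] at h
        rw [RunEnd]
        by_contra hcon
        push Not at hcon
        exact h hcon
      rw [if_pos h'] at hL hflag
      refine .seq (.assign ?_ (.assign ?_ ?_))
      · simp only [Expr.Fits, Expr.eval, f₄]; omega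
      · simp only [Expr.Fits]; omega
      · simp only [Expr.cost, Cond.cost, Expr.eval, f₄, hL, hflag]
        exact ⟨by omega, by simp [h20], by simp [h21], by simp, by simp,
          hset _ _ _ _ _ (by omega) (by omega) (hset _ _ _ _ _ (by omega) (by omega) hIs)⟩
    · intro h
      have h' : ¬ RunEnd a M i := by
        simp only [Cond.Holds, Expr.eval, h20, f₁, f₃, not_not] at h
        rw [RunEnd]
        push Not
        exact h
      rw [if_neg h'] at hL hflag
      refine .seq (.assign ?_ (.assign ?_ ?_))
      · simp only [Expr.Fits, Expr.eval, f₅]; omega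
      · simp only [Expr.Fits]; omega
      · simp only [Expr.cost, Cond.cost, Expr.eval, f₅, hL, hflag]
        exact ⟨by omega, by simp [h20], by simp [h21], by simp, by simp,
          hset _ _ _ _ _ (by omega) (by omega) (hset _ _ _ _ _ (by omega) (by omega) hIs)⟩
    rintro t₁ s₁ ⟨ht₁, h20, h21, h23, h24, hIs⟩
    refine .seq (.assign (by simp only [Expr.Fits]; omega) ?_)
    refine (WP.forLoop (hi := L + 1) (Φ := fun x => x * (τ + 20))
      (I := fun x s => s.reg 22 = x ∧ s.reg 23 = L + 1 ∧ s.reg 20 = i ∧ s.reg 21 = M + 1 ∧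
        s.reg 24 = flag ∧ 0 < x ∧ I i (jj (x - 1) + 1) s)
      (by omega) (fun i s h => ⟨h.1, h.2.1⟩) ?_ (lo := 1) (by omega) ?_).mono ?_
    · rintro x s hx ⟨k₂, k₃, k₀, k₁, k₄, hx₀, k⟩
      obtain ⟨x, rfl⟩ := Nat.exists_eq_succ_of_ne_zero hx₀.ne'
      simp only [Nat.succ_eq_add_one, Nat.add_sub_cancel] at *
      have hxL : x < L := by omega
      -- The invariant is carried over the skipped columns without executing anything.
      have hIj : I i (jj (x + 1)) s := by
        have key : ∀ d, jj x + 1 + d ≤ jj (x + 1) → I i (jj x + 1 + d) s := by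
          intro d
          induction d with
          | zero => intro _; exact k
          | succ d ih =>
            intro hd
            have := hjjN _ (show x + 1 ≤ L from hxL)
            rw [← add_assoc]
            exact hskip i (jj x + 1 + d) s hi₀ (by omega) (by omega) (by omega)
              (hns x hxL _ (by omega) (by omega)) (ih (by omega))
        have hlt := hstep x hxL
        have := key (jj (x + 1) - (jj x + 1)) (by omega)
        rwa [show jj x + 1 + (jj (x + 1) - (jj x + 1)) = jj (x + 1) by omega] at this
      obtain ⟨f₁, f₂, f₃, f₄, f₅⟩ := hI _ _ _ hIj
      have hjN := hjjN (x + 1) hxL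
      have hj₀ := hstep x hxL
      refine .seq (WP.mono (Q := fun t s' => t ≤ 8 ∧ s' = s.setReg 25 (jj (x + 1)))
        (.ite ?_ ?_ ?_) ?_)
      · simp only [Cond.Fits, Expr.Fits, k₄, hflag]
        constructor
        · split <;> omega
        · omega
      · intro h
        have h' : RunEnd a M i := by
          simp only [Cond.Holds, Expr.eval, k₄, hflag] at h
          by_contra hcon
          simp [hcon] at h
        refine .assign ?_ ?_
        · simp only [Expr.Fits, k₂]; omega
        · simp only [Expr.cost, Cond.cost, Expr.eval, k₂, hjj, if_pos h', id]
          exact ⟨by omega, trivial⟩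
      · intro h
        have h' : ¬ RunEnd a M i := by
          simp only [Cond.Holds, Expr.eval, k₄, hflag] at h
          intro hcon
          simp [hcon] at h
        rw [hjj, if_neg h'] at hjN
        refine .assign ?_ ?_
        · simp only [Expr.Fits, Expr.eval, k₂, f₂]; omega
        · simp only [Expr.cost, Cond.cost, Expr.eval, k₂, f₂, hjj, if_neg h']
          exact ⟨by omega, trivial⟩
      · rintro t s' ⟨ht, rfl⟩
        refine (hbody i (jj (x + 1)) _ hi₀ (by omega) (by omega) hjN (hsp x hxL)
          (by simp [k₀]) (by simp) (hset _ _ _ _ _ (by omega) (by omega) hIj)).frame.mono ?_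
        rintro t' s' ⟨⟨ht', hI'⟩, hr, -⟩
        have r : ∀ y, 20 ≤ y → y ≤ 24 → s'.reg y = s.reg y := by
          intro y h₁ h₂
          rw [hr y (hwr y h₁ (by omega)), State.setReg_reg, if_neg (by omega)]
        refine ⟨?_, by rw [r 22 (by omega) (by omega), k₂], ?_, ?_, ?_, ?_, ?_, by omega, ?_⟩
        · rw [add_mul (x + 1) 1]; omega
        · simp
        · rw [State.setReg_reg, if_neg (by omega), r 23 (by omega) (by omega), k₃]
        · rw [State.setReg_reg, if_neg (by omega), r 20 (by omega) (by omega), k₀]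
        · rw [State.setReg_reg, if_neg (by omega), r 21 (by omega) (by omega), k₁]
        · rw [State.setReg_reg, if_neg (by omega), r 24 (by omega) (by omega), k₄]
        · exact hset _ _ _ _ _ (by omega) (by omega) hI'
    · refine ⟨by simp [Expr.eval], by simp [h23], by simp [h20], by simp [h21], by simp [h24],
        by omega, ?_⟩
      rw [Nat.sub_self, hjj₀]
      exact hset _ _ _ _ _ (by omega) (by omega) hIs
    · rintro t₂ s₂ ⟨ht₂, k₂, k₃, k₀, k₁, k₄, -, k⟩
      rw [Nat.add_sub_cancel, hjjL] at k
      refine ⟨?_, k₀, by simp, by simp [k₁], by omega, hset _ _ _ _ _ (by omega) (by omega)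
        (hrow i s₂ hi₀ (by omega) k)⟩
      simp only [Expr.cost]
      have e₁ : (L + 1) * (τ + 20) = L * (τ + 20) + (τ + 20) := by ring
      have e₂ : n * (i + 1) = n * i + n := by ring
      suffices L * (τ + 20) + ((if i ≤ M then Nat.count (NewRun a) i else
          Nat.count (NewRun a) M + 1) * N + n * i) * (τ + 20) ≤
          ((if i + 1 ≤ M then Nat.count (NewRun a) (i + 1) else
          Nat.count (NewRun a) M + 1) * N + n * (i + 1)) * (τ + 20) by omega
      rw [← add_mul]
      refine Nat.mul_le_mul_right _ ?_
      rw [if_pos (by omega), e₂]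
      by_cases hend : RunEnd a M i
      · rw [if_pos hend] at hL
        have : Nat.count (NewRun a) i + 1 ≤ (if i + 1 ≤ M then Nat.count (NewRun a) (i + 1) else
            Nat.count (NewRun a) M + 1) := by
          split_ifs with hiM
          · rw [Nat.count_succ, if_pos]
            rcases hend with h | h
            · omega
            · exact .inr h
          · obtain rfl : i = M := by omega
            exact le_rfl
        have := Nat.mul_le_mul_right N this
        rw [add_mul] at this
        omega
      · rw [if_neg hend] at hL
        have : Nat.count (NewRun a) i ≤ (if i + 1 ≤ M then Nat.count (NewRun a) (i + 1) else
            Nat.count (NewRun a) M + 1) := by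
          split_ifs with hiM
          · exact Nat.count_monotone _ (by omega)
          · exact (Nat.count_monotone _ (by omega : i ≤ M)).trans (by omega)
        have := Nat.mul_le_mul_right N this
        omega
  · refine ⟨by simp [Expr.eval], ?_, by omega, hset _ _ _ _ _ (by omega) (by omega)
      (hset _ _ _ _ _ (by omega) (by omega) hs)⟩
    simp [Expr.eval, if_neg (hlt hlA (le_refl 20)), (hI _ _ _ hs).2.2.1]
  · rintro t s' ⟨ht, -, -, -, h⟩
    refine ⟨?_, h⟩
    rw [if_neg (by omega : ¬ M + 1 ≤ M)] at ht
    simp only [Expr.cost]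
    omega

end WordRAM

/-! ### Filling the tables and maximizing over the special cuts -/

namespace WordRAM

open STRICLCS

/-- The body of `fillTable`. -/
def fillCell (cha chb sta stb T : ℕ) : Program :=
  .seq (.assign 26 (.reg 20)) <| .seq (.assign 27 (.reg 25)) <|
  .seq (lookupCell cha chb sta stb T) <|
  .store T (.add (.mul (.reg 20) (.add (.reg 1) (.const 1))) (.reg 25)) (.reg 28)

/-- Fills the table `T` at all places where a run ends. -/
def fillTable (cha chb sta stb bdb nb T : ℕ) : Program :=
  forSpecial cha 0 1 bdb nb (fillCell cha chb sta stb T)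

/-- The cells consulted for `(i, j)` are weakly above and to the left of it and different from it,
hence lexicographically earlier. Only special cells are written: the table occupies a quadratic
address range but is never traversed. -/
theorem wp_fillTable {w cha chb sta stb bda bdb nb T M N : ℕ} {s : State} (hM₀ : 0 < M)
    (hw : (M + 1) * (N + 1) + 4 * (M + N) + 16 < 2 ^ w) (hM : s.reg 0 = M) (hN : s.reg 1 = N)
    (hnb : nb < 10) (hn : s.reg nb = Nat.count (NewRun (s.arr chb)) N)
    (h₁ : cha ≠ T) (h₂ : chb ≠ T) (h₃ : sta ≠ T) (h₄ : stb ≠ T) (h₅ : bdb ≠ T)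
    (ha : ∀ i, s.arr cha i < 2 ^ w) (hb : ∀ i, s.arr chb i < 2 ^ w)
    (hta : IsRunTable (s.arr cha) M (s.arr sta) (s.arr bda))
    (htb : IsRunTable (s.arr chb) N (s.arr stb) (s.arr bdb)) (hT : ∀ u, s.arr T u = 0) :
    WP w (fillTable cha chb sta stb bdb nb T) s fun t s' =>
      t ≤ ((Nat.count (NewRun (s.arr cha)) M + 1) * N +
        Nat.count (NewRun (s.arr chb)) N * (M + 1)) * 140 + 60 * (M + 1) + 20 ∧
      IsLCSTable (s.arr cha) (s.arr chb) M N (fun i j => s'.arr T (i * (N + 1) + j)) ∧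
      (∀ u, s'.arr T u ≤ M) ∧ (∀ x < 10, s'.reg x = s.reg x) ∧
      ∀ y, y ≠ T → s'.arr y = s.arr y := by
  set a := s.arr cha with ha'
  set b := s.arr chb with hb'
  have hidx : ∀ {i j}, i ≤ M → j ≤ N → i * (N + 1) + j < 2 ^ w := fun hi hj =>
    (index_lt hi hj).trans (by omega)
  refine (wp_forSpecial (τ := 120) (a := a) (b := b)
    (I := fun i j s' => (∀ x < 10, s'.reg x = s.reg x) ∧ (∀ y, y ≠ T → s'.arr y = s.arr y) ∧
      (∀ u, s'.arr T u ≤ M) ∧ ∀ i' ≤ M, ∀ j' ≤ N,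
        (i' = 0 ∨ j' = 0 ∨ Special a b M N i' j' ∧ (i' < i ∨ i' = i ∧ j' < j)) →
        s'.arr T (i' * (N + 1) + j') = lcs a b i' j')
    hM₀ hw (by omega) ha htb ?_ ?_ ?_ ?_ ?_ ?_ ?_).mono ?_
  · rintro i j s' ⟨g₁, g₂, -⟩
    exact ⟨g₂ _ h₁, g₂ _ h₅, (g₁ 0 (by omega)).trans hM, (g₁ 1 (by omega)).trans hN,
      (g₁ nb hnb).trans hn⟩
  · rintro i j s' x v hx - ⟨g₁, g₂⟩
    refine ⟨fun y hy => ?_, g₂⟩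
    rw [State.setReg_reg, if_neg (by omega), g₁ y hy]
  · rintro i j s' hi₀ hi hj₀ hj hns ⟨g₁, g₂, g₃, g₄⟩
    refine ⟨g₁, g₂, g₃, fun i' hi' j' hj' h => g₄ i' hi' j' hj' ?_⟩
    rcases h with h | h | ⟨h, h'⟩
    · exact .inl h
    · exact .inr (.inl h)
    · refine .inr (.inr ⟨h, ?_⟩)
      by_contra hcon
      obtain ⟨rfl, rfl⟩ : i' = i ∧ j' = j := by omega
      exact hns h
  · rintro i s' hi₀ hi ⟨g₁, g₂, g₃, g₄⟩
    refine ⟨g₁, g₂, g₃, fun i' hi' j' hj' h => g₄ i' hi' j' hj' ?_⟩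
    rcases h with h | h | ⟨h, h'⟩
    · exact .inl h
    · exact .inr (.inl h)
    · by_cases hj0 : j' = 0
      · exact .inr (.inl hj0)
      · exact .inr (.inr ⟨h, by omega⟩)
  · intro x hx hx'
    simp [fillCell, lookupCell, Program.WritesReg]
    omega
  · rintro i j s' hi₀ hi hj₀ hj hs h20 h25 ⟨g₁, g₂, g₃, g₄⟩
    have hN' : s'.reg 1 = N := (g₁ 1 (by omega)).trans hN
    refine .seq (.assign ?_ (.seq (.assign ?_ (.seq ?_))))
    · have := index_lt hi hj
      have := hidx hi (Nat.zero_le N)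
      have hle : i ≤ i * (N + 1) := Nat.le_mul_of_pos_right _ (by omega)
      simp only [Expr.Fits, h20]; omega
    · simp only [Expr.Fits, State.setReg_reg, h25]
      rw [if_neg (by omega)]
      omega
    refine (wp_lookupCell (p := i) (q := j) hw ?_ ?_ ?_ hi hj ?_ ?_ ?_ ?_ ?_).mono ?_
    · simp [hN']
    · simp [Expr.eval, h20]
    · simp [Expr.eval, h25]
    · simp only [State.setReg_arr, g₂ _ h₁]; exact ha
    · simp only [State.setReg_arr, g₂ _ h₂]; exact hb
    · simp only [State.setReg_arr, g₂ _ h₁, g₂ _ h₃]; exact hta.st_eq i hi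
    · simp only [State.setReg_arr, g₂ _ h₂, g₂ _ h₄]; exact htb.st_eq j hj
    · simpa only [State.setReg_arr] using g₃
    · simp only [State.setReg_arr, g₂ _ h₁, g₂ _ h₂, State.setReg_reg]
      rintro t s₁ ⟨ht, k₁, k₂, k₃⟩
      rw [lookup_eq] at k₁
      · have hle := lcs_le_left (a := s.arr cha) (b := s.arr chb) i j
        have r20 : s₁.reg 20 = i := by rw [k₂ 20 (by omega) (by omega)]; simp [h20]
        have r25 : s₁.reg 25 = j := by rw [k₂ 25 (by omega) (by omega)]; simp [h25]
        have r1 : s₁.reg 1 = N := by rw [k₂ 1 (by omega) (by omega)]; simp [hN']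
        have h₁ := hidx hi hj
        have h₂ := hidx hi (Nat.zero_le N)
        have hNM : N + 1 ≤ (M + 1) * (N + 1) := Nat.le_mul_of_pos_left _ (by omega)
        refine .store ?_ ?_ ?_
        · simp only [Expr.Fits, Expr.eval, r20, r25, r1]
          exact ⟨⟨by omega, ⟨by omega, by omega, by omega⟩, h₂⟩, by omega, h₁⟩
        · simp only [Expr.Fits, k₁]; omega
        · simp only [Expr.eval, Expr.cost, r20, r25, r1, k₁, State.setArr_reg]
          refine ⟨by omega, fun x hx => ?_, fun y hy => ?_, fun u => ?_, fun i' hi' j' hj' h => ?_⟩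
          · rw [k₂ x (by omega) (by omega), if_neg (by omega), if_neg (by omega), g₁ x hx]
          · rw [State.setArr_arr_ne _ _ _ hy, k₃, g₂ y hy]
          · rw [State.setArr_arr_same, k₃]
            split_ifs
            · omega
            · exact g₃ u
          · rw [State.setArr_arr_same, k₃]
            split_ifs with hidx
            · obtain ⟨rfl, rfl⟩ := index_inj hj' hj hidx
              rfl
            · refine g₄ i' hi' j' hj' ?_
              rcases h with h | h | ⟨h, h'⟩
              · exact .inl h
              · exact .inr (.inl h)
              · refine .inr (.inr ⟨h, ?_⟩)
                by_contra hcon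
                obtain ⟨rfl, rfl⟩ : i' = i ∧ j' = j := by omega
                exact hidx rfl
      · intro i' hi' j' hj' hs h
        refine g₄ i' (by omega) j' (by omega) ?_
        rcases hs with hs | hs
        · rcases hs.runEnd (M := M) with hs | hs
          · exact .inl hs
          · exact .inr (.inr ⟨.inl hs, by omega⟩)
        · rcases hs.runEnd (M := N) with hs | hs
          · exact .inr (.inl hs)
          · exact .inr (.inr ⟨.inr hs, by omega⟩)
  -- The axes need no initialization, since memory starts at `0` and the LCS length with an empty
  -- prefix is `0`.
  · refine ⟨fun _ _ => rfl, fun _ _ => rfl, fun u => by simp [hT], fun i' hi' j' hj' h => ?_⟩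
    rw [hT]
    rcases h with rfl | rfl | ⟨-, h | h⟩
    · simp
    · simp
    · obtain rfl : i' = 0 := by omega
      simp
    · obtain rfl : j' = 0 := by omega
      simp
  · rintro t s' ⟨ht, g₁, g₂, g₃, g₄⟩
    refine ⟨ht, fun i hi j hj h => g₄ i hi j hj ?_, g₃, g₁, g₂⟩
    rcases h with h | h | h
    · exact .inl h
    · exact .inr (.inl h)
    · exact .inr (.inr ⟨h, by omega⟩)

/-- The body of `maximize`. -/
def improve : Program :=
  .ite (.and (.lt (.const 0) (.get 15 (.add (.reg 20) (.const 1)))) <|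
      .and (.lt (.const 0) (.get 16 (.add (.reg 25) (.const 1)))) <|
      .and (.lt (.const 0) (.get 17 (.add (.sub (.reg 0) (.reg 20)) (.const 1))))
        (.lt (.const 0) (.get 18 (.add (.sub (.reg 1) (.reg 25)) (.const 1)))))
    (.seq (.assign 26 (.sub (.get 15 (.add (.reg 20) (.const 1))) (.const 1))) <|
      .seq (.assign 27 (.sub (.get 16 (.add (.reg 25) (.const 1))) (.const 1))) <|
      .seq (lookupCell 0 1 5 6 21) <|
      .seq (.assign 30 (.reg 28)) <|
      .seq (.assign 26 (.sub (.get 17 (.add (.sub (.reg 0) (.reg 20)) (.const 1))) (.const 1))) <|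
      .seq (.assign 27 (.sub (.get 18 (.add (.sub (.reg 1) (.reg 25)) (.const 1))) (.const 1))) <|
      .seq (lookupCell 3 4 7 8 22) <|
      .seq (.assign 28 (.add (.add (.add (.reg 30) (.reg 2)) (.reg 28)) (.const 1))) <|
      .ite (.lt (.reg 8) (.reg 28)) (.assign 8 (.reg 28)) .skip)
    .skip

/-- Sets the register `8` to the maximal cell value where a run ends. -/
def maximize : Program :=
  .seq (.assign 8 (.const 0)) (forSpecial 0 0 1 11 4 improve)

theorem wp_improve {w M N K i j : ℕ} {a b ar br P Q P' Q' : ℕ → ℕ} {s : State}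
    (hw : (M + 1) * (N + 1) + 4 * (M + N + K) + 16 < 2 ^ w)
    (hM : s.reg 0 = M) (hN : s.reg 1 = N) (hK : s.reg 2 = K)
    (h20 : s.reg 20 = i) (h25 : s.reg 25 = j) (hi : i ≤ M) (hj : j ≤ N)
    (h₀ : s.arr 0 = a) (h₁ : s.arr 1 = b) (h₃ : s.arr 3 = ar) (h₄ : s.arr 4 = br)
    (ha : ∀ i, a i < 2 ^ w) (hb : ∀ i, b i < 2 ^ w) (har : ∀ i, ar i < 2 ^ w)
    (hbr : ∀ i, br i < 2 ^ w)
    (h₅ : ∀ i ≤ M, s.arr 5 i = runStart a i) (h₆ : ∀ i ≤ N, s.arr 6 i = runStart b i)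
    (h₇ : ∀ i ≤ M, s.arr 7 i = runStart ar i) (h₈ : ∀ i ≤ N, s.arr 8 i = runStart br i)
    (hP : ∀ q ≤ M + 1, s.arr 15 q = P q) (hQ : ∀ q ≤ N + 1, s.arr 16 q = Q q)
    (hP' : ∀ q ≤ M + 1, s.arr 17 q = P' q) (hQ' : ∀ q ≤ N + 1, s.arr 18 q = Q' q)
    (hPl : ∀ q, P q ≤ q) (hQl : ∀ q, Q q ≤ q) (hPl' : ∀ q, P' q ≤ q) (hQl' : ∀ q, Q' q ≤ q)
    (hT : IsLCSTable a b M N fun i j => s.arr 21 (i * (N + 1) + j)) (hTM : ∀ u, s.arr 21 u ≤ M)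
    (hT' : IsLCSTable ar br M N fun i j => s.arr 22 (i * (N + 1) + j))
    (hTM' : ∀ u, s.arr 22 u ≤ M) (h8 : s.reg 8 < 2 ^ w) :
    WP w improve s fun t s' => t ≤ 340 ∧ s'.arr = s.arr ∧
      (∀ x < 10, x ≠ 8 → s'.reg x = s.reg x) ∧
      s'.reg 8 = max (s.reg 8) (cellValue (lcs a b) (lcs ar br) P Q P' Q' M N K i j) := by
  subst h₀ h₁ h₃ h₄
  have hNM : N + 1 ≤ (M + 1) * (N + 1) := Nat.le_mul_of_pos_left _ (by omega)
  have hMM : M + 1 ≤ (M + 1) * (N + 1) := Nat.le_mul_of_pos_right _ (by omega)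
  have hPi := hP (i + 1) (by omega)
  have hQi := hQ (j + 1) (by omega)
  have hPi' := hP' (M - i + 1) (by omega)
  have hQi' := hQ' (N - j + 1) (by omega)
  have l₁ := hPl (i + 1)
  have l₂ := hQl (j + 1)
  have l₃ := hPl' (M - i + 1)
  have l₄ := hQl' (N - j + 1)
  have hwl : (M + 1) * (N + 1) + 4 * (M + N) + 16 < 2 ^ w := by omega
  have hcond : (Cond.Holds s (.and (.lt (.const 0) (.get 15 (.add (.reg 20) (.const 1)))) <|
      .and (.lt (.const 0) (.get 16 (.add (.reg 25) (.const 1)))) <|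
      .and (.lt (.const 0) (.get 17 (.add (.sub (.reg 0) (.reg 20)) (.const 1))))
        (.lt (.const 0) (.get 18 (.add (.sub (.reg 1) (.reg 25)) (.const 1)))))) ↔
      0 < P (i + 1) ∧ 0 < Q (j + 1) ∧ 0 < P' (M - i + 1) ∧ 0 < Q' (N - j + 1) := by
    simp only [Cond.Holds, Expr.eval, h20, h25, hM, hN, hPi, hQi, hPi', hQi']
  refine (WP.frame (Q := fun t s' => t ≤ 340 ∧ s'.reg 8 = max (s.reg 8)
    (cellValue (lcs (s.arr 0) (s.arr 1)) (lcs (s.arr 3) (s.arr 4)) P Q P' Q' M N K i j))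
      ?_).mono ?_
  · refine .ite ?_ ?_ ?_
    · simp only [Cond.Fits, Expr.Fits, Expr.eval, h20, h25, hM, hN, hPi, hQi, hPi', hQi']
      refine ⟨⟨?_, ⟨?_, ?_, ?_⟩, ?_⟩, ⟨?_, ⟨?_, ?_, ?_⟩, ?_⟩, ⟨?_, ⟨⟨?_, ?_⟩, ?_, ?_⟩, ?_⟩,
        ?_, ⟨⟨?_, ?_⟩, ?_, ?_⟩, ?_⟩ <;> omega
    · intro h
      rw [hcond] at h
      simp only [cellValue, if_pos h]
      refine .seq (.assign ?_ (.seq (.assign ?_ (.seq ?_))))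
      · simp only [Expr.Fits, Expr.eval, h20, hPi]
        refine ⟨⟨⟨?_, ?_, ?_⟩, ?_⟩, ?_⟩ <;> omega
      · simp only [Expr.Fits, Expr.eval, State.setReg_reg, State.setReg_arr,
          show (25 : ℕ) ≠ 26 by decide, if_false, h25, hQi]
        refine ⟨⟨⟨?_, ?_, ?_⟩, ?_⟩, ?_⟩ <;> omega
      refine (wp_lookupCell (M := M) (N := N) (p := P (i + 1) - 1) (q := Q (j + 1) - 1) hwl (by simp [hN])
        (by simp [Expr.eval, h20, hPi]) (by simp [Expr.eval, h25, hQi]) (by omega) (by omega)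
        (by simpa using ha) (by simpa using hb) (by simpa using h₅ _ (by omega))
        (by simpa using h₆ _ (by omega)) (by simpa using hTM)).mono ?_
      simp only [State.setReg_arr, State.setReg_reg]
      rintro t₁ s₁ ⟨ht₁, k₁, k₂, k₃⟩
      rw [hT.lookup_eq (by omega) (by omega)] at k₁
      have hle := lcs_le_left (a := s.arr 0) (b := s.arr 1) (P (i + 1) - 1) (Q (j + 1) - 1)
      replace k₂ : ∀ x < 26, s₁.reg x = s.reg x := fun x hx => by
        rw [k₂ x (by omega) (by omega), if_neg (by omega), if_neg (by omega)]
      have r0 := (k₂ 0 (by omega)).trans hM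
      have r1 := (k₂ 1 (by omega)).trans hN
      have r20 := (k₂ 20 (by omega)).trans h20
      have r25 := (k₂ 25 (by omega)).trans h25
      refine .seq (.assign ?_ (.seq (.assign ?_ (.seq (.assign ?_ (.seq ?_))))))
      · simp only [Expr.Fits, k₁]; omega
      · simp only [Expr.Fits, Expr.eval, State.setReg_reg, State.setReg_arr,
          show (0 : ℕ) ≠ 30 by decide, show (20 : ℕ) ≠ 30 by decide, if_false, r0, r20, k₃, hPi']
        refine ⟨⟨⟨⟨?_, ?_⟩, ?_, ?_⟩, ?_⟩, ?_⟩ <;> omega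
      · simp only [Expr.Fits, Expr.eval, State.setReg_reg, State.setReg_arr,
          show (1 : ℕ) ≠ 30 by decide, show (25 : ℕ) ≠ 30 by decide, show (1 : ℕ) ≠ 26 by decide,
          show (25 : ℕ) ≠ 26 by decide, if_false, r1, r25, k₃, hQi']
        refine ⟨⟨⟨⟨?_, ?_⟩, ?_, ?_⟩, ?_⟩, ?_⟩ <;> omega
      refine (wp_lookupCell (M := M) (N := N) (p := P' (M - i + 1) - 1) (q := Q' (N - j + 1) - 1) hwl
        (by simp [r1]) (by simp [Expr.eval, r0, r20, k₃, hPi'])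
        (by simp [Expr.eval, r1, r25, k₃, hQi']) (by omega) (by omega)
        (by simpa [k₃] using har) (by simpa [k₃] using hbr) (by simpa [k₃] using h₇ _ (by omega))
        (by simpa [k₃] using h₈ _ (by omega)) (by simpa [k₃] using hTM')).mono ?_
      simp only [State.setReg_arr, State.setReg_reg, k₃]
      rintro t₂ s₂ ⟨ht₂, m₁, m₂, m₃⟩
      rw [hT'.lookup_eq (by omega) (by omega)] at m₁
      have hle' := lcs_le_left (a := s.arr 3) (b := s.arr 4) (P' (M - i + 1) - 1)
        (Q' (N - j + 1) - 1)
      have r30 : s₂.reg 30 = lcs (s.arr 0) (s.arr 1) (P (i + 1) - 1) (Q (j + 1) - 1) := by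
        rw [m₂ 30 (by omega) (by omega)]
        simp [Expr.eval, k₁]
      replace m₂ : ∀ x < 26, s₂.reg x = s.reg x := fun x hx => by
        rw [m₂ x (by omega) (by omega), if_neg (by omega), if_neg (by omega), if_neg (by omega),
          k₂ x hx]
      have r2 := (m₂ 2 (by omega)).trans hK
      have r8 := m₂ 8 (by omega)
      refine .seq (.assign ?_ (.ite ?_ ?_ ?_))
      · simp only [Expr.Fits, Expr.eval, r30, r2, m₁]
        refine ⟨⟨⟨?_, ?_, ?_⟩, ?_, ?_⟩, ?_, ?_⟩ <;> omega
      · simp only [Cond.Fits, Expr.Fits, Expr.eval, State.setReg_reg, if_true,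
          show (8 : ℕ) ≠ 28 by decide, if_false, r30, r2, m₁, r8]
        omega
      · intro hlt
        simp only [Cond.Holds, Expr.eval, State.setReg_reg, if_true,
          show (8 : ℕ) ≠ 28 by decide, if_false, r30, r2, m₁, r8] at hlt
        refine .assign ?_ ?_
        · simp only [Expr.Fits, Expr.eval, State.setReg_reg, if_true, r30, r2, m₁]
          omega
        · simp only [Expr.eval, Expr.cost, Cond.cost, State.setReg_reg, if_true, r30, r2, m₁]
          omega
      · intro hlt
        simp only [Cond.Holds, Expr.eval, State.setReg_reg, if_true,
          show (8 : ℕ) ≠ 28 by decide, if_false, r30, r2, m₁, r8] at hlt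
        refine .skip ?_
        simp only [Expr.cost, Cond.cost, State.setReg_reg, show (8 : ℕ) ≠ 28 by decide,
          if_false, r8]
        omega
    · intro h
      rw [hcond] at h
      refine .skip ?_
      simp only [cellValue, if_neg h, Expr.cost, Cond.cost]
      omega
  · rintro t s' ⟨⟨ht, g₁⟩, hr, ha⟩
    refine ⟨ht, funext fun y => ha y ?_, fun x hx hx' => hr x ?_, g₁⟩
    · simp [improve, lookupCell, Program.WritesArr]
    · simp [improve, lookupCell, Program.WritesReg]; omega

/-- Needed to see that the current maximum always fits into a word. -/
theorem cellValue_le {a b ar br P Q P' Q' : ℕ → ℕ} {M N K i j : ℕ} (hi : i ≤ M)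
    (hPl : ∀ q, P q ≤ q) (hPl' : ∀ q, P' q ≤ q) :
    cellValue (lcs a b) (lcs ar br) P Q P' Q' M N K i j ≤ 2 * M + K + 1 := by
  have h₁ := hPl (i + 1)
  have h₂ := hPl' (M - i + 1)
  have h₃ := lcs_le_left (a := a) (b := b) (P (i + 1) - 1) (Q (j + 1) - 1)
  have h₄ := lcs_le_left (a := ar) (b := br) (P' (M - i + 1) - 1) (Q' (N - j + 1) - 1)
  rw [cellValue]
  split <;> omega

/-- The result is given by two one-sided facts: unless it is `0`, it is the value of some cut, which
by soundness need not be special, and it dominates the values of all special cuts. -/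
theorem wp_maximize {w M N K : ℕ} {a b ar br P Q P' Q' : ℕ → ℕ} {s : State} (hM₀ : 0 < M)
    (hw : (M + 1) * (N + 1) + 4 * (M + N + K) + 16 < 2 ^ w)
    (hM : s.reg 0 = M) (hN : s.reg 1 = N) (hK : s.reg 2 = K)
    (hn : s.reg 4 = Nat.count (NewRun b) N)
    (h₀ : s.arr 0 = a) (h₁ : s.arr 1 = b) (h₃ : s.arr 3 = ar) (h₄ : s.arr 4 = br)
    (ha : ∀ i, a i < 2 ^ w) (hb : ∀ i, b i < 2 ^ w) (har : ∀ i, ar i < 2 ^ w)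
    (hbr : ∀ i, br i < 2 ^ w)
    (h₅ : ∀ i ≤ M, s.arr 5 i = runStart a i) (h₆ : IsRunTable b N (s.arr 6) (s.arr 11))
    (h₇ : ∀ i ≤ M, s.arr 7 i = runStart ar i) (h₈ : ∀ i ≤ N, s.arr 8 i = runStart br i)
    (hP : ∀ q ≤ M + 1, s.arr 15 q = P q) (hQ : ∀ q ≤ N + 1, s.arr 16 q = Q q)
    (hP' : ∀ q ≤ M + 1, s.arr 17 q = P' q) (hQ' : ∀ q ≤ N + 1, s.arr 18 q = Q' q)
    (hPl : ∀ q, P q ≤ q) (hQl : ∀ q, Q q ≤ q) (hPl' : ∀ q, P' q ≤ q) (hQl' : ∀ q, Q' q ≤ q)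
    (hT : IsLCSTable a b M N fun i j => s.arr 21 (i * (N + 1) + j)) (hTM : ∀ u, s.arr 21 u ≤ M)
    (hT' : IsLCSTable ar br M N fun i j => s.arr 22 (i * (N + 1) + j))
    (hTM' : ∀ u, s.arr 22 u ≤ M) :
    WP w maximize s fun t s' =>
      t ≤ ((Nat.count (NewRun a) M + 1) * N + Nat.count (NewRun b) N * (M + 1)) * 360 +
        60 * (M + 1) + 30 ∧
      (s'.reg 8 = 0 ∨ ∃ i ≤ M, ∃ j ≤ N,
        cellValue (lcs a b) (lcs ar br) P Q P' Q' M N K i j = s'.reg 8) ∧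
      ∀ i j, 0 < i → i ≤ M → 0 < j → j ≤ N → Special a b M N i j →
        cellValue (lcs a b) (lcs ar br) P Q P' Q' M N K i j ≤ s'.reg 8 := by
  refine .seq (.assign (by simp only [Expr.Fits]; omega) ?_)
  refine (wp_forSpecial (τ := 340) (a := a) (b := b)
    (I := fun i j s' => (∀ x < 10, x ≠ 8 → s'.reg x = s.reg x) ∧ s'.arr = s.arr ∧
      (s'.reg 8 = 0 ∨ ∃ i ≤ M, ∃ j ≤ N,
        cellValue (lcs a b) (lcs ar br) P Q P' Q' M N K i j = s'.reg 8) ∧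
      ∀ i' j', 0 < i' → i' ≤ M → 0 < j' → j' ≤ N → Special a b M N i' j' →
        (i' < i ∨ i' = i ∧ j' < j) →
        cellValue (lcs a b) (lcs ar br) P Q P' Q' M N K i' j' ≤ s'.reg 8)
    hM₀ (by omega) (by omega) ha h₆ ?_ ?_ ?_ ?_ ?_ ?_ ?_).mono ?_
  · rintro i j s' ⟨g₁, g₂, -⟩
    exact ⟨by rw [g₂, h₀], by rw [g₂], (g₁ 0 (by omega) (by omega)).trans hM,
      (g₁ 1 (by omega) (by omega)).trans hN, (g₁ 4 (by omega) (by omega)).trans hn⟩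
  · rintro i j s' x v hx - ⟨g₁, g₂⟩
    refine ⟨fun y hy hy' => ?_, ?_⟩
    · rw [State.setReg_reg, if_neg (by omega), g₁ y hy hy']
    · rwa [State.setReg_reg, if_neg (by omega)]
  · rintro i j s' hi₀ hi hj₀ hj hns ⟨g₁, g₂, g₃, g₄⟩
    refine ⟨g₁, g₂, g₃, fun i' j' hi₀' hi' hj₀' hj' h h' => g₄ i' j' hi₀' hi' hj₀' hj' h ?_⟩
    by_contra hcon
    obtain ⟨rfl, rfl⟩ : i' = i ∧ j' = j := by omega
    exact hns h
  · rintro i s' hi₀ hi ⟨g₁, g₂, g₃, g₄⟩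
    exact ⟨g₁, g₂, g₃, fun i' j' hi₀' hi' hj₀' hj' h h' =>
      g₄ i' j' hi₀' hi' hj₀' hj' h (by omega)⟩
  · intro x hx hx'
    simp [improve, lookupCell, Program.WritesReg]
    omega
  · rintro i j s' hi₀ hi hj₀ hj hs h20 h25 ⟨g₁, g₂, g₃, g₄⟩
    have h8 : s'.reg 8 < 2 ^ w := by
      rcases g₃ with h | ⟨i', hi', j', -, h⟩
      · omega
      · rw [← h]
        exact (cellValue_le hi' hPl hPl').trans_lt (by omega)
    refine (wp_improve (a := a) (b := b) (ar := ar) (br := br) (i := i) (j := j) hw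
      ((g₁ 0 (by omega) (by omega)).trans hM)
      ((g₁ 1 (by omega) (by omega)).trans hN) ((g₁ 2 (by omega) (by omega)).trans hK) h20 h25 hi hj
      (by rw [g₂, h₀]) (by rw [g₂, h₁]) (by rw [g₂, h₃]) (by rw [g₂, h₄]) ha hb har hbr
      (by rwa [g₂]) (by rw [g₂]; exact h₆.st_eq) (by rwa [g₂]) (by rwa [g₂]) (by rwa [g₂])
      (by rwa [g₂]) (by rwa [g₂]) (by rwa [g₂]) hPl hQl hPl' hQl' (by rwa [g₂]) (by rwa [g₂])
      (by rwa [g₂]) (by rwa [g₂]) h8).mono ?_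
    rintro t s₁ ⟨ht, k₁, k₂, k₃⟩
    refine ⟨ht, fun x hx hx' => (k₂ x hx hx').trans (g₁ x hx hx'), k₁.trans g₂, ?_,
      fun i' j' hi₀' hi' hj₀' hj' h h' => ?_⟩
    · rcases max_choice (s'.reg 8) (cellValue (lcs a b) (lcs ar br) P Q P' Q' M N K i j) with h | h
      · rwa [k₃, h]
      · exact .inr ⟨i, hi, j, hj, by rw [k₃, h]⟩
    · rw [k₃]
      by_cases hij : i' = i ∧ j' = j
      · obtain ⟨rfl, rfl⟩ := hij
        exact le_max_right _ _
      · exact (g₄ i' j' hi₀' hi' hj₀' hj' h (by omega)).trans (le_max_left _ _)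
  · refine ⟨fun x hx hx' => by simp [hx'], rfl, .inl (by simp [Expr.eval]), ?_⟩
    intro i' j' _ _ _ _ _ h
    omega
  · rintro t s' ⟨ht, g₁, g₂, g₃, g₄⟩
    simp only [Expr.cost]
    exact ⟨by omega, g₃, fun i j h₁ h₂ h₃ h₄ h₅ => g₄ i j h₁ h₂ h₃ h₄ h₅ (by omega)⟩

end WordRAM

/-! ### Decomposing `C` into its first run and the rest -/

namespace STRICLCS

theorem pre_add {c : ℕ → ℕ} {i k v : ℕ} (h : ∀ u < k, c (i + u) = v) :
    pre c (i + k) = pre c i ++ List.replicate k v := by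
  induction k with
  | zero => simp
  | succ k ih =>
    rw [← add_assoc, pre_succ, ih fun u hu => h u (by omega), h k (by omega), List.append_assoc,
      List.replicate_succ']

@[simp] theorem length_pre (c : ℕ → ℕ) (i : ℕ) : (pre c i).length = i := by simp [pre]

variable {c st bd : ℕ → ℕ} {K : ℕ}

theorem IsRunTable.eq_of_le (h : IsRunTable c K st bd) {x : ℕ}
    (hx : x < Nat.count (NewRun c) K) {u : ℕ} (h₁ : bd x ≤ u) (h₂ : u < bd (x + 1)) :
    c u = c (bd x) := by
  obtain ⟨hs, hlt⟩ := h.step x hx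
  rw [eq_of_runStart_le (hs.trans_le h₁) h₂, eq_of_runStart_le hs.le hlt]

theorem IsRunTable.le (h : IsRunTable c K st bd) {x : ℕ} (hx : x ≤ Nat.count (NewRun c) K) :
    bd x ≤ K := by
  rcases Nat.lt_or_eq_of_le hx with hx | rfl
  · exact (h.lt x hx).1.le
  · exact h.last.le

theorem IsRunTable.pre_succ (h : IsRunTable c K st bd) {x : ℕ}
    (hx : x < Nat.count (NewRun c) K) :
    pre c (bd (x + 1)) = pre c (bd x) ++ List.replicate (bd (x + 1) - bd x) (c (bd x)) := by
  have hlt := (h.step x hx).2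
  rw [← pre_add (i := bd x) (k := bd (x + 1) - bd x) fun u hu =>
    h.eq_of_le hx (by omega) (by omega), Nat.add_sub_cancel' hlt.le]

/-- The first run of the string `c`, listed by `bd`. -/
def firstRun (c bd : ℕ → ℕ) (x : ℕ) : List ℕ := pre c (bd (min x 1))

/-- The runs of the string `c` from the second to the `x`-th one. -/
def otherRuns (c bd : ℕ → ℕ) (x : ℕ) : List ℕ := (pre c (bd x)).drop (bd (min x 1))

theorem IsRunTable.firstRun_one (h : IsRunTable c K st bd) (h₀ : 0 < Nat.count (NewRun c) K) :
    firstRun c bd 1 = List.replicate (bd 1) (c 0) := by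
  rw [firstRun, min_self, h.pre_succ h₀, h.zero]
  simp

theorem IsRunTable.otherRuns_succ (h : IsRunTable c K st bd) {x : ℕ} (hx₀ : 0 < x)
    (hx : x < Nat.count (NewRun c) K) :
    otherRuns c bd (x + 1) =
      otherRuns c bd x ++ List.replicate (bd (x + 1) - bd x) (c (bd x)) := by
  have hle : bd 1 ≤ bd x := by
    have : ∀ y, y ≤ Nat.count (NewRun c) K → 1 ≤ y → bd 1 ≤ bd y := by
      intro y hy hy₁
      induction y, hy₁ using Nat.le_induction with
      | base => exact le_rfl
      | succ y hy₁ ih => exact (ih (by omega)).trans (h.step y (by omega)).2.le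
    exact this x hx.le hx₀
  rw [otherRuns, otherRuns, min_eq_right (by omega), min_eq_right (by omega), h.pre_succ hx,
    List.drop_append_of_le_length (by simpa using hle)]

/-- Provides the decomposition that the exchange argument requires: by maximality of the first run,
the rest cannot begin with the same character. -/
theorem IsRunTable.exists_firstRun (h : IsRunTable c K st bd) :
    ∃ k v, firstRun c bd (Nat.count (NewRun c) K) = List.replicate k v ∧
      pre c K = List.replicate k v ++ otherRuns c bd (Nat.count (NewRun c) K) ∧
      (otherRuns c bd (Nat.count (NewRun c) K)).head? ≠ some v ∧
      (k = 0 → otherRuns c bd (Nat.count (NewRun c) K) = []) := by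
  rcases Nat.eq_zero_or_pos (Nat.count (NewRun c) K) with h₀ | h₀
  · have hK : K = 0 := by rw [← h.last, h₀, h.zero]
    refine ⟨0, 0, ?_⟩
    rw [h₀, firstRun, otherRuns, Nat.zero_min, h.zero, hK]
    simp
  · have hr : firstRun c bd (Nat.count (NewRun c) K) = firstRun c bd 1 := by
      rw [firstRun, firstRun, min_eq_right (by omega), min_self]
    have ho : otherRuns c bd (Nat.count (NewRun c) K) = (pre c K).drop (bd 1) := by
      rw [otherRuns, min_eq_right (by omega), h.last]
    have hlt : bd 0 < bd 1 := (h.step 0 h₀).2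
    have hle : bd 1 ≤ K := h.le h₀
    refine ⟨bd 1, c 0, by rw [hr, h.firstRun_one h₀], ?_, ?_, fun hk => by omega⟩
    · rw [ho, ← h.firstRun_one h₀, firstRun, min_self]
      conv_lhs => rw [← List.take_append_drop (bd 1) (pre c K)]
      congr 1
      simp [pre, ← List.map_take, List.take_range, hle]
    · rw [ho]
      rcases Nat.lt_or_ge 1 (Nat.count (NewRun c) K) with h₁ | h₁
      · have hnew := (h.lt 1 h₁).2
        have hlt' := (h.lt 1 h₁).1
        -- The character just before the second run belongs to the first run.
        have e : c (bd 1 - 1) = c 0 := by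
          rw [h.eq_of_le h₀ (u := bd 1 - 1) (by rw [h.zero]; omega) (by simp; omega), h.zero]
        rcases hnew with hnew | hnew
        · omega
        · rw [e] at hnew
          simpa [List.head?_drop, pre, hlt'] using hnew
      · have : bd 1 = K := by rw [← h.last]; congr 1; omega
        rw [this, List.drop_eq_nil_of_le (by simp)]
        simp

end STRICLCS

/-! ### Greedy embeddings of all runs of `C` -/

namespace WordRAM

open STRICLCS

/-- Computes the latest embeddings of the first run of `C` into the prefixes of `A` and `B`, and
of the remaining runs into the prefixes of the reversed strings. -/
def matchAll : Program :=
  .seq (initPositions 15 0) <| .seq (initPositions 16 1) <| .seq (initPositions 17 0) <|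
  .seq (initPositions 18 1) <| .seq (.assign 16 (.const 0)) <|
  forLoop 16 7 <|
    .seq (.assign 12 (.get 2 (.get 14 (.reg 16)))) <|
    .seq (.assign 13 (.sub (.get 14 (.add (.reg 16) (.const 1))) (.get 14 (.reg 16)))) <|
    .ite (.eq (.reg 16) (.const 0)) (.seq (matchRun 0 15 0) (matchRun 1 16 1))
      (.seq (matchRun 3 17 0) (matchRun 4 18 1))

theorem wp_matchRun_pair {w cha chb F G M N v k x : ℕ} {V : List ℕ} {a b : ℕ → ℕ} {s : State}
    (hF : 14 < F ∧ F < 19) (hG : 14 < G ∧ G < 19) (hFG : F ≠ G) (hcha : cha < 15)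
    (hchb : chb < 15) (hM : s.reg 0 = M) (hN : s.reg 1 = N) (hx : s.reg 16 = x)
    (hwM : M + 16 < 2 ^ w) (hwN : N + 16 < 2 ^ w)
    (ha₀ : s.arr cha = a) (hb₀ : s.arr chb = b) (ha : ∀ i, a i < 2 ^ w) (hb : ∀ i, b i < 2 ^ w)
    (h12 : s.reg 12 = v) (h13 : s.reg 13 = k) (hv : v < 2 ^ w) (hk : k < 2 ^ w) (hk₀ : 0 < k)
    (hFV : ∀ q ≤ M + 1, s.arr F q = latest a V q) (hGV : ∀ q ≤ N + 1, s.arr G q = latest b V q) :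
    WP w (.seq (matchRun cha F 0) (matchRun chb G 1)) s fun t s' =>
      t ≤ 60 * M + 60 * N + 400 ∧
      (∀ q ≤ M + 1, s'.arr F q = latest a (V ++ List.replicate k v) q) ∧
      (∀ q ≤ N + 1, s'.arr G q = latest b (V ++ List.replicate k v) q) ∧
      (∀ y < 10, s'.reg y = s.reg y) ∧ s'.reg 16 = x ∧
      ∀ y, y ≠ F → y ≠ G → y ≠ 19 → y ≠ 20 → s'.arr y = s.arr y := by
  refine .seq ((wp_matchRun (M := M) (by omega) (by omega) (by omega) (by omega) (by omega)
    (by omega) hM hwM (by rwa [ha₀]) ?_ h12 h13 hv hk hk₀).mono ?_)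
  · intro q hq
    rw [hFV q hq]
    exact latest_le _ _ _
  rintro t₁ s₁ ⟨ht₁, g₁, g₂, g₃⟩
  have eb : s₁.arr chb = b := by rw [g₃ _ (by omega) (by omega) (by omega), hb₀]
  have eG : s₁.arr G = s.arr G := g₃ _ hFG.symm (by omega) (by omega)
  refine (wp_matchRun (M := N) (c := v) (k := k) (by omega) (by omega) (by omega) (by omega)
    (by omega) (by omega) ?_ hwN (by rwa [eb]) ?_ ?_ ?_ hv hk hk₀).mono ?_
  · rw [g₂ 1 (by omega) (by omega) (by omega), hN]
  · intro q hq
    rw [eG, hGV q hq]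
    exact latest_le _ _ _
  · rw [g₂ 12 (by omega) (by omega) (by omega), h12]
  · rw [g₂ 13 (by omega) (by omega) (by omega), h13]
  · rintro t₂ s₂ ⟨ht₂, k₁, k₂, k₃⟩
    refine ⟨by omega, fun q hq => ?_, fun q hq => ?_, fun y hy => ?_, ?_,
      fun y h₁ h₂ h₃ h₄ => ?_⟩
    · rw [k₃ _ hFG (by omega) (by omega), g₁ q hq, hFV q hq, latest_append, latest_replicate, ha₀]
    · rw [k₁ q hq, eG, hGV q hq, latest_append, latest_replicate, eb]
    · rw [k₂ y (by omega) (by omega) (by omega), g₂ y (by omega) (by omega) (by omega)]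
    · rw [k₂ 16 (by omega) (by omega) (by omega), g₂ 16 (by omega) (by omega) (by omega), hx]
    · rw [k₃ y h₂ h₃ h₄, g₃ y h₁ h₃ h₄]

/-- By `latest_append`, matching one more run composes the current maps with the map for that run.
The first run acts on the original strings, all later ones on the reversed strings. -/
theorem wp_matchAll {w M N K : ℕ} {a b c ar br st bd : ℕ → ℕ} {s : State}
    (hw : 4 * (M + N + K) + 16 < 2 ^ w) (hM : s.reg 0 = M) (hN : s.reg 1 = N)
    (hr : s.reg 7 = Nat.count (NewRun c) K)
    (h₀ : s.arr 0 = a) (h₁ : s.arr 1 = b) (h₂ : s.arr 2 = c) (h₃ : s.arr 3 = ar)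
    (h₄ : s.arr 4 = br) (h₁₄ : s.arr 14 = bd)
    (ha : ∀ i, a i < 2 ^ w) (hb : ∀ i, b i < 2 ^ w) (hc : ∀ i, c i < 2 ^ w)
    (har : ∀ i, ar i < 2 ^ w) (hbr : ∀ i, br i < 2 ^ w) (ht : IsRunTable c K st bd) :
    WP w matchAll s fun t s' =>
      t ≤ Nat.count (NewRun c) K * (60 * M + 60 * N + 450) + 40 * (M + N) + 250 ∧
      (∀ q ≤ M + 1, s'.arr 15 q = latest a (firstRun c bd (Nat.count (NewRun c) K)) q) ∧
      (∀ q ≤ N + 1, s'.arr 16 q = latest b (firstRun c bd (Nat.count (NewRun c) K)) q) ∧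
      (∀ q ≤ M + 1, s'.arr 17 q = latest ar (otherRuns c bd (Nat.count (NewRun c) K)) q) ∧
      (∀ q ≤ N + 1, s'.arr 18 q = latest br (otherRuns c bd (Nat.count (NewRun c) K)) q) ∧
      (∀ y < 10, s'.reg y = s.reg y) ∧ ∀ y, (y < 15 ∨ 20 < y) → s'.arr y = s.arr y := by
  have hrK : Nat.count (NewRun c) K ≤ K := Nat.count_le _
  obtain ⟨T, hT⟩ : ∃ T, 60 * M + 60 * N + 450 = T := ⟨_, rfl⟩
  rw [hT]
  refine .seq ((wp_initPositions (by omega) hM (by omega)).mono ?_)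
  rintro t₁ s₁ ⟨ht₁, p₁, r₁, f₁⟩
  refine .seq ((wp_initPositions (M := N) (by omega) (by rw [r₁ 1 (by omega), hN])
    (by omega)).mono ?_)
  rintro t₂ s₂ ⟨ht₂, p₂, r₂, f₂⟩
  refine .seq ((wp_initPositions (M := M) (by omega) (by rw [r₂ 0 (by omega), r₁ 0 (by omega), hM])
    (by omega)).mono ?_)
  rintro t₃ s₃ ⟨ht₃, p₃, r₃, f₃⟩
  refine .seq ((wp_initPositions (M := N) (by omega)
    (by rw [r₃ 1 (by omega), r₂ 1 (by omega), r₁ 1 (by omega), hN]) (by omega)).mono ?_)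
  rintro t₄ s₄ ⟨ht₄, p₄, r₄, f₄⟩
  refine .seq (.assign (by simp only [Expr.Fits]; omega) ?_)
  refine (WP.forLoop (hi := Nat.count (NewRun c) K)
    (Φ := fun x => x * T)
    (I := fun x s' => s'.reg 16 = x ∧ (∀ y < 10, s'.reg y = s.reg y) ∧
      (∀ y, (y < 15 ∨ 20 < y) → s'.arr y = s.arr y) ∧
      (∀ q ≤ M + 1, s'.arr 15 q = latest a (firstRun c bd x) q) ∧
      (∀ q ≤ N + 1, s'.arr 16 q = latest b (firstRun c bd x) q) ∧
      (∀ q ≤ M + 1, s'.arr 17 q = latest ar (otherRuns c bd x) q) ∧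
      ∀ q ≤ N + 1, s'.arr 18 q = latest br (otherRuns c bd x) q)
    (by omega) (fun x s h => ⟨h.1, (h.2.1 7 (by omega)).trans hr⟩) ?_ (lo := 0)
    (by omega) ?_).mono ?_
  · rintro x s' hx ⟨g₁, g₂, g₃, g₄, g₅, g₆, g₇⟩
    have e₂ : s'.arr 2 = c := by rw [g₃ 2 (by omega), h₂]
    have e₁₄ : s'.arr 14 = bd := by rw [g₃ 14 (by omega), h₁₄]
    have l₁ := ht.le hx.le
    have l₂ := ht.le (show x + 1 ≤ _ from hx)
    have l₃ := (ht.step x hx).2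
    have hinit : ∀ q, latest ar [] q = q ∧ latest br [] q = q := fun q => ⟨rfl, rfl⟩
    refine .seq (.assign ?_ (.seq (.assign ?_ (.ite ?_ ?_ ?_))))
    · simp only [Expr.Fits, Expr.eval, g₁, e₁₄, e₂]
      exact ⟨⟨by omega, by omega⟩, hc _⟩
    · simp only [Expr.Fits, Expr.eval, State.setReg_reg, State.setReg_arr,
        show (16 : ℕ) ≠ 12 by decide, if_false, g₁, e₁₄]
      omega
    · simp only [Cond.Fits, Expr.Fits, State.setReg_reg, show (16 : ℕ) ≠ 12 by decide,
        show (16 : ℕ) ≠ 13 by decide, if_false, g₁]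
      omega
    · intro hx₀
      simp only [Cond.Holds, Expr.eval, State.setReg_reg, show (16 : ℕ) ≠ 12 by decide,
        show (16 : ℕ) ≠ 13 by decide, if_false, g₁] at hx₀
      subst hx₀
      rw [zero_add] at l₂ l₃
      refine (wp_matchRun_pair (M := M) (N := N) (a := a) (b := b) (v := c (bd 0))
        (k := bd 1 - bd 0) (x := 0) (V := []) (by omega) (by omega) (by omega) (by omega) (by omega)
        (by simp [g₂, hM]) (by simp [g₂, hN]) (by simp [g₁]) (by omega) (by omega)
        (by simp [g₃, h₀]) (by simp [g₃, h₁]) ha hb (by simp [Expr.eval, g₁, e₂, e₁₄])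
        (by simp [Expr.eval, g₁, e₁₄]) (hc _) (by omega) (by omega)
        (by simpa [firstRun, ht.zero] using g₄) (by simpa [firstRun, ht.zero] using g₅)).mono ?_
      rintro t s'' ⟨hts, k₁, k₂, k₃, k₄, k₅⟩
      have hV : firstRun c bd 1 = [] ++ List.replicate (bd 1 - bd 0) (c (bd 0)) := by
        rw [ht.firstRun_one hx, ht.zero]; rfl
      have hW : otherRuns c bd 1 = otherRuns c bd 0 := by
        rw [otherRuns, otherRuns, ht.zero]
        simp
      simp only [zero_add, zero_mul, one_mul, hV, hW, State.setReg_arr]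
      refine ⟨?_, k₄, by simp, fun y hy => ?_, fun y hy => ?_, k₁, k₂, fun q hq => ?_,
        fun q hq => ?_⟩
      · simp only [Expr.cost, Cond.cost]; omega
      · rw [State.setReg_reg, if_neg (by omega), k₃ y hy, State.setReg_reg, if_neg (by omega),
          State.setReg_reg, if_neg (by omega), g₂ y hy]
      · rw [k₅ y (by omega) (by omega) (by omega) (by omega)]
        exact g₃ y hy
      · rw [k₅ 17 (by omega) (by omega) (by omega) (by omega)]
        exact g₆ q hq
      · rw [k₅ 18 (by omega) (by omega) (by omega) (by omega)]
        exact g₇ q hq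
    · intro hx₀
      simp only [Cond.Holds, Expr.eval, State.setReg_reg, show (16 : ℕ) ≠ 12 by decide,
        show (16 : ℕ) ≠ 13 by decide, if_false, g₁] at hx₀
      refine (wp_matchRun_pair (M := M) (N := N) (a := ar) (b := br) (v := c (bd x))
        (k := bd (x + 1) - bd x) (x := x) (V := otherRuns c bd x) (by omega) (by omega) (by omega)
        (by omega) (by omega)
        (by simp [g₂, hM]) (by simp [g₂, hN]) (by simp [g₁]) (by omega) (by omega)
        (by simp [g₃, h₃]) (by simp [g₃, h₄]) har hbr (by simp [Expr.eval, g₁, e₂, e₁₄])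
        (by simp [Expr.eval, g₁, e₁₄]) (hc _) (by omega) (by omega)
        (by simpa using g₆) (by simpa using g₇)).mono ?_
      rintro t s'' ⟨hts, k₁, k₂, k₃, k₄, k₅⟩
      have hV : firstRun c bd (x + 1) = firstRun c bd x := by
        rw [firstRun, firstRun, min_eq_right (by omega), min_eq_right (by omega)]
      rw [hV, ht.otherRuns_succ (by omega) hx]
      refine ⟨?_, k₄, by simp, fun y hy => ?_, fun y hy => ?_, fun q hq => ?_, fun q hq => ?_,
        k₁, k₂⟩
      · simp only [Expr.cost, Cond.cost]
        rw [add_mul x 1, one_mul]; omega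
      · rw [State.setReg_reg, if_neg (by omega), k₃ y hy, State.setReg_reg, if_neg (by omega),
          State.setReg_reg, if_neg (by omega), g₂ y hy]
      · rw [State.setReg_arr, k₅ y (by omega) (by omega) (by omega) (by omega)]
        exact g₃ y hy
      · rw [State.setReg_arr, k₅ 15 (by omega) (by omega) (by omega) (by omega)]
        exact g₄ q hq
      · rw [State.setReg_arr, k₅ 16 (by omega) (by omega) (by omega) (by omega)]
        exact g₅ q hq
  · have hV : firstRun c bd 0 = [] := by rw [firstRun, Nat.zero_min, ht.zero]; rfl
    have hW : otherRuns c bd 0 = [] := by rw [otherRuns, Nat.zero_min, ht.zero]; rfl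
    simp only [hV, hW, State.setReg_arr]
    refine ⟨by simp [Expr.eval], fun y hy => ?_, fun y hy => ?_, fun q hq => ?_, fun q hq => ?_,
      fun q hq => ?_, fun q hq => ?_⟩
    · rw [State.setReg_reg, if_neg (by omega), r₄ y hy, r₃ y hy, r₂ y hy, r₁ y hy]
    · rw [f₄ y (by omega), f₃ y (by omega), f₂ y (by omega), f₁ y (by omega)]
    · rw [f₄ 15 (by omega), f₃ 15 (by omega), f₂ 15 (by omega), p₁ q hq]; rfl
    · rw [f₄ 16 (by omega), f₃ 16 (by omega), p₂ q hq]; rfl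
    · rw [f₄ 17 (by omega), p₃ q hq]; rfl
    · rw [p₄ q hq]; rfl
  · rintro t s' ⟨htt, -, g₂, g₃, g₄, g₅, g₆, g₇⟩
    simp only [Expr.cost]
    exact ⟨by omega, g₄, g₅, g₆, g₇, g₂, g₃⟩

end WordRAM

/-! ### From cell values to the answer -/

namespace STRICLCS

/-- `out₀` tells whether there is an STR-IC-LCS, and `out₁` is its length. -/
def IsAnswer (A B C : List ℕ) (out₀ out₁ : ℕ) : Prop :=
  (∀ Z, IsSTRICCommonSubseq A B C Z → out₀ = 1 ∧ Z.length ≤ out₁) ∧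
    (out₀ = 0 ∨ out₀ = 1 ∧ ∃ Z, IsSTRICCommonSubseq A B C Z ∧ Z.length = out₁)

theorem isAnswer_zero {A B C : List ℕ} (h : ∀ Z, ¬ IsSTRICCommonSubseq A B C Z) (out₁ : ℕ) :
    IsAnswer A B C 0 out₁ :=
  ⟨fun Z hZ => absurd hZ (h Z), .inl rfl⟩

theorem IsSTRICCommonSubseq.sublist {α : Type*} {A B C Z : List α}
    (h : IsSTRICCommonSubseq A B C Z) : C.Sublist A ∧ C.Sublist B :=
  ⟨h.2.2.sublist.trans h.1, h.2.2.sublist.trans h.2.1⟩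

theorem getD_lt {A : List ℕ} {W : ℕ} (h : ∀ x ∈ A, x < W) (hW : 0 < W) (i : ℕ) :
    A.getD i 0 < W := by
  rcases Nat.lt_or_ge i A.length with hi | hi
  · rw [List.getD_eq_getElem _ _ hi]
    exact h _ (List.getElem_mem hi)
  · rwa [List.getD_eq_default _ _ hi]

theorem isAnswer_of_cellValue {A B C : List ℕ} {ar br st bd : ℕ → ℕ} {best : ℕ}
    (hA₀ : 0 < A.length) (hB₀ : 0 < B.length)
    (hA : IsReverse (fun i => A.getD i 0) ar A.length)
    (hB : IsReverse (fun i => B.getD i 0) br B.length)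
    (ht : IsRunTable (fun i => C.getD i 0) C.length st bd) {V W : List ℕ}
    (hV : V = firstRun (fun i => C.getD i 0) bd
      (Nat.count (NewRun fun i => C.getD i 0) C.length))
    (hW : W = otherRuns (fun i => C.getD i 0) bd
      (Nat.count (NewRun fun i => C.getD i 0) C.length))
    (h₁ : best = 0 ∨ ∃ i ≤ A.length, ∃ j ≤ B.length,
      cellValue (lcs (fun i => A.getD i 0) fun i => B.getD i 0) (lcs ar br)
        (latest (fun i => A.getD i 0) V) (latest (fun i => B.getD i 0) V) (latest ar W)
        (latest br W) A.length B.length C.length i j = best)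
    (h₂ : ∀ i j, 0 < i → i ≤ A.length → 0 < j → j ≤ B.length →
      Special (fun i => A.getD i 0) (fun i => B.getD i 0) A.length B.length i j →
      cellValue (lcs (fun i => A.getD i 0) fun i => B.getD i 0) (lcs ar br)
        (latest (fun i => A.getD i 0) V) (latest (fun i => B.getD i 0) V) (latest ar W)
        (latest br W) A.length B.length C.length i j ≤ best) :
    IsAnswer A B C (if 0 < best then 1 else 0) (best - 1) := by
  obtain ⟨k, v, e₁, e₂, e₃, e₄⟩ := ht.exists_firstRun
  rw [← hV] at e₁
  rw [← hW] at e₂ e₃ e₄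
  rw [pre_getD C le_rfl, List.take_length] at e₂
  constructor
  · intro Z hZ
    obtain ⟨i, j, hi₀, hi, hj₀, hj, hs, hle⟩ := exists_le_cellValue hA hB hA₀ hB₀ e₂ e₃ e₄ hZ
    rw [← e₁] at hle
    have := hle.trans (h₂ i j hi₀ hi hj₀ hj hs)
    rw [if_pos (by omega)]
    omega
  · rcases Nat.eq_zero_or_pos best with h | h
    · left
      rw [h, if_neg (by omega)]
    · right
      rw [if_pos h]
      refine ⟨rfl, ?_⟩
      rcases h₁ with h₁ | ⟨i, hi, j, hj, hval⟩
      · omega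
      -- On the left side `V` is matched in reverse order, which is harmless because the first run
      -- is constant.
      · obtain ⟨Z, hZ, hlen⟩ := exists_of_cellValue (C := C) (V := V) (W := W) hA hB
          (by rw [e₁, List.reverse_replicate]; exact e₂) hi hj (by omega)
        exact ⟨Z, hZ, by omega⟩

end STRICLCS

/-! ### The complete program -/

namespace WordRAM

open STRICLCS

/-- The computation on non-empty strings `A` and `B` with at least as many runs as `C`, whose runs
have been found. -/
def solve : Program :=
  .seq (reverseCopy 0 3 0) <| .seq (reverseCopy 1 4 1) <|
  .seq (findRuns 3 7 12 0 5) <| .seq (findRuns 4 8 13 1 6) <|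
  .seq matchAll <| .seq (fillTable 0 1 5 6 11 4 21) <| .seq (fillTable 3 4 7 8 13 6 22) <|
  .seq maximize <|
  .seq (.ite (.lt (.const 0) (.reg 8)) (.assign 0 (.const 1)) (.assign 0 (.const 0))) <|
  .assign 1 (.sub (.reg 8) (.const 1))

/-- The only term that is not visibly within the bound is `r * (M + N)`; `r ≤ n` and `r ≤ m` turn
its two parts into `n * M` and `m * N`. Lower-order terms are absorbed because all four parameters
are positive. -/
theorem solve_time {M N m n r t₁ t₂ t₃ t₄ t₅ t₆ t₇ t₈ : ℕ} (hM₀ : 0 < M) (hN₀ : 0 < N)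
    (hm₀ : 0 < m) (hn₀ : 0 < n) (hrm : r ≤ m) (hrn : r ≤ n)
    (h₁ : t₁ ≤ 20 * M + 20) (h₂ : t₂ ≤ 20 * N + 20) (h₃ : t₃ ≤ 50 * M + 50)
    (h₄ : t₄ ≤ 50 * N + 50) (h₅ : t₅ ≤ r * (60 * M + 60 * N + 450) + 40 * (M + N) + 250)
    (h₆ : t₆ ≤ ((m + 1) * N + n * (M + 1)) * 140 + 60 * (M + 1) + 20)
    (h₇ : t₇ ≤ ((m + 1) * N + n * (M + 1)) * 140 + 60 * (M + 1) + 20)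
    (h₈ : t₈ ≤ ((m + 1) * N + n * (M + 1)) * 360 + 60 * (M + 1) + 30) :
    t₁ + (t₂ + (t₃ + (t₄ + (t₅ + (t₆ + (t₇ + t₈)))))) ≤ 3900 * (m * N + n * M) := by
  have e₁ : r * M ≤ n * M := Nat.mul_le_mul_right _ hrn
  have e₂ : r * N ≤ m * N := Nat.mul_le_mul_right _ hrm
  have e₃ : N ≤ m * N := Nat.le_mul_of_pos_left _ hm₀
  have e₄ : M ≤ n * M := Nat.le_mul_of_pos_left _ hn₀
  have e₅ : n ≤ n * M := Nat.le_mul_of_pos_right _ hM₀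
  have e₆ : r * (60 * M + 60 * N + 450) = 60 * (r * M) + 60 * (r * N) + 450 * r := by ring
  have e₇ : (m + 1) * N + n * (M + 1) = m * N + N + (n * M + n) := by ring
  rw [e₆] at h₅
  rw [e₇] at h₆ h₇ h₈
  omega

theorem wp_solve {w : ℕ} {A B C : List ℕ} {s : State} (hA₀ : 0 < A.length) (hB₀ : 0 < B.length)
    (hw : (A.length + 1) * (B.length + 1) + 4 * (A.length + B.length + C.length) + 16 < 2 ^ w)
    (hA : ∀ x ∈ A, x < 2 ^ w) (hB : ∀ x ∈ B, x < 2 ^ w) (hC : ∀ x ∈ C, x < 2 ^ w)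
    (hM : s.reg 0 = A.length) (hN : s.reg 1 = B.length) (hK : s.reg 2 = C.length)
    (hn : s.reg 4 = Nat.count (NewRun fun i => B.getD i 0) B.length)
    (hr : s.reg 7 = Nat.count (NewRun fun i => C.getD i 0) C.length)
    (h₀ : s.arr 0 = fun i => A.getD i 0) (h₁ : s.arr 1 = fun i => B.getD i 0)
    (h₂ : s.arr 2 = fun i => C.getD i 0) (h₃ : ∀ i, s.arr 3 i = 0) (h₄ : ∀ i, s.arr 4 i = 0)
    (h₂₁ : ∀ i, s.arr 21 i = 0) (h₂₂ : ∀ i, s.arr 22 i = 0)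
    (hta : IsRunTable (fun i => A.getD i 0) A.length (s.arr 5) (s.arr 10))
    (htb : IsRunTable (fun i => B.getD i 0) B.length (s.arr 6) (s.arr 11))
    (htc : IsRunTable (fun i => C.getD i 0) C.length (s.arr 9) (s.arr 14))
    (hrm : (rle C).length ≤ (rle A).length) (hrn : (rle C).length ≤ (rle B).length) :
    WP w solve s fun t s' =>
      t ≤ 4000 * ((rle A).length * B.length + (rle B).length * A.length) ∧
      IsAnswer A B C (s'.reg 0) (s'.reg 1) := by
  rw [length_rle_eq_count, length_rle_eq_count] at hrm hrn
  rw [length_rle_eq_count, length_rle_eq_count]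
  have hw₀ : 0 < 2 ^ w := by omega
  have ha := getD_lt hA hw₀
  have hb := getD_lt hB hw₀
  have hc := getD_lt hC hw₀
  revert h₀ h₁ h₂ hta htb htc ha hb hc hn hr hrm hrn
  generalize hdA : (fun i => A.getD i 0) = a
  generalize hdB : (fun i => B.getD i 0) = b
  generalize hdC : (fun i => C.getD i 0) = c
  intro hn hr h₀ h₁ h₂ hta htb htc hrm hrn ha hb hc
  replace ha : ∀ i, a i < 2 ^ w := by subst hdA; exact ha
  replace hb : ∀ i, b i < 2 ^ w := by subst hdB; exact hb
  replace hc : ∀ i, c i < 2 ^ w := by subst hdC; exact hc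
  generalize hdM : A.length = M at *
  generalize hdN : B.length = N at *
  generalize hdK : C.length = K at *
  have hNM : N + 1 ≤ (M + 1) * (N + 1) := Nat.le_mul_of_pos_left _ (by omega)
  have hMM : M + 1 ≤ (M + 1) * (N + 1) := Nat.le_mul_of_pos_right _ (by omega)
  refine .seq ((wp_reverseCopy (M := M) (by omega) (by omega) hM (by omega)
    (by rwa [h₀])).mono ?_)
  rintro t₁ s₁ ⟨ht₁, p₁, q₁, r₁, f₁⟩
  refine .seq ((wp_reverseCopy (M := N) (by omega) (by omega) (by simp [r₁, hN]) (by omega)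
    (by simpa [f₁, h₁] using hb)).mono ?_)
  rintro t₂ s₂ ⟨ht₂, p₂, q₂, r₂, f₂⟩
  obtain ⟨ar, har'⟩ : ∃ ar, s₁.arr 3 = ar := ⟨_, rfl⟩
  obtain ⟨br, hbr'⟩ : ∃ br, s₂.arr 4 = br := ⟨_, rfl⟩
  rw [h₀, har'] at p₁
  rw [f₁ 1 (by omega), h₁, hbr'] at p₂
  -- Indices from `M` on matter too: the test for a run end in row `M` reads the character at index
  -- `M`, as both sides of a conjunction are evaluated.
  have har : ∀ i, ar i < 2 ^ w := by
    intro i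
    rcases Nat.lt_or_ge i M with hi | hi
    · rw [p₁ i hi]; exact ha _
    · rw [← har', q₁ i hi, h₃]; exact hw₀
  have hbr : ∀ i, br i < 2 ^ w := by
    intro i
    rcases Nat.lt_or_ge i N with hi | hi
    · rw [p₂ i hi]; exact hb _
    · rw [← hbr', q₂ i hi, f₁ 4 (by omega), h₄]; exact hw₀
  refine .seq ((wp_findRuns (M := M) (by omega) (by omega) (by omega) (by omega) (by omega)
    (by omega) (by simp [r₂, r₁, hM]) (by omega) (by simpa [f₂, har'] using har)).mono ?_)
  rintro t₃ s₃ ⟨ht₃, p₃, q₃, r₃, f₃⟩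
  refine .seq ((wp_findRuns (M := N) (by omega) (by omega) (by omega) (by omega) (by omega)
    (by omega) (by simp [r₃, r₂, r₁, hN]) (by omega) (by simpa [f₃, hbr'] using hbr)).mono ?_)
  rintro t₄ s₄ ⟨ht₄, p₄, q₄, r₄, f₄⟩
  rw [f₂ 3 (by omega), har'] at p₃ q₃
  rw [f₃ 4 (by omega) (by omega), hbr'] at p₄ q₄
  refine .seq ((wp_matchAll (M := M) (N := N) (K := K) (a := a) (b := b) (c := c) (ar := ar)
    (br := br) (bd := s.arr 14) (by omega) (by simp [r₄, r₃, r₂, r₁, hM])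
    (by simp [r₄, r₃, r₂, r₁, hN]) (by simp [r₄, r₃, r₂, r₁, hr])
    (by simp [f₄, f₃, f₂, f₁, h₀]) (by simp [f₄, f₃, f₂, f₁, h₁]) (by simp [f₄, f₃, f₂, f₁, h₂])
    (by simp [f₄, f₃, f₂, har']) (by simp [f₄, f₃, hbr']) (by simp [f₄, f₃, f₂, f₁])
    ha hb hc har hbr htc).mono ?_)
  rintro t₅ s₅ ⟨ht₅, p₅, p₅', q₅, q₅', r₅, f₅⟩
  generalize hdV : firstRun c (s.arr 14) (Nat.count (NewRun c) K) = V at p₅ p₅'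
  generalize hdW : otherRuns c (s.arr 14) (Nat.count (NewRun c) K) = W at q₅ q₅'
  have a₅₀ : s₅.arr 0 = a := by simp [f₅, f₄, f₃, f₂, f₁, h₀]
  have a₅₁ : s₅.arr 1 = b := by simp [f₅, f₄, f₃, f₂, f₁, h₁]
  have a₅₃ : s₅.arr 3 = ar := by simp [f₅, f₄, f₃, f₂, har']
  have a₅₄ : s₅.arr 4 = br := by simp [f₅, f₄, f₃, hbr']
  have a₅₅ : s₅.arr 5 = s.arr 5 := by simp [f₅, f₄, f₃, f₂, f₁]
  have a₅₆ : s₅.arr 6 = s.arr 6 := by simp [f₅, f₄, f₃, f₂, f₁]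
  have a₅₇ : s₅.arr 7 = s₃.arr 7 := by simp [f₅, f₄]
  have a₅₈ : s₅.arr 8 = s₄.arr 8 := by simp [f₅]
  have a₅₁₁ : s₅.arr 11 = s.arr 11 := by simp [f₅, f₄, f₃, f₂, f₁]
  have a₅₁₀ : s₅.arr 10 = s.arr 10 := by simp [f₅, f₄, f₃, f₂, f₁]
  have a₅₁₂ : s₅.arr 12 = s₃.arr 12 := by simp [f₅, f₄]
  have a₅₁₃ : s₅.arr 13 = s₄.arr 13 := by simp [f₅]
  have a₅₂₁ : s₅.arr 21 = s.arr 21 := by simp [f₅, f₄, f₃, f₂, f₁]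
  have a₅₂₂ : s₅.arr 22 = s.arr 22 := by simp [f₅, f₄, f₃, f₂, f₁]
  have x₀ : s₅.reg 0 = M := by simp [r₅, r₄, r₃, r₂, r₁, hM]
  have x₁ : s₅.reg 1 = N := by simp [r₅, r₄, r₃, r₂, r₁, hN]
  have x₂ : s₅.reg 2 = K := by simp [r₅, r₄, r₃, r₂, r₁, hK]
  have x₄ : s₅.reg 4 = Nat.count (NewRun b) N := by simp [r₅, r₄, r₃, r₂, r₁, hn]
  have x₆ : s₅.reg 6 = Nat.count (NewRun br) N := by simp [r₅, q₄]
  clear f₅ f₄ f₃ f₂ f₁ r₅ r₄ r₃ r₂ r₁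
  refine .seq ((wp_fillTable (M := M) (N := N) (bda := 10) hA₀ (by omega) x₀ x₁ (by omega)
    (by rw [a₅₁, x₄]) (by omega) (by omega) (by omega) (by omega) (by omega) (by rwa [a₅₀])
    (by rwa [a₅₁]) (by rwa [a₅₀, a₅₅, a₅₁₀]) (by rwa [a₅₁, a₅₆, a₅₁₁]) (by rwa [a₅₂₁])).mono ?_)
  rintro t₆ s₆ ⟨ht₆, p₆, q₆, r₆, f₆⟩
  rw [a₅₀, a₅₁] at ht₆ p₆
  refine .seq ((wp_fillTable (M := M) (N := N) (bda := 12) hA₀ (by omega) (by simp [r₆, x₀])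
    (by simp [r₆, x₁]) (by omega) (by simp [r₆, f₆, x₆, a₅₄]) (by omega) (by omega) (by omega)
    (by omega) (by omega) (by simpa [f₆, a₅₃] using har) (by simpa [f₆, a₅₄] using hbr)
    (by simpa [f₆, a₅₃, a₅₇, a₅₁₂] using p₃) (by simpa [f₆, a₅₄, a₅₈, a₅₁₃] using p₄)
    (by simpa [f₆, a₅₂₂] using h₂₂)).mono ?_)
  rintro t₇ s₇ ⟨ht₇, p₇, q₇, r₇, f₇⟩
  rw [f₆ 3 (by omega), f₆ 4 (by omega), a₅₃, a₅₄] at ht₇ p₇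
  -- The cost of the table for the reversed strings is expressed by the numbers of runs of `A` and
  -- `B`.
  rw [count_newRun_reverse p₁, count_newRun_reverse p₂] at ht₇
  refine .seq ((wp_maximize (M := M) (N := N) (K := K) (a := a) (b := b) (ar := ar) (br := br)
    (P := latest a V) (Q := latest b V) (P' := latest ar W) (Q' := latest br W) hA₀ hw
    (by simp [r₇, r₆, x₀]) (by simp [r₇, r₆, x₁]) (by simp [r₇, r₆, x₂]) (by simp [r₇, r₆, x₄])
    (by simp [f₇, f₆, a₅₀]) (by simp [f₇, f₆, a₅₁]) (by simp [f₇, f₆, a₅₃])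
    (by simp [f₇, f₆, a₅₄]) ha hb har hbr (by simpa [f₇, f₆, a₅₅] using hta.st_eq)
    (by simpa [f₇, f₆, a₅₆, a₅₁₁] using htb) (by simpa [f₇, f₆, a₅₇] using p₃.st_eq)
    (by simpa [f₇, f₆, a₅₈] using p₄.st_eq) (by simpa [f₇, f₆] using p₅)
    (by simpa [f₇, f₆] using p₅') (by simpa [f₇, f₆] using q₅) (by simpa [f₇, f₆] using q₅')
    (latest_le _ _) (latest_le _ _) (latest_le _ _) (latest_le _ _)
    (by simpa [f₇] using p₆) (by simpa [f₇] using q₆) p₇ q₇).mono ?_)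
  rintro t₈ s₈ ⟨ht₈, p₈, q₈⟩
  have hbest : s₈.reg 8 < 2 ^ w := by
    rcases p₈ with h | ⟨i, hi, j, -, h⟩
    · omega
    · rw [← h]
      exact (cellValue_le hi (latest_le _ _) (latest_le _ _)).trans_lt (by omega)
  have hm₀ : 0 < Nat.count (NewRun a) M := by
    by_contra h0
    have h0' : Nat.count (NewRun a) M = 0 := by omega
    have := hta.last
    rw [h0', hta.zero] at this
    omega
  have hn₀ : 0 < Nat.count (NewRun b) N := by
    by_contra h0
    have h0' : Nat.count (NewRun b) N = 0 := by omega
    have := htb.last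
    rw [h0', htb.zero] at this
    omega
  have htime := solve_time hA₀ hB₀ hm₀ hn₀ hrm hrn ht₁ ht₂ ht₃ ht₄ ht₅ ht₆ ht₇ ht₈
  have hpos : 1 ≤ Nat.count (NewRun b) N * M := Nat.mul_pos hn₀ hA₀
  have hans : IsAnswer A B C (if 0 < s₈.reg 8 then 1 else 0) (s₈.reg 8 - 1) := by
    subst hdA hdB hdC hdM hdN hdK
    exact isAnswer_of_cellValue hA₀ hB₀ p₁ p₂ htc hdV.symm hdW.symm p₈ q₈
  refine .seq (.ite ?_ ?_ ?_)
  · simp only [Cond.Fits, Expr.Fits]; omega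
  · intro h
    simp only [Cond.Holds, Expr.eval] at h
    rw [if_pos h] at hans
    refine .assign (by simp only [Expr.Fits]; omega) (.assign ?_ ?_)
    · simp only [Expr.Fits, State.setReg_reg]; rw [if_neg (by omega)]; omega
    · simp only [Expr.cost, Cond.cost]
      exact ⟨by omega, by simpa [Expr.eval] using hans⟩
  · intro h
    simp only [Cond.Holds, Expr.eval] at h
    rw [if_neg h] at hans
    refine .assign (by simp only [Expr.Fits]; omega) (.assign ?_ ?_)
    · simp only [Expr.Fits, State.setReg_reg]; rw [if_neg (by omega)]; omega
    · simp only [Expr.cost, Cond.cost]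
      exact ⟨by omega, by simpa [Expr.eval] using hans⟩

/-- The program that computes the length of an STR-IC-LCS. -/
def striclcs : Program :=
  .ite (.and (.lt (.const 0) (.reg 0)) (.lt (.const 0) (.reg 1)))
    (.ite (.lt (.reg 0) (.reg 2)) (.assign 0 (.const 0)) <|
      .seq (findRuns 0 5 10 0 3) <| .seq (findRuns 1 6 11 1 4) <| .seq (findRuns 2 9 14 2 7) <|
      .ite (.lt (.reg 3) (.reg 7)) (.assign 0 (.const 0)) <|
      .ite (.lt (.reg 4) (.reg 7)) (.assign 0 (.const 0)) solve)
    (.ite (.eq (.reg 2) (.const 0)) (.seq (.assign 0 (.const 1)) (.assign 1 (.const 0)))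
      (.assign 0 (.const 0)))

theorem wp_striclcs {w : ℕ} {A B C : List ℕ}
    (hw : (A.length + 1) * (B.length + 1) + 4 * (A.length + B.length + C.length) + 16 < 2 ^ w)
    (hA : ∀ x ∈ A, x < 2 ^ w) (hB : ∀ x ∈ B, x < 2 ^ w) (hC : ∀ x ∈ C, x < 2 ^ w) :
    WP w striclcs (input id A B C) fun t s' =>
      t ≤ 5000 * ((rle A).length * B.length + (rle B).length * A.length + 1) ∧
      IsAnswer A B C (s'.reg 0) (s'.reg 1) := by
  obtain ⟨s, hs⟩ : ∃ s, input id A B C = s := ⟨_, rfl⟩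
  have hM : s.reg 0 = A.length := by rw [← hs]; rfl
  have hN : s.reg 1 = B.length := by rw [← hs]; rfl
  have hK : s.reg 2 = C.length := by rw [← hs]; rfl
  have h₀ : s.arr 0 = fun i => A.getD i 0 := by rw [← hs]; simp [input]
  have h₁ : s.arr 1 = fun i => B.getD i 0 := by rw [← hs]; simp [input]
  have h₂ : s.arr 2 = fun i => C.getD i 0 := by rw [← hs]; simp [input]
  have h₃ : ∀ y i, 2 < y → s.arr y i = 0 := by
    intro y i hy
    rw [← hs]
    obtain ⟨y, rfl⟩ := Nat.exists_eq_add_of_lt hy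
    rw [show 2 + y + 1 = y + 3 by ring]
    rfl
  rw [hs]
  clear hs
  have hw₀ : 0 < 2 ^ w := by omega
  have hNM : B.length + 1 ≤ (A.length + 1) * (B.length + 1) := Nat.le_mul_of_pos_left _ (by omega)
  have hMM : A.length + 1 ≤ (A.length + 1) * (B.length + 1) := Nat.le_mul_of_pos_right _ (by omega)
  refine .ite ?_ ?_ ?_
  · simp only [Cond.Fits, Expr.Fits]; omega
  · intro hpos
    simp only [Cond.Holds, Expr.eval, hM, hN] at hpos
    refine .ite ?_ ?_ ?_
    · simp only [Cond.Fits, Expr.Fits]; omega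
    -- Testing `|A| < |C|` before looking at `C` is essential for the time bound, which does not
    -- contain `|C|`; afterwards `|C| ≤ |A|`.
    · intro hlt
      simp only [Cond.Holds, Expr.eval, hM, hK] at hlt
      refine .assign (by simp only [Expr.Fits]; omega) ⟨by simp only [Cond.cost, Expr.cost]; omega, ?_⟩
      simp only [Expr.eval, State.setReg_reg, if_true]
      refine isAnswer_zero (fun Z hZ => ?_) _
      have := hZ.sublist.1.length_le
      omega
    · intro hlt
      simp only [Cond.Holds, Expr.eval, hM, hK] at hlt
      refine .seq ((wp_findRuns (by omega) (by omega) (by omega) (by omega) (by omega) (by omega)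
        hM (by omega) (by rw [h₀]; exact getD_lt hA hw₀)).mono ?_)
      rintro t₁ s₁ ⟨ht₁, p₁, q₁, r₁, f₁⟩
      refine .seq ((wp_findRuns (M := B.length) (by omega) (by omega) (by omega) (by omega)
        (by omega) (by omega) (by simp [r₁, hN]) (by omega)
        (by simpa [f₁, h₁] using getD_lt hB hw₀)).mono ?_)
      rintro t₂ s₂ ⟨ht₂, p₂, q₂, r₂, f₂⟩
      refine .seq ((wp_findRuns (M := C.length) (by omega) (by omega) (by omega) (by omega)
        (by omega) (by omega) (by simp [r₂, r₁, hK]) (by omega)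
        (by simpa [f₂, f₁, h₂] using getD_lt hC hw₀)).mono ?_)
      rintro t₃ s₃ ⟨ht₃, p₃, q₃, r₃, f₃⟩
      rw [h₀] at p₁ q₁
      rw [f₁ 1 (by omega) (by omega), h₁] at p₂ q₂
      rw [f₂ 2 (by omega) (by omega), f₁ 2 (by omega) (by omega), h₂] at p₃ q₃
      have x₃ : s₃.reg 3 = (rle A).length := by
        rw [r₃ 3 (by omega) (by omega), r₂ 3 (by omega) (by omega), q₁, length_rle_eq_count]
      have x₄ : s₃.reg 4 = (rle B).length := by
        rw [r₃ 4 (by omega) (by omega), q₂, length_rle_eq_count]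
      have x₇ : s₃.reg 7 = (rle C).length := by rw [q₃, length_rle_eq_count]
      have b₃ : (rle A).length ≤ A.length := by
        rw [length_rle_eq_count]; exact Nat.count_le _
      have b₄ : (rle B).length ≤ B.length := by
        rw [length_rle_eq_count]; exact Nat.count_le _
      have b₇ : (rle C).length ≤ C.length := by
        rw [length_rle_eq_count]; exact Nat.count_le _
      -- A non-empty string has at least one run, so `|A|` and `|B|` are within the allowed time.
      have hpos' : ∀ {D : List ℕ}, 0 < D.length → 0 < (rle D).length := by
        intro D hD
        have := length_rle_mono (l₁ := [D[0]]) (l₂ := D) (by simp)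
        rw [length_rle_singleton] at this
        omega
      have e₁ : B.length ≤ (rle A).length * B.length := Nat.le_mul_of_pos_left _ (hpos' hpos.1)
      have e₂ : A.length ≤ (rle B).length * A.length := Nat.le_mul_of_pos_left _ (hpos' hpos.2)
      refine .ite ?_ ?_ ?_
      · simp only [Cond.Fits, Expr.Fits, x₃, x₇]; omega
      · intro hl
        simp only [Cond.Holds, Expr.eval, x₃, x₇] at hl
        refine .assign (by simp only [Expr.Fits]; omega)
          ⟨by simp only [Cond.cost, Expr.cost]; omega, ?_⟩
        simp only [Expr.eval, State.setReg_reg, if_true]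
        refine isAnswer_zero (fun Z hZ => ?_) _
        have := length_rle_mono hZ.sublist.1
        omega
      intro hl
      simp only [Cond.Holds, Expr.eval, x₃, x₇] at hl
      refine .ite ?_ ?_ ?_
      · simp only [Cond.Fits, Expr.Fits, x₄, x₇]; omega
      · intro hl'
        simp only [Cond.Holds, Expr.eval, x₄, x₇] at hl'
        refine .assign (by simp only [Expr.Fits]; omega)
          ⟨by simp only [Cond.cost, Expr.cost]; omega, ?_⟩
        simp only [Expr.eval, State.setReg_reg, if_true]
        refine isAnswer_zero (fun Z hZ => ?_) _
        have := length_rle_mono hZ.sublist.2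
        omega
      intro hl'
      simp only [Cond.Holds, Expr.eval, x₄, x₇] at hl'
      have z : ∀ y i, 14 < y ∨ y = 3 ∨ y = 4 → s₃.arr y i = 0 := by
        intro y i hy
        rw [f₃ y (by omega) (by omega), f₂ y (by omega) (by omega), f₁ y (by omega) (by omega),
          h₃ y i (by omega)]
      refine (wp_solve hpos.1 hpos.2 hw hA hB hC (by simp [r₃, r₂, r₁, hM])
        (by simp [r₃, r₂, r₁, hN]) (by simp [r₃, r₂, r₁, hK]) (by simp [r₃, q₂]) q₃
        (by simp [f₃, f₂, f₁, h₀]) (by simp [f₃, f₂, f₁, h₁]) (by simp [f₃, f₂, f₁, h₂])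
        (fun i => z 3 i (by omega)) (fun i => z 4 i (by omega)) (fun i => z 21 i (by omega))
        (fun i => z 22 i (by omega)) (by simpa [f₃, f₂] using p₁) (by simpa [f₃] using p₂) p₃
        (by omega) (by omega)).mono ?_
      rintro t₄ s₄ ⟨ht₄, h⟩
      simp only [Cond.cost, Expr.cost]
      exact ⟨by omega, h⟩
  -- If `A` or `B` is empty, then the empty string is the only common subsequence, and it is a
  -- solution exactly for empty `C`.
  · intro hpos
    simp only [Cond.Holds, Expr.eval, hM, hN] at hpos
    refine .ite ?_ ?_ ?_
    · simp only [Cond.Fits, Expr.Fits]; omega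
    · intro hK₀
      simp only [Cond.Holds, Expr.eval, hK] at hK₀
      refine .seq (.assign (by simp only [Expr.Fits]; omega)
        (.assign (by simp only [Expr.Fits]; omega) ?_))
      refine ⟨by simp only [Cond.cost, Expr.cost]; omega, ?_⟩
      obtain rfl := List.eq_nil_of_length_eq_zero hK₀
      refine ⟨fun Z hZ => ⟨by simp [Expr.eval], ?_⟩, .inr ⟨by simp [Expr.eval], [], ?_, ?_⟩⟩
      · have l₁ := hZ.1.length_le
        have l₂ := hZ.2.1.length_le
        omega
      · exact ⟨by simp, by simp, by simp⟩
      · simp [Expr.eval]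
    · intro hK₀
      simp only [Cond.Holds, Expr.eval, hK] at hK₀
      refine .assign (by simp only [Expr.Fits]; omega)
        ⟨by simp only [Cond.cost, Expr.cost]; omega, ?_⟩
      simp only [Expr.eval, State.setReg_reg, if_true]
      refine isAnswer_zero (fun Z hZ => ?_) _
      have l₁ := hZ.sublist.1.length_le
      have l₂ := hZ.sublist.2.length_le
      omega

theorem input_map {α : Type*} (code : α → ℕ) (A B C : List α) :
    input code A B C = input id (A.map code) (B.map code) (C.map code) := by
  simp [input]

end WordRAM

/-! ### Transfer to arbitrary alphabets -/

namespace STRICLCS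

theorem IsSTRICCommonSubseq.map {α β : Type*} {A B C Z : List α} (f : α → β)
    (h : IsSTRICCommonSubseq A B C Z) :
    IsSTRICCommonSubseq (A.map f) (B.map f) (C.map f) (Z.map f) :=
  ⟨h.1.map f, h.2.1.map f, h.2.2.map f⟩

/-- A subsequence of an image is itself an image, and injectivity makes the preimages taken in `A`
and in `B`, and that of the copy of `C`, agree. -/
theorem exists_of_isSTRICCommonSubseq_map {α β : Type*} {A B C : List α} {f : α → β}
    (hf : Function.Injective f) {Y : List β}
    (h : IsSTRICCommonSubseq (A.map f) (B.map f) (C.map f) Y) :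
    ∃ Z, IsSTRICCommonSubseq A B C Z ∧ Z.length = Y.length := by
  obtain ⟨hA, hB, X, X', hC⟩ := h
  obtain ⟨Z, hZA, rfl⟩ := List.sublist_map_iff.1 hA
  obtain ⟨Z', hZB, e⟩ := List.sublist_map_iff.1 hB
  obtain rfl := List.map_injective_iff.2 hf e
  obtain ⟨Z₁, Z₃, rfl, h₁, rfl⟩ := List.map_eq_append_iff.1 hC.symm
  obtain ⟨Z₀, Z₂, rfl, rfl, h₂⟩ := List.map_eq_append_iff.1 h₁
  obtain rfl := List.map_injective_iff.2 hf h₂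
  exact ⟨_, ⟨hZA, hZB, _, _, rfl⟩, by simp⟩

/-- Without a longest solution there would be arbitrarily long ones, but all are subsequences of
`A`. -/
theorem exists_isSTRICLCS {α : Type*} {A B C Z : List α} (h : IsSTRICCommonSubseq A B C Z) :
    ∃ Z, IsSTRICLCS A B C Z := by
  by_contra hcon
  have key : ∀ k, ∃ Z, IsSTRICCommonSubseq A B C Z ∧ k ≤ Z.length := by
    intro k
    induction k with
    | zero => exact ⟨Z, h, Nat.zero_le _⟩
    | succ k ih =>
      obtain ⟨Z, hZ, hk⟩ := ih
      by_contra hno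
      refine hcon ⟨Z, hZ, fun Z' hZ' => ?_⟩
      by_contra hlt
      exact hno ⟨Z', hZ', by omega⟩
  obtain ⟨Z, hZ, hk⟩ := key (A.length + 1)
  have := hZ.1.length_le
  omega

/-- The left side covers the addresses of the quadratic tables and all lengths that occur. With `S =
M + N + K + 2 ≥ 2` it is below `16 * S ^ 2`, and `16 ≤ S ^ 4`; this gives the exponent `6`. -/
theorem size_bound {M N K w : ℕ} (h : (M + N + K + 2) ^ 6 ≤ 2 ^ w) :
    (M + 1) * (N + 1) + 4 * (M + N + K) + 16 < 2 ^ w := by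
  refine lt_of_lt_of_le ?_ h
  obtain ⟨S, hS⟩ : ∃ S, M + N + K + 2 = S := ⟨_, rfl⟩
  rw [hS]
  have h₁ : (M + 1) * (N + 1) ≤ S * S := Nat.mul_le_mul (by omega) (by omega)
  have h₂ : 2 * S ≤ S * S := Nat.mul_le_mul_right _ (by omega)
  have h₃ : 4 * 4 ≤ (S * S) * (S * S) := Nat.mul_le_mul (by omega) (by omega)
  have h₄ : 16 * (S * S) ≤ (S * S) * (S * S) * (S * S) := Nat.mul_le_mul_right _ h₃
  have h₅ : S ^ 6 = (S * S) * (S * S) * (S * S) := by ring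
  omega

end STRICLCS

theorem theorem3 :
    ∃ (P : WordRAM.Program) (c d : ℕ),
      ∀ (α : Type*) [DecidableEq α] (A B C : List α) (w : ℕ) (code : α → ℕ),
        Function.Injective code → (∀ a, code a < 2 ^ w) →
        (A.length + B.length + C.length + 2) ^ d ≤ 2 ^ w →
        ∃ (t : ℕ) (s : WordRAM.State),
          WordRAM.Exec w P (WordRAM.input code A B C) t s ∧
          t ≤ c * ((rle A).length * B.length + (rle B).length * A.length + 1) ∧
          (∀ Z : List α, IsSTRICLCS A B C Z → s.reg 0 = 1 ∧ s.reg 1 = Z.length) ∧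
          ((¬ ∃ Z : List α, IsSTRICLCS A B C Z) → s.reg 0 = 0) := by
  refine ⟨WordRAM.striclcs, 5000, 6, fun α _ A B C w code hinj hlt hw => ?_⟩
  have hmem : ∀ (D : List α), ∀ x ∈ D.map code, x < 2 ^ w := by
    intro D x hx
    obtain ⟨a, -, rfl⟩ := List.mem_map.1 hx
    exact hlt a
  obtain ⟨t, s, hexec, ht, h₁, h₂⟩ := WordRAM.wp_striclcs (A := A.map code) (B := B.map code)
    (C := C.map code) (by simpa using STRICLCS.size_bound hw) (hmem A) (hmem B) (hmem C)
  refine ⟨t, s, ?_, ?_, fun Z hZ => ?_, fun hno => ?_⟩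
  · rwa [WordRAM.input_map]
  · simpa [STRICLCS.length_rle_map hinj] using ht
  · obtain ⟨hone, hle⟩ := h₁ _ (STRICLCS.IsSTRICCommonSubseq.map code hZ.1)
    rcases h₂ with h₀ | ⟨-, Y, hY, hlen⟩
    · omega
    · obtain ⟨Z', hZ', hlen'⟩ := STRICLCS.exists_of_isSTRICCommonSubseq_map hinj hY
      have := hZ.2 Z' hZ'
      rw [List.length_map] at hle
      exact ⟨hone, by omega⟩
  · rcases h₂ with h₀ | ⟨-, Y, hY, -⟩
    · exact h₀
    · obtain ⟨Z', hZ', -⟩ := STRICLCS.exists_of_isSTRICCommonSubseq_map hinj hY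
      exact absurd (STRICLCS.exists_isSTRICLCS hZ') hno
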